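/- **Setting.** Let $\kappa>0$ ($\kappa=16\pi G$), $\lambda\neq0$ and let $V:\mathbb R\to\mathbb R$ be smooth. The extended ADM phase space over $\mathbb R^3$ has the canonical pairs $(q_{ab},P^{ab})$, $(N,\Pi)$, $(N^a,\Pi_a)$, $(\varphi,\pi_\varphi)$ with $\{q_{ab},P^{cd}\}=\kappa\,\delta_{(a}^c\delta_{b)}^d\delta$, $\{\varphi,\pi_\varphi\}=\delta$, $\{N,\Pi\}=\kappa\,\delta$, $\{N^a,\Pi_b\}=\kappa\,\delta^a_b\delta$, the secondary constraints (multiplied by $\kappa$) $$C=\tfrac1{\sqrt q}\big(P_{ab}P^{ab}-\tfrac12(P^a{}_a)^2\big)-\sqrt q\,R+\kappa\Big(\tfrac{\lambda\pi_\varphi^2}{2\sqrt q}+\tfrac{\sqrt q}{2\lambda}\big(q^{ab}\partial_a\varphi\,\partial_b\varphi+V(\varphi)\big)\Big),\qquad C_a=-2q_{ac}D_bP^{bc}+\kappa\,\pi_\varphi\partial_a\varphi,$$ the primary constraints $\Pi,\Pi_a$, and the canonical Hamiltonian $H_{\rm can}=\frac1\kappa\int(NC+N^aC_a+\ell\,\Pi+\ell^a\Pi_a)$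 with Lagrange multipliers $\ell,\ell^a$. Let $\bar q_{ab}=A\delta_{ab}$, $\bar P^{ab}=\tilde P\delta^{ab}$, $\bar N$, $\bar N^a=0$, $\bar\varphi$, $\bar\pi_\varphi$, with vanishing $\bar\Pi,\bar\Pi_a$, be a smooth flat FLRW background on an open set $I$ of times, where $A,\bar N>0$, $\tilde P=-\dot A/(\bar N\sqrt A)$ and $\tilde{\mathcal H}=\dot A/(2A)\ne0$. With $\rho,p=\frac12\big(\lambda\bar\pi_\varphi^2/A^3\pm V(\bar\varphi)/\lambda\big)$ it satisfies $$\dot{\bar\varphi}=\tfrac{\lambda\bar N}{A^{3/2}}\bar\pi_\varphi,\quad \dot{\bar\pi}_\varphi=-\tfrac{\bar NA^{3/2}}{2\lambda}V'(\bar\varphi),\quad \tilde{\mathcal H}^2=\tfrac\kappa6\bar N^2\rho,\quad \dot{\tilde{\mathcal H}}=\tfrac{\dot{\bar N}}{\bar N}\tilde{\mathcal H}-\tfrac32\tilde{\mathcal H}^2-\tfrac\kappa4\bar N^2p .$$ Scalar perturbations are $\delta q_{ab}=2A(\psi\delta_{ab}+E_{,<ab>})$, $\delta P^{ab}=2\tilde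 P(p_\psi\delta^{ab}+p_E{}^{,<ab>})$, $\delta N=\bar N\phi$, $\delta\Pi=\bar Np_\phi$, $\delta N^a=B^{,a}$, $\delta\Pi_a=(p_B)_{,a}$, $\delta\varphi$, $\delta\pi_\varphi$, where $f_{,<ab>}=\partial_a\partial_bf-\frac13\delta_{ab}\Delta f$ and $\Delta$ is the flat Laplacian. All scalars are smooth and tend to $0$ at spatial infinity with all spatial derivatives; along time-dependent solutions they are jointly smooth and the same decay holds for their first time derivatives. Their dynamics is Hamilton's equations generated by the second-order part of $H_{\rm can}$ at the background (with multipliers $\ell=\dot{\bar N}+\delta\lambda$, $\ell^a=\partial^a\delta\hat\lambda$). The symbol $\approx$ means equality along solutions lying on the linearized constraint surface $\delta C=0$, $\delta C_a=0$, $\delta\Pi=0$, $\delta\Pi_a=0$. **Observables.** The clocks of the spatially flat gauge are $\delta T^0=\frac{\bar N}{\tilde{\mathcal H}}(\psi-\frac13\Delta E)$ and $\delta T^a=\delta^{ab}E_{,b}$. For the gauge conditions $\mathfrak G=(-\delta T^\mu,-\delta\dot T^\mu)$ and constraints $\mathfrak C=(C_\mu,\Pi_\mu)$, the linearized observable map is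 $\mathcal O_f=f+\int\mathfrak G^I\{f,\mathfrak B^J{}_I\mathfrak C_J\}$, $\mathfrak B=\mathfrak A^{-1}$, $\mathfrak A=-\{\mathfrak G,\mathfrak C\}$, with brackets evaluated at the background. Put $$\Psi=\psi+\tfrac{4\tilde{\mathcal H}^2A}{\bar N^2}(E+p_E)-\tfrac13\Delta E,\qquad \Upsilon=p_\psi+\tfrac12\Delta E+\tfrac23\Delta p_E-\Big(\tfrac{\tilde{\mathcal H}^2A}{\bar N^2}+\tfrac{\kappa A}2p\Big)(E+p_E),\qquad Q=\tfrac12+\tfrac\kappa4\tfrac{\bar N^2p}{\tilde{\mathcal H}^2}.$$ **Claim.** (1) $\{\delta T^\mu,C_\nu\}$ is the identity (with respect to the brackets normalized by $\frac1\kappa\int\xi^\nu C_\nu$), the observable map is well defined, and it is given by $\mathcal O_\psi=\mathcal O_E=0$, $\mathcal O_{p_E}=\Psi/\tilde P^2$, $\mathcal O_{p_\psi}=\Upsilon+\big(\frac14+\frac{\kappa Ap}{2\tilde P^2}-\frac{2}{3\tilde P^2}\Delta\big)\Psi$, $\mathcal O_\phi=-2\Upsilon-Q\Psi$, $\mathcal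 O_B=\frac{\bar N^2}{A\tilde{\mathcal H}}\Psi$, $\mathcal O_{p_\phi}=p_\phi$, $\mathcal O_{p_B}=p_B$ and $$v:=\mathcal O_{\delta\varphi}=\delta\varphi-\tfrac{\lambda\bar N\bar\pi_\varphi}{A^{3/2}\tilde{\mathcal H}}\big(\psi-\tfrac13\Delta E\big),\qquad \pi_v:=\mathcal O_{\delta\pi_\varphi}=\delta\pi_\varphi-\bar\pi_\varphi\Delta E+\tfrac{A^{3/2}}{2\lambda}V'(\bar\varphi)\tfrac{\bar N}{\tilde{\mathcal H}}\big(\psi-\tfrac13\Delta E\big).$$ (2) The observables are again smooth and decaying in the above sense, and $\frac{d}{dt}\mathcal O_f\approx\mathcal O_{\{f,H_{\rm can}\}}$ for all these variables $f$: the observables satisfy the linearized Hamilton equations, with the multiplier perturbations $$\mathcal O_{\delta\lambda}=-\Big(\dot{\bar N}+\tfrac\kappa2\tfrac{\bar N^3p}{\tilde{\mathcal H}}\Big)(2\Upsilon+Q\Psi)+\tfrac\kappa4\tfrac{\bar N^3}{\tilde{\mathcal H}}\delta\mathcal T,\qquad \mathcal O_{\delta\hat\lambda}=\Big(\tfrac{\dot{\bar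 N}\bar N}{A\tilde{\mathcal H}}-\tfrac{3\bar N^2}{A}\Big)\Psi+\tfrac{\bar N^2}A(2\Upsilon+Q\Psi),$$ where $\delta\mathcal T=\frac{\lambda\bar\pi_\varphi}{A^3}\pi_v-\frac{1}{2\lambda}V'(\bar\varphi)v$. Explicitly, $\frac d{dt}$ of $\mathcal O_\psi,\mathcal O_E,\mathcal O_{p_\phi},\mathcal O_{p_B}$ is $\approx0$, $\frac d{dt}\mathcal O_B\approx\mathcal O_{\delta\hat\lambda}$, and $$\begin{aligned} \tfrac d{dt}\mathcal O_\phi&\approx-\tfrac\kappa2\tfrac{\bar N^2p}{\tilde{\mathcal H}}(2\Upsilon+Q\Psi)+\tfrac\kappa4\tfrac{\bar N^2}{\tilde{\mathcal H}}\delta\mathcal T,\\ \tfrac d{dt}\mathcal O_{p_\psi}&\approx\Big(\tfrac{\bar N^2}{6A\tilde{\mathcal H}}-\tfrac{\kappa}{12}\tfrac{\bar N^4p}{A\tilde{\mathcal H}^3}\Big)\Delta\Psi+\Big(\tfrac\kappa8\tfrac{\bar N^2p}{\tilde{\mathcal H}}+\tfrac{\kappa^2}{16}\tfrac{\bar N^4p^2}{\tilde{\mathcal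 H}^3}\Big)\Psi-\tfrac{\bar N^2}{3A\tilde{\mathcal H}}\Delta\Upsilon+\tfrac\kappa2\tfrac{\bar N^2p}{\tilde{\mathcal H}}\Upsilon-\tfrac\kappa8\tfrac{\bar N^2}{\tilde{\mathcal H}}\delta\mathcal T,\\ \tfrac d{dt}\mathcal O_{p_E}&\approx\tfrac{\bar N^2}{2A\tilde{\mathcal H}}\Upsilon+\Big(\tfrac\kappa8\tfrac{\bar N^4p}{A\tilde{\mathcal H}^3}-\tfrac{\bar N^2}{4A\tilde{\mathcal H}}\Big)\Psi,\\ \dot v&\approx\tfrac{\lambda\bar N}{A^{3/2}}\big(-\bar\pi_\varphi(2\Upsilon+Q\Psi)+\pi_v\big),\\ \dot\pi_v&\approx\tfrac{\bar NA^{3/2}}{\lambda}\Big(\tfrac1A\Delta v-\tfrac12V''(\bar\varphi)v+V'(\bar\varphi)\big(\Upsilon+\tfrac12Q\Psi\big)\Big)+\bar\pi_\varphi\tfrac{\bar N^2}{A\tilde{\mathcal H}}\Delta\Psi . \end{aligned}$$ (3) The Mukhanov–Sasaki variable $v=\mathcal O_{\delta\varphi}$ satisfies $$\ddot v\approx\frac{\bar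 N^2}{A}\Delta v+\Big(\frac{\dot{\bar N}}{\bar N}-3\tilde{\mathcal H}\Big)\dot v+\Big(\frac{\kappa^2}{8}\frac{\dot{\bar\varphi}^4}{\lambda^2\tilde{\mathcal H}^2}-\frac{3\kappa}{2}\frac{\dot{\bar\varphi}^2}{\lambda}-\frac\kappa2\frac{\bar N^2\dot{\bar\varphi}}{\lambda\tilde{\mathcal H}}V'(\bar\varphi)-\frac{\bar N^2}{2}V''(\bar\varphi)\Big)v .$$ (4) In proper time ($\bar N\equiv1$ on $I$) and with the usual potential $U=V/2$, this agrees with the standard form of the Mukhanov–Sasaki equation, $$\ddot v+3\tilde{\mathcal H}\dot v-\frac1A\Delta v+\Big(U''(\bar\varphi)-\frac{\kappa}{2\lambda}\frac1{A^{3/2}}\frac{d}{dt}\Big(\frac{A^{3/2}\dot{\bar\varphi}^2}{\tilde{\mathcal H}}\Big)\Big)v\approx0 .$$ -/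

import Mathlib

open scoped ContDiff

namespace CosmoPert

noncomputable section

/-! ### Flat space, partial derivatives, admissible fields -/

/-- The spatial slice `ℝ³`. -/
abbrev Space : Type := EuclideanSpace ℝ (Fin 3)

/-- Partial derivative in the direction of the coordinate `a`. -/
def pd (a : Fin 3) (f : Space → ℝ) (x : Space) : ℝ :=
  fderiv ℝ f x (EuclideanSpace.single a 1)

/-- The flat Laplacian (with respect to `δ_{ab}`). -/
def lap (f : Space → ℝ) : Space → ℝ := Laplacian.laplacian f

/-- `f_{,<ab>} = ∂_a ∂_b f - (1/3) δ_{ab} Δ f`. -/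
def traceless (f : Space → ℝ) (a b : Fin 3) (x : Space) : ℝ :=
  pd a (pd b f) x - if a = b then lap f x / 3 else 0

/-- Smooth functions all of whose derivatives tend to zero at spatial infinity. On these the
scalar-vector-tensor decomposition (equivalently the inverse Laplacian) has no zero modes. -/
def Decaying (f : Space → ℝ) : Prop :=
  ContDiff ℝ ∞ f ∧
    ∀ n : ℕ, Filter.Tendsto (fun x => iteratedFDeriv ℝ n f x) (Filter.cocompact Space) (nhds 0)

/-! ### The extended ADM phase space of gravity with a scalar field -/

/-- A point of the extended ADM phase space: `(q_{ab}, P^{ab})`, `(N, Π)`, `(N^a, Π_a)`,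
`(φ, π_φ)`. Symmetry of `q` and `P` is imposed on variations, see `IsTestVariation`. -/
structure PhasePoint where
  q : Space → Matrix (Fin 3) (Fin 3) ℝ
  P : Space → Matrix (Fin 3) (Fin 3) ℝ
  N : Space → ℝ
  PiN : Space → ℝ
  shift : Space → Fin 3 → ℝ
  PiShift : Space → Fin 3 → ℝ
  phi : Space → ℝ
  piPhi : Space → ℝ

instance : Add PhasePoint where
  add m n := ⟨m.q + n.q, m.P + n.P, m.N + n.N, m.PiN + n.PiN, m.shift + n.shift,
    m.PiShift + n.PiShift, m.phi + n.phi, m.piPhi + n.piPhi⟩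

instance : SMul ℝ PhasePoint where
  smul r m := ⟨r • m.q, r • m.P, r • m.N, r • m.PiN, r • m.shift, r • m.PiShift, r • m.phi,
    r • m.piPhi⟩

/-- The parameters: `κ = 16πG`, the coupling constant `λ_φ` of the scalar field, and the
potential `V` (twice the usual one). -/
structure Model where
  kappa : ℝ
  lam : ℝ
  V : ℝ → ℝ
  kappa_pos : 0 < kappa
  lam_ne_zero : lam ≠ 0
  V_smooth : ContDiff ℝ ∞ V

/-- Christoffel symbols of the first kind,
`Γ_{c,ab} = (∂_a q_{cb} + ∂_b q_{ca} - ∂_c q_{ab}) / 2`. -/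
def christoffel (q : Space → Matrix (Fin 3) (Fin 3) ℝ) (c a b : Fin 3) (x : Space) : ℝ :=
  (pd a (fun y => q y c b) x + pd b (fun y => q y c a) x - pd c (fun y => q y a b) x) / 2

/-- The Riemann tensor `R_{abcd}` of the metric `q` in the coordinates of `ℝ³`. -/
def riemann (q : Space → Matrix (Fin 3) (Fin 3) ℝ) (a b c d : Fin 3) (x : Space) : ℝ :=
  (pd b (pd c (fun y => q y a d)) x + pd a (pd d (fun y => q y b c)) x
    - pd a (pd c (fun y => q y b d)) x - pd b (pd d (fun y => q y a c)) x) / 2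
  + ∑ e, ∑ f, (q x)⁻¹ e f *
      (christoffel q e b c x * christoffel q f a d x
        - christoffel q e b d x * christoffel q f a c x)

/-- The scalar curvature `R = q^{ac} q^{bd} R_{abcd}`. -/
def scalarCurvature (q : Space → Matrix (Fin 3) (Fin 3) ℝ) (x : Space) : ℝ :=
  ∑ a, ∑ b, ∑ c, ∑ d, (q x)⁻¹ a c * (q x)⁻¹ b d * riemann q a b c d x

/-- `κ` times the total Hamiltonian constraint `C^tot = C^geo + C^φ`, with
`κ C^geo = (P_{ab} P^{ab} - (P^a_a)²/2) / √q - √q R` and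
`C^φ = λ_φ π²/(2√q) + √q (q^{ab} ∂_aφ ∂_bφ + V(φ)) / (2λ_φ)`. -/
def hamiltonianConstraint (M : Model) (m : PhasePoint) (x : Space) : ℝ :=
  ((m.q x * m.P x * m.q x * m.P x).trace - (m.q x * m.P x).trace ^ 2 / 2)
      / Real.sqrt (m.q x).det
    - Real.sqrt (m.q x).det * scalarCurvature m.q x
    + M.kappa * (M.lam * m.piPhi x ^ 2 / (2 * Real.sqrt (m.q x).det)
      + Real.sqrt (m.q x).det / (2 * M.lam)
        * ((∑ a, ∑ b, (m.q x)⁻¹ a b * pd a m.phi x * pd b m.phi x) + M.V (m.phi x)))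

/-- `κ` times the total spatial diffeomorphism constraint,
`-2 q_{ac} D_b P^{bc} + κ π ∂_aφ`, where `D_b P^{bc} = ∂_b P^{bc} + Γ^c_{bd} P^{bd}` because
`P^{bc}` is a tensor density of weight one. -/
def diffeoConstraint (M : Model) (m : PhasePoint) (a : Fin 3) (x : Space) : ℝ :=
  -2 * (∑ b, ∑ c, m.q x a c * pd b (fun y => m.P y b c) x)
    - 2 * (∑ b, ∑ d, christoffel m.q a b d x * m.P x b d)
    + M.kappa * m.piPhi x * pd a m.phi x

/-- The density of a linear combination `∫ (ξ C + ξ^a C_a + χ Π + χ^a Π_a)` of the secondary and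
primary constraints, smeared with the given functions. -/
def smearedConstraints (M : Model) (m : PhasePoint) (xi : Space → ℝ) (xiVec : Space → Fin 3 → ℝ)
    (chi : Space → ℝ) (chiVec : Space → Fin 3 → ℝ) (x : Space) : ℝ :=
  xi x * hamiltonianConstraint M m x + (∑ a, xiVec x a * diffeoConstraint M m a x)
    + chi x * m.PiN x + ∑ a, chiVec x a * m.PiShift x a

/-- The density of the canonical Hamiltonian `∫ (N C + N^a C_a + l Π + l_a Π^a)` with Lagrange
multipliers `l`, `l_a`. -/
def canonicalDensity (M : Model) (m : PhasePoint) (l : Space → ℝ) (lVec : Space → Fin 3 → ℝ)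
    (x : Space) : ℝ :=
  smearedConstraints M m m.N m.shift l lVec x

/-- The density of `κ` times the symplectic form. The Poisson brackets are
`{q_{ab}, P^{cd}} = κ δ_(a^c δ_b)^d`, `{φ, π_φ} = 1`, `{N, Π} = κ`, `{N^a, Π_b} = κ δ^a_b`, and,
for a functional `F = (1/κ) ∫ f`, the vector field `u = {·, F}` is characterized by
`∫ (first variation of f along η) = ∫ symplecticDensity u η` for all variations `η`. -/
def symplecticDensity (M : Model) (u η : PhasePoint) (x : Space) : ℝ :=
  (∑ a, ∑ b, (u.q x a b * η.P x a b - u.P x a b * η.q x a b))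
    + (u.N x * η.PiN x - u.PiN x * η.N x)
    + (∑ a, (u.shift x a * η.PiShift x a - u.PiShift x a * η.shift x a))
    + M.kappa * (u.phi x * η.piPhi x - u.piPhi x * η.phi x)

/-- Smooth compactly supported scalar functions. -/
def IsTest (f : Space → ℝ) : Prop := ContDiff ℝ ∞ f ∧ HasCompactSupport f

/-- Smooth compactly supported variations of all phase space variables. -/
structure IsTestVariation (η : PhasePoint) : Prop where
  q_test : ∀ a b, IsTest fun x => η.q x a b
  q_symm : ∀ x, (η.q x).IsSymm
  P_test : ∀ a b, IsTest fun x => η.P x a b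
  P_symm : ∀ x, (η.P x).IsSymm
  N_test : IsTest η.N
  PiN_test : IsTest η.PiN
  shift_test : ∀ a, IsTest fun x => η.shift x a
  PiShift_test : ∀ a, IsTest fun x => η.PiShift x a
  phi_test : IsTest η.phi
  piPhi_test : IsTest η.piPhi

/-- The time derivative at `t` of a curve in phase space. -/
def phaseVelocity (c : ℝ → PhasePoint) (t : ℝ) : PhasePoint where
  q x := Matrix.of fun a b => deriv (fun τ => (c τ).q x a b) t
  P x := Matrix.of fun a b => deriv (fun τ => (c τ).P x a b) t
  N x := deriv (fun τ => (c τ).N x) t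
  PiN x := deriv (fun τ => (c τ).PiN x) t
  shift x a := deriv (fun τ => (c τ).shift x a) t
  PiShift x a := deriv (fun τ => (c τ).PiShift x a) t
  phi x := deriv (fun τ => (c τ).phi x) t
  piPhi x := deriv (fun τ => (c τ).piPhi x) t

/-! ### The spatially flat FLRW background -/

/-- Background functions of time: `A = a²`, the lapse, the scalar field and its momentum. -/
structure Background where
  A : ℝ → ℝ
  N : ℝ → ℝ
  phi : ℝ → ℝ
  piPhi : ℝ → ℝ

namespace Background

variable (bg : Background)

/-- The Hubble parameter `H = Ȧ / (2A)`. -/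
def H (t : ℝ) : ℝ := deriv bg.A t / (2 * bg.A t)

/-- `P̃ = -Ȧ / (N √A)`. -/
def Pt (t : ℝ) : ℝ := -deriv bg.A t / (bg.N t * Real.sqrt (bg.A t))

/-- Energy density of the scalar field. -/
def rho (M : Model) (t : ℝ) : ℝ :=
  (M.lam / bg.A t ^ 3 * bg.piPhi t ^ 2 + M.V (bg.phi t) / M.lam) / 2

/-- Pressure of the scalar field. -/
def p (M : Model) (t : ℝ) : ℝ :=
  (M.lam / bg.A t ^ 3 * bg.piPhi t ^ 2 - M.V (bg.phi t) / M.lam) / 2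

/-- The background as a point of the extended phase space. -/
def point (t : ℝ) : PhasePoint where
  q _ := bg.A t • (1 : Matrix (Fin 3) (Fin 3) ℝ)
  P _ := bg.Pt t • (1 : Matrix (Fin 3) (Fin 3) ℝ)
  N _ := bg.N t
  PiN _ := 0
  shift _ := 0
  PiShift _ := 0
  phi _ := bg.phi t
  piPhi _ := bg.piPhi t

/-- A smooth background solution on the set `I` of times: positive `A` and lapse, the matter
equations of motion and the Friedmann equations; moreover `H ≠ 0`, so that the clocks of the
spatially flat gauge are defined. -/
structure IsSolution (M : Model) (I : Set ℝ) : Prop where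
  A_smooth : ContDiffOn ℝ ∞ bg.A I
  N_smooth : ContDiffOn ℝ ∞ bg.N I
  phi_smooth : ContDiffOn ℝ ∞ bg.phi I
  piPhi_smooth : ContDiffOn ℝ ∞ bg.piPhi I
  A_pos : ∀ t ∈ I, 0 < bg.A t
  N_pos : ∀ t ∈ I, 0 < bg.N t
  H_ne_zero : ∀ t ∈ I, bg.H t ≠ 0
  phi_eq : ∀ t ∈ I, deriv bg.phi t = M.lam * bg.N t / bg.A t ^ (3 / 2 : ℝ) * bg.piPhi t
  piPhi_eq : ∀ t ∈ I, deriv bg.piPhi t =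
    -(bg.N t * bg.A t ^ (3 / 2 : ℝ)) / (2 * M.lam) * deriv M.V (bg.phi t)
  friedmann : ∀ t ∈ I, bg.H t ^ 2 = M.kappa / 6 * bg.N t ^ 2 * bg.rho M t
  friedmann_dot : ∀ t ∈ I, deriv bg.H t =
    deriv bg.N t / bg.N t * bg.H t - 3 / 2 * bg.H t ^ 2 - M.kappa / 4 * bg.N t ^ 2 * bg.p M t

end Background

/-! ### Scalar perturbations -/

/-- Names of the scalar perturbation variables and their momenta:
`(ψ, p_ψ)`, `(E, p_E)`, `(φ, p_φ)`, `(B, p_B)`, `(δφ, δπ_φ)`. -/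
inductive Var
  | psi | pPsi | E | pE | phi | pPhi | B | pB | dphi | dpi

/-- A scalar perturbation: one function on space for each variable. -/
abbrev ScalarPert : Type := Var → Space → ℝ

/-- All variables are smooth and decay with all derivatives. -/
def ScalarPert.IsDecaying (s : ScalarPert) : Prop := ∀ k, Decaying (s k)

/-- The scalar part of the decomposition at time `t`:
`δq_{ab} = 2A(ψ δ_{ab} + E_{,<ab>})`, `δP^{ab} = 2P̃(p_ψ δ^{ab} + p_E^{,<ab>})`, `δN = N φ`,
`δΠ = N p_φ`, `δN^a = B^{,a}`, `δΠ_a = (p_B)_{,a}`, `δφ`, `δπ_φ`. -/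
def embed (bg : Background) (t : ℝ) (s : ScalarPert) : PhasePoint where
  q x := Matrix.of fun a b =>
    2 * bg.A t * ((if a = b then s .psi x else 0) + traceless (s .E) a b x)
  P x := Matrix.of fun a b =>
    2 * bg.Pt t * ((if a = b then s .pPsi x else 0) + traceless (s .pE) a b x)
  N x := bg.N t * s .phi x
  PiN x := bg.N t * s .pPhi x
  shift x a := pd a (s .B) x
  PiShift x a := pd a (s .pB) x
  phi := s .dphi
  piPhi := s .dpi

/-- The time derivative at `t` of a curve of scalar perturbations. -/
def dt (s : ℝ → ScalarPert) (t : ℝ) : ScalarPert := fun k x => deriv (fun τ => s τ k x) t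

/-- The bilinear second variation at the background of the density of the canonical Hamiltonian,
along the perturbation `δm` (with perturbations `δl`, `∂_a δl̂` of the multipliers, whose
background values are `dN/dt` and `0`) and the variation `η`. -/
def secondVariation (M : Model) (bg : Background) (t : ℝ) (dm : PhasePoint)
    (dl dlHat : Space → ℝ) (η : PhasePoint) (x : Space) : ℝ :=
  deriv (fun r : ℝ => deriv (fun e : ℝ =>
    canonicalDensity M (bg.point t + r • dm + e • η)
      (fun y => deriv bg.N t + r * dl y) (fun y a => r * pd a dlHat y) x) 0) 0

/-- At the time `t`, the curve `s` of scalar perturbations satisfies the linearized Hamilton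
equations, i.e. those generated on the linearized phase space by the second order part of the
canonical Hamiltonian, with multiplier perturbations `dl` and `dlHat`. -/
def LinearizedHamiltonAt (M : Model) (bg : Background) (t : ℝ) (s : ℝ → ScalarPert)
    (dl dlHat : Space → ℝ) : Prop :=
  ∀ η, IsTestVariation η →
    ∫ x, secondVariation M bg t (embed bg t (s t)) dl dlHat η x =
      ∫ x, symplecticDensity M (phaseVelocity (fun τ => embed bg τ (s τ)) t) η x

/-- Smooth (in time and space) and, at each time in `I`, decaying curves of perturbations. -/
def IsAdmissibleCurve (I : Set ℝ) (s : ℝ → ScalarPert) : Prop :=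
  (∀ k, ContDiffOn ℝ ∞ (fun z : ℝ × Space => s z.1 k z.2) (I ×ˢ Set.univ)) ∧
    ∀ t ∈ I, (s t).IsDecaying ∧ (dt s t).IsDecaying

/-- Solutions on `I` of the linearized equations of motion of the gauge variant variables. -/
def IsLinearizedSolution (M : Model) (bg : Background) (I : Set ℝ) (s : ℝ → ScalarPert)
    (dl dlHat : ℝ → Space → ℝ) : Prop :=
  IsAdmissibleCurve I s ∧
    ∀ t ∈ I, Decaying (dl t) ∧ Decaying (dlHat t) ∧
      LinearizedHamiltonAt M bg t s (dl t) (dlHat t)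

/-- The linearized constraint surface `δΠ = 0`, `δΠ_a = 0`, `δC = 0`, `δC_a = 0`. -/
def OnConstraintSurface (M : Model) (bg : Background) (t : ℝ) (s : ScalarPert) : Prop :=
  ∀ x, (embed bg t s).PiN x = 0 ∧ (∀ a, (embed bg t s).PiShift x a = 0) ∧
    deriv (fun e : ℝ => hamiltonianConstraint M (bg.point t + e • embed bg t s) x) 0 = 0 ∧
    ∀ a, deriv (fun e : ℝ => diffeoConstraint M (bg.point t + e • embed bg t s) a x) 0 = 0

/-! ### Clocks of the spatially flat gauge and Dirac observables -/

/-- The temporal clock `δT⁰ = (N/H)(ψ - ΔE/3)`. -/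
def clock0 (bg : Background) (t : ℝ) (s : ScalarPert) (x : Space) : ℝ :=
  bg.N t / bg.H t * (s .psi x - lap (s .E) x / 3)

/-- The spatial clocks `δT^a = δ^{ab} E_{,b}` (scalar part). -/
def clockVec (s : ScalarPert) (a : Fin 3) (x : Space) : ℝ := pd a (s .E) x

/-- `g` is the Poisson bracket `{·, 𝔠[ζ]}` of the scalar variables, evaluated at the background,
with the constraints smeared by the descriptors `ζ = (ξ, β^{,a}, χ, χ_B^{,a})`: the Hamiltonian
vector field at the background of `∫ (ξ C + β^{,a} C_a + χ Π + χ_B^{,a} Π_a)`. -/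
def IsGaugeVector (M : Model) (bg : Background) (t : ℝ) (xi beta chi chiB : Space → ℝ)
    (g : ScalarPert) : Prop :=
  g.IsDecaying ∧ ∀ η, IsTestVariation η →
    ∫ x, deriv (fun e : ℝ => smearedConstraints M (bg.point t + e • η) xi
        (fun y a => pd a beta y) chi (fun y a => pd a chiB y) x) 0 =
      ∫ x, symplecticDensity M (embed bg t g) η x

/-- `o` collects the linearized Dirac observables `O_{f,T}` of all scalar variables `f` at the
phase space point `s` and time `t`. With gauge conditions `𝔊 = (-T^μ, -dT^μ/dt)`, constraints
`𝔠 = (C_μ, Π_μ)`, `𝔄 = -{𝔊, 𝔠}` and `𝔅 = 𝔄⁻¹`, the observable map to linear order is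
`O_f = f + ∫ 𝔊^I {f, 𝔅^J_I 𝔠_J} = f + {f, 𝔠[ζ]}` with `ζ = 𝔅𝔊`, that is with the descriptors `ζ`
such that `𝔊(s) + {𝔊, 𝔠[ζ]} = 0`. As `𝔊` is linear, this says that all clocks and their rates
vanish at the point `o = s + {·, 𝔠[ζ]}`. The rate `dT^μ/dt = ∂_t T^μ + {T^μ, H_can}` is the
derivative of the clock along the (linearized) Hamiltonian velocity `w` at `o`. -/
def IsDiracObservable (M : Model) (bg : Background) (t : ℝ) (s o : ScalarPert) : Prop :=
  (∃ (xi beta chi chiB : Space → ℝ) (g : ScalarPert),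
    Decaying xi ∧ Decaying beta ∧ Decaying chi ∧ Decaying chiB ∧
    IsGaugeVector M bg t xi beta chi chiB g ∧ o = s + g) ∧
  (∀ x, clock0 bg t o x = 0 ∧ ∀ a, clockVec o a x = 0) ∧
  ∃ (w : ScalarPert) (dl dlHat : Space → ℝ),
    w.IsDecaying ∧ Decaying dl ∧ Decaying dlHat ∧
    LinearizedHamiltonAt M bg t (fun τ => o + (τ - t) • w) dl dlHat ∧
    ∀ x, deriv (fun τ => clock0 bg τ (o + (τ - t) • w) x) t = 0 ∧
      ∀ a, deriv (fun τ => clockVec (o + (τ - t) • w) a x) t = 0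

/-! ### Explicit expressions -/

/-- `Ψ = ψ + (4H²A/N²)(E + p_E) - ΔE/3`. -/
def bardeenPsi (bg : Background) (t : ℝ) (s : ScalarPert) (x : Space) : ℝ :=
  s .psi x + 4 * bg.H t ^ 2 * bg.A t / bg.N t ^ 2 * (s .E x + s .pE x) - lap (s .E) x / 3

/-- `Υ = p_ψ + ΔE/2 + (2/3)Δp_E - (H²A/N² + κAp/2)(E + p_E)`. -/
def upsilon (M : Model) (bg : Background) (t : ℝ) (s : ScalarPert) (x : Space) : ℝ :=
  s .pPsi x + lap (s .E) x / 2 + 2 / 3 * lap (s .pE) x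
    - (bg.H t ^ 2 * bg.A t / bg.N t ^ 2 + M.kappa * bg.A t / 2 * bg.p M t) * (s .E x + s .pE x)

/-- The table of observables in the spatially flat gauge. The entry for `δφ` is the
Mukhanov-Sasaki variable `v`, the entry for `δπ_φ` is `π_v`. -/
def flatObservables (M : Model) (bg : Background) (t : ℝ) (s : ScalarPert) : ScalarPert
  | .psi => fun _ => 0
  | .E => fun _ => 0
  | .pPsi => fun x => upsilon M bg t s x
      + (1 / 4 + M.kappa / (2 * bg.Pt t ^ 2) * bg.A t * bg.p M t) * bardeenPsi bg t s x
      - 2 / (3 * bg.Pt t ^ 2) * lap (bardeenPsi bg t s) x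
  | .pE => fun x => bardeenPsi bg t s x / bg.Pt t ^ 2
  | .phi => fun x => -2 * upsilon M bg t s x
      - (1 / 2 + M.kappa / bg.Pt t ^ 2 * bg.A t * bg.p M t) * bardeenPsi bg t s x
  | .B => fun x => bg.N t ^ 2 / (bg.A t * bg.H t) * bardeenPsi bg t s x
  | .pPhi => s .pPhi
  | .pB => s .pB
  | .dphi => fun x => s .dphi x
      - M.lam / (bg.A t ^ (3 / 2 : ℝ) * bg.H t) * bg.N t * bg.piPhi t
        * (s .psi x - lap (s .E) x / 3)
  | .dpi => fun x => s .dpi x - bg.piPhi t * lap (s .E) x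
      + 1 / 2 * (bg.A t ^ (3 / 2 : ℝ) / M.lam) * deriv M.V (bg.phi t) * (bg.N t / bg.H t)
        * (s .psi x - lap (s .E) x / 3)

/-- `δT̃ = -3λ_φ π̄²/A³ ψ + λ_φ π̄/A³ δπ_φ - V'/(2λ_φ) δφ`. -/
def deltaT (M : Model) (bg : Background) (t : ℝ) (s : ScalarPert) (x : Space) : ℝ :=
  -3 * M.lam * bg.piPhi t ^ 2 / bg.A t ^ 3 * s .psi x
    + M.lam * bg.piPhi t / bg.A t ^ 3 * s .dpi x
    - deriv M.V (bg.phi t) / (2 * M.lam) * s .dphi x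

/-- The observable of the lapse multiplier `δλ`, expressed through `Ψ`, `Υ` at `s` and the
observables `o`. -/
def obsMultiplier (M : Model) (bg : Background) (t : ℝ) (s o : ScalarPert) (x : Space) : ℝ :=
  (deriv bg.N t + M.kappa / 2 * (bg.N t ^ 3 * bg.p M t / bg.H t))
      * (-2 * upsilon M bg t s x
        - (1 / 2 + M.kappa / 4 * (bg.N t ^ 2 * bg.p M t / bg.H t ^ 2)) * bardeenPsi bg t s x)
    + M.kappa / 4 * (bg.N t ^ 3 / bg.H t) * deltaT M bg t o x

/-- The observable of the longitudinal shift multiplier `δλ̂`. -/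
def obsMultiplierHat (M : Model) (bg : Background) (t : ℝ) (s : ScalarPert) (x : Space) : ℝ :=
  (deriv bg.N t * bg.N t / (bg.A t * bg.H t) - 3 * bg.N t ^ 2 / bg.A t) * bardeenPsi bg t s x
    + bg.N t ^ 2 / bg.A t * (2 * upsilon M bg t s x
      + (1 / 2 + M.kappa / 4 * (bg.N t ^ 2 * bg.p M t / bg.H t ^ 2)) * bardeenPsi bg t s x)

/-- Hamilton's equations for the observables `o` of the scalar sector in the spatially flat gauge,
in terms of `Ψ`, `Υ` (evaluated at `s`), `v = o .dphi` and `π_v = o .dpi`. -/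
structure FlatHamiltonEquations (M : Model) (bg : Background) (t : ℝ) (s : ScalarPert)
    (o : ℝ → ScalarPert) (x : Space) : Prop where
  phi_eq : dt o t .phi x =
    -(M.kappa / 2) * (bg.N t ^ 2 * bg.p M t / bg.H t) * (2 * upsilon M bg t s x
      + (1 / 2 + M.kappa / 4 * (bg.N t ^ 2 * bg.p M t / bg.H t ^ 2)) * bardeenPsi bg t s x)
    + M.kappa / 4 * (bg.N t ^ 2 / bg.H t) * deltaT M bg t (o t) x
  pPhi_eq : dt o t .pPhi x = 0
  psi_eq : dt o t .psi x = 0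
  pPsi_eq : dt o t .pPsi x =
    (1 / 6 * (bg.N t ^ 2 / (bg.A t * bg.H t))
        - M.kappa / 12 * (bg.N t ^ 4 * bg.p M t / (bg.A t * bg.H t ^ 3)))
      * lap (bardeenPsi bg t s) x
    + (M.kappa / 8 * (bg.N t ^ 2 * bg.p M t / bg.H t)
        + M.kappa ^ 2 / 16 * (bg.N t ^ 4 * bg.p M t ^ 2 / bg.H t ^ 3)) * bardeenPsi bg t s x
    - 1 / 3 * (bg.N t ^ 2 / (bg.A t * bg.H t)) * lap (upsilon M bg t s) x
    + M.kappa / 2 * (bg.N t ^ 2 * bg.p M t / bg.H t) * upsilon M bg t s x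
    - M.kappa / 8 * (bg.N t ^ 2 / bg.H t) * deltaT M bg t (o t) x
  E_eq : dt o t .E x = 0
  pE_eq : dt o t .pE x =
    1 / 2 * (bg.N t ^ 2 / (bg.A t * bg.H t)) * upsilon M bg t s x
    + (M.kappa / 8 * (bg.N t ^ 4 * bg.p M t / (bg.A t * bg.H t ^ 3))
        - 1 / 4 * (bg.N t ^ 2 / (bg.A t * bg.H t))) * bardeenPsi bg t s x
  B_eq : dt o t .B x = obsMultiplierHat M bg t s x
  pB_eq : dt o t .pB x = 0
  dphi_eq : dt o t .dphi x =
    M.lam * (bg.N t / bg.A t ^ (3 / 2 : ℝ)) * (bg.piPhi t * (-2 * upsilon M bg t s x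
        - (1 / 2 + M.kappa / 4 * (bg.N t ^ 2 * bg.p M t / bg.H t ^ 2)) * bardeenPsi bg t s x)
      + o t .dpi x)
  dpi_eq : dt o t .dpi x =
    bg.N t * bg.A t ^ (3 / 2 : ℝ) / M.lam * (lap (o t .dphi) x / bg.A t
        - 1 / 2 * deriv (deriv M.V) (bg.phi t) * o t .dphi x
        + deriv M.V (bg.phi t) * upsilon M bg t s x)
    + bg.N t * bg.A t ^ (3 / 2 : ℝ) / M.lam * deriv M.V (bg.phi t)
        * (1 / 4 + M.kappa / 8 * (bg.N t ^ 2 * bg.p M t / bg.H t ^ 2)) * bardeenPsi bg t s x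
    + bg.piPhi t * (bg.N t ^ 2 / (bg.A t * bg.H t)) * lap (bardeenPsi bg t s) x

end

end CosmoPert

open CosmoPert

/-! The proof turns every statement about functionals on phase space into an identity between
finitely many functions on space, and then into rational identities in the background quantities.

Variational side. The Hamiltonian density is evaluated on the two-parameter family background +
r·perturbation + e·test variation. Its mixed r,e-derivative is computed by a calculus of
two-parameter jets (`HasJet`), which applies to inverse metrics, determinants, square roots and
curvature because the background metric is a constant multiple of the identity. Integration by parts
(`DivEq`) moves all derivatives off the compactly supported test variation. For scalar perturbations
the outcome is the symplectic density of another scalar perturbation, `hamVec`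
(`DivEq.variationDensity`). Since the symplectic pairing is nondegenerate and decaying scalars are
determined by the tensors they generate (`symplecticDensity_scalarPoint_iff`), the weak Hamilton
equations are equivalent to the velocity being `linearFlow`, and gauge vectors are exactly
`gaugeVec` (`linearizedHamiltonAt_iff_velocity`, `isGaugeVector_iff_eq`). Here the Friedmann
constraint eliminates the potential.

Observables. The combination ψ - ΔE/3 moves under a gauge transformation by (H/N)ξ and E moves by β,
which gives the bracket matrix of the clocks. Vanishing clocks therefore fix ξ and β. Vanishing
clock rates read E' = 0 and ψ' = 0 in `linearFlow`; they give B = 4H p_E and φ = -2 p_ψ - (4/3)Δp_E,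
hence fix χ and χ_B. This is existence and uniqueness in `isDiracObservable_iff`.

Evolution. In the time derivative of each observable the arbitrary lapse and shift perturbations of
the original solution cancel, and what remains is the flow evaluated at the observables. For all
variables except p_φ and p_B this needs no constraints; those two evolve by the linearized
constraints themselves. The multipliers are whatever the velocities of the observables of φ and B
require.

Mukhanov-Sasaki equation. Expressed through observables, the linearized constraints are algebraic:
they give the observable lapse and the trace of the momentum in terms of v and π_v
(`OnConstraintSurface.flatObservables_eq`). Differentiating v' = (λN/A^(3/2))(π_v + π O_φ) once more
and eliminating these, together with ΔO_{p_E}, leaves a closed second-order equation for v. -/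

namespace CosmoPert

open MeasureTheory Filter Topology

/-! ### Calculus of the coordinate derivatives -/

section PartialDerivatives

variable {f g : Space → ℝ}

lemma pd_eq_fderiv_apply (a : Fin 3) (f : Space → ℝ) :
    pd a f = fun x => fderiv ℝ f x (EuclideanSpace.single a 1) := rfl

@[fun_prop]
lemma contDiff_pd (a : Fin 3) (hf : ContDiff ℝ ∞ f) : ContDiff ℝ ∞ (pd a f) := by
  rw [pd_eq_fderiv_apply]
  exact (hf.fderiv_right (m := ∞) (by simp)).clm_apply contDiff_const

@[fun_prop]
lemma contDiff_pd_apply (a : Fin 3) (hf : ContDiff ℝ ∞ f) : ContDiff ℝ ∞ (fun x => pd a f x) :=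
  contDiff_pd a hf

lemma differentiableAt_of_contDiff (hf : ContDiff ℝ ∞ f) (x : Space) :
    DifferentiableAt ℝ f x :=
  (hf.differentiable (by simp)) x

lemma pd_add (a : Fin 3) (hf : ContDiff ℝ ∞ f) (hg : ContDiff ℝ ∞ g) :
    pd a (fun x => f x + g x) = fun x => pd a f x + pd a g x := by
  ext x
  simp only [pd]
  rw [fderiv_fun_add (differentiableAt_of_contDiff hf x) (differentiableAt_of_contDiff hg x)]
  rfl

lemma pd_sub (a : Fin 3) (hf : ContDiff ℝ ∞ f) (hg : ContDiff ℝ ∞ g) :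
    pd a (fun x => f x - g x) = fun x => pd a f x - pd a g x := by
  ext x
  simp only [pd]
  rw [fderiv_fun_sub (differentiableAt_of_contDiff hf x) (differentiableAt_of_contDiff hg x)]
  rfl

lemma pd_const_mul (a : Fin 3) (c : ℝ) (hf : ContDiff ℝ ∞ f) :
    pd a (fun x => c * f x) = fun x => c * pd a f x := by
  ext x
  simp only [pd]
  rw [fderiv_const_mul (differentiableAt_of_contDiff hf x)]
  rfl

lemma pd_const (a : Fin 3) (c : ℝ) : pd a (fun _ => c) = fun _ => 0 := by
  ext x
  simp [pd]

lemma pd_const_apply (a : Fin 3) (c : ℝ) (x : Space) : pd a (fun _ => c) x = 0 := by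
  rw [pd_const]

lemma pd_sum {ι : Type*} (s : Finset ι) (a : Fin 3) {F : ι → Space → ℝ}
    (hF : ∀ i, ContDiff ℝ ∞ (F i)) :
    pd a (fun x => ∑ i ∈ s, F i x) = fun x => ∑ i ∈ s, pd a (F i) x := by
  classical
  induction s using Finset.induction_on with
  | empty => simpa using pd_const a 0
  | insert i s hi ih =>
    simp only [Finset.sum_insert hi]
    rw [pd_add a (hF i) (ContDiff.sum fun j _ => hF j), ih]

lemma pd_pd_eq (a b : Fin 3) (hf : ContDiff ℝ ∞ f) (x : Space) :
    pd a (pd b f) x =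
      fderiv ℝ (fderiv ℝ f) x (EuclideanSpace.single a 1) (EuclideanSpace.single b 1) := by
  have h : DifferentiableAt ℝ (fderiv ℝ f) x :=
    ((hf.fderiv_right (m := ∞) (by simp)).differentiable (by simp)) x
  rw [pd, pd_eq_fderiv_apply, fderiv_clm_apply h (differentiableAt_const _)]
  simp

lemma pd_comm (a b : Fin 3) (hf : ContDiff ℝ ∞ f) : pd a (pd b f) = pd b (pd a f) := by
  ext x
  rw [pd_pd_eq a b hf, pd_pd_eq b a hf]
  exact (hf.contDiffAt.isSymmSndFDerivAt (by
    rw [minSmoothness_of_isRCLikeNormedField]; exact ENat.LEInfty.out)) _ _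

lemma lap_eq (hf : ContDiff ℝ ∞ f) : lap f = fun x => ∑ a, pd a (pd a f) x := by
  ext x
  rw [lap, InnerProductSpace.laplacian_eq_iteratedFDeriv_orthonormalBasis f
    (EuclideanSpace.basisFun (Fin 3) ℝ)]
  refine Finset.sum_congr rfl fun a _ => ?_
  rw [pd_pd_eq a a hf, iteratedFDeriv_two_apply]
  simp

@[fun_prop]
lemma contDiff_lap (hf : ContDiff ℝ ∞ f) : ContDiff ℝ ∞ (lap f) := by
  rw [lap_eq hf]
  fun_prop

@[fun_prop]
lemma contDiff_lap_apply (hf : ContDiff ℝ ∞ f) : ContDiff ℝ ∞ (fun x => lap f x) :=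
  contDiff_lap hf

lemma lap_add (hf : ContDiff ℝ ∞ f) (hg : ContDiff ℝ ∞ g) :
    lap (fun x => f x + g x) = fun x => lap f x + lap g x := by
  rw [lap_eq hf, lap_eq hg, lap_eq (by fun_prop)]
  ext x
  rw [← Finset.sum_add_distrib]
  refine Finset.sum_congr rfl fun a _ => ?_
  rw [pd_add a hf hg, pd_add a (by fun_prop) (by fun_prop)]

lemma lap_const_mul (c : ℝ) (hf : ContDiff ℝ ∞ f) :
    lap (fun x => c * f x) = fun x => c * lap f x := by
  rw [lap_eq hf, lap_eq (by fun_prop)]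
  ext x
  rw [Finset.mul_sum]
  refine Finset.sum_congr rfl fun a _ => ?_
  rw [pd_const_mul a c hf, pd_const_mul a c (by fun_prop)]

lemma lap_sub (hf : ContDiff ℝ ∞ f) (hg : ContDiff ℝ ∞ g) :
    lap (fun x => f x - g x) = fun x => lap f x - lap g x := by
  have h := lap_add hf (g := fun x => (-1) * g x) (by fun_prop)
  rw [lap_const_mul (-1) hg] at h
  have e : (fun x => f x - g x) = fun x => f x + (-1) * g x := by ext; ring
  rw [e, h]
  ext; ring

lemma pd_lap (a : Fin 3) (hf : ContDiff ℝ ∞ f) : pd a (lap f) = lap (pd a f) := by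
  rw [lap_eq hf, lap_eq (by fun_prop), pd_sum _ _ (fun i => by fun_prop)]
  ext x
  refine Finset.sum_congr rfl fun b _ => ?_
  rw [pd_comm a b (by fun_prop), pd_comm a b hf]

end PartialDerivatives

/-! ### Decaying functions -/

namespace Decaying

variable {f g : Space → ℝ}

lemma add (hf : Decaying f) (hg : Decaying g) : Decaying (fun x => f x + g x) := by
  refine ⟨hf.1.add hg.1, fun n => ?_⟩
  have h := (hf.2 n).add (hg.2 n)
  rw [add_zero] at h
  refine h.congr fun x => ?_
  exact (iteratedFDeriv_add_apply ((hf.1.of_le (mod_cast le_top)).contDiffAt)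
    ((hg.1.of_le (mod_cast le_top)).contDiffAt)).symm

lemma const_mul (c : ℝ) (hf : Decaying f) : Decaying (fun x => c * f x) := by
  refine ⟨contDiff_const.mul hf.1, fun n => ?_⟩
  have h := (hf.2 n).const_smul c
  rw [smul_zero] at h
  refine h.congr fun x => ?_
  exact (iteratedFDeriv_const_smul_apply (a := c)
    ((hf.1.of_le (mod_cast le_top)).contDiffAt)).symm

lemma sub (hf : Decaying f) (hg : Decaying g) : Decaying (fun x => f x - g x) := by
  simpa [sub_eq_add_neg] using hf.add (hg.const_mul (-1))

lemma neg (hf : Decaying f) : Decaying (fun x => - f x) := by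
  simpa using hf.const_mul (-1)

lemma div_const (c : ℝ) (hf : Decaying f) : Decaying (fun x => f x / c) := by
  simpa [div_eq_inv_mul] using hf.const_mul c⁻¹

lemma zero : Decaying (fun _ => 0) := by
  refine ⟨contDiff_const, fun n => ?_⟩
  have : (fun x : Space => iteratedFDeriv ℝ n (fun _ : Space => (0 : ℝ)) x) = fun _ => 0 := by
    ext x
    rw [iteratedFDeriv_fun_zero]
    rfl
  rw [this]
  exact tendsto_const_nhds

/-- Evaluation at a basis vector is a bounded linear map, so the n-th derivative of the partial
derivative is controlled by the derivative of order n + 1 of the function. -/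
lemma pd (a : Fin 3) (hf : Decaying f) : Decaying (pd a f) := by
  refine ⟨contDiff_pd a hf.1, fun n => ?_⟩
  rw [tendsto_zero_iff_norm_tendsto_zero]
  have h := (hf.2 (n + 1)).norm
  rw [norm_zero] at h
  set L : (Space →L[ℝ] ℝ) →L[ℝ] ℝ :=
    ContinuousLinearMap.apply ℝ ℝ (EuclideanSpace.single a (1 : ℝ) : Space)
  have h2 := h.const_mul ‖L‖
  rw [mul_zero] at h2
  refine squeeze_zero (fun _ => norm_nonneg _) (fun x => ?_) h2
  have h3 := L.norm_iteratedFDeriv_comp_left (f := fderiv ℝ f) (x := x) (N := ∞) (n := n)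
    ((hf.1.fderiv_right (m := ∞) (by simp)).contDiffAt) (mod_cast le_top)
  rw [norm_iteratedFDeriv_fderiv] at h3
  exact h3

lemma lap (hf : Decaying f) : Decaying (lap f) := by
  rw [lap_eq hf.1]
  simp only [Fin.sum_univ_three]
  exact (((hf.pd 0).pd 0).add ((hf.pd 1).pd 1)).add ((hf.pd 2).pd 2)

lemma tendsto (hf : Decaying f) : Tendsto f (cocompact Space) (𝓝 0) := by
  have h := (hf.2 0).norm
  simp only [norm_iteratedFDeriv_zero, norm_zero] at h
  exact tendsto_zero_iff_norm_tendsto_zero.2 h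

/-- A constant that tends to zero at infinity is zero. This is what excludes zero modes whenever
only gradients of scalar potentials are known. -/
lemma eq_zero_of_pd_eq_zero (hf : Decaying f) (h : ∀ a x, CosmoPert.pd a f x = 0) (x : Space) :
    f x = 0 := by
  have hd : ∀ y, fderiv ℝ f y = 0 := by
    intro y
    have : (fderiv ℝ f y : Space →ₗ[ℝ] ℝ) = 0 := by
      refine (EuclideanSpace.basisFun (Fin 3) ℝ).toBasis.ext fun a => ?_
      have := h a y
      simp only [CosmoPert.pd] at this
      simpa using this
    ext v
    exact LinearMap.congr_fun this v
  have hc : ∀ y, f y = f x := fun y =>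
    is_const_of_fderiv_eq_zero (hf.1.differentiable (by simp)) hd y x
  have h2 : Tendsto f (cocompact Space) (𝓝 (f x)) :=
    tendsto_const_nhds.congr fun y => (hc y).symm
  exact tendsto_nhds_unique h2 hf.tendsto

end Decaying

/-- A decaying trace and a decaying potential of the trace-free part are determined by the symmetric
tensor they generate. -/
lemma eq_zero_of_trace_add_traceless {X Y : Space → ℝ} (hY : Decaying Y)
    (h : ∀ a b x, (if a = b then X x else 0) + traceless Y a b x = 0) :
    (∀ x, X x = 0) ∧ ∀ x, Y x = 0 := by
  have hX0 : ∀ x, X x = 0 := by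
    intro x
    have h0 := h 0 0 x
    have h1 := h 1 1 x
    have h2 := h 2 2 x
    simp only [traceless, if_true, lap_eq hY.1, Fin.sum_univ_three] at h0 h1 h2
    linarith
  refine ⟨hX0, ?_⟩
  have hd : ∀ a b x, pd a (pd b Y) x = if a = b then lap Y x / 3 else 0 := by
    intro a b x
    have := h a b x
    simp only [hX0, traceless] at this
    split_ifs at this ⊢ <;> linarith
  -- The Hessian is pure trace. For b ≠ a, the third derivative ∂_a∂_b∂_b Y equals ∂_a ΔY / 3 when
  -- read from the diagonal and zero when read from the off-diagonal entry, so ΔY is constant.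
  have hl : ∀ x, lap Y x = 0 := by
    refine hY.lap.eq_zero_of_pd_eq_zero fun a x => ?_
    obtain ⟨b, hb⟩ : ∃ b, b ≠ a := exists_ne a
    have h1 : pd a (pd b (pd b Y)) x = pd a (lap Y) x / 3 := by
      have : pd b (pd b Y) = fun x => (1 / 3) * lap Y x := by
        ext y; rw [hd]; simp; ring
      rw [this, pd_const_mul a _ (contDiff_lap hY.1)]
      ring
    have h2 : pd a (pd b (pd b Y)) x = 0 := by
      rw [pd_comm a b (contDiff_pd b hY.1)]
      have : pd a (pd b Y) = fun _ => 0 := by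
        ext y; rw [hd]; simp [hb.symm]
      rw [this, pd_const]
    linarith
  have hp : ∀ b x, pd b Y x = 0 := by
    intro b
    refine (hY.pd b).eq_zero_of_pd_eq_zero fun a x => ?_
    rw [hd, hl]
    simp
  exact hY.eq_zero_of_pd_eq_zero hp

/-! ### Test functions and integration by parts -/

namespace IsTest

variable {f g : Space → ℝ}

lemma pd (a : Fin 3) (hf : IsTest f) : IsTest (pd a f) := by
  refine ⟨contDiff_pd a hf.1, ?_⟩
  exact hf.2.fderiv_apply (𝕜 := ℝ) (EuclideanSpace.single a (1 : ℝ))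

lemma integrable (hf : IsTest f) : Integrable f :=
  hf.1.continuous.integrable_of_hasCompactSupport hf.2

lemma mul_left (hg : ContDiff ℝ ∞ g) (hf : IsTest f) : IsTest (fun x => g x * f x) :=
  ⟨hg.mul hf.1, hf.2.mul_left⟩

lemma add (hf : IsTest f) (hg : IsTest g) : IsTest (fun x => f x + g x) :=
  ⟨hf.1.add hg.1, hf.2.add hg.2⟩

lemma sub (hf : IsTest f) (hg : IsTest g) : IsTest (fun x => f x - g x) :=
  ⟨hf.1.sub hg.1, hf.2.sub hg.2⟩

lemma zero : IsTest (fun _ => (0 : ℝ)) := ⟨contDiff_const, HasCompactSupport.zero⟩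

lemma sum {ι : Type*} (s : Finset ι) {F : ι → Space → ℝ} (hF : ∀ i, IsTest (F i)) :
    IsTest (fun x => ∑ i ∈ s, F i x) := by
  classical
  induction s using Finset.induction_on with
  | empty => simpa using zero
  | insert i s hi ih => simpa only [Finset.sum_insert hi] using (hF i).add ih

lemma integral_mul_pd (hg : ContDiff ℝ ∞ g) (a : Fin 3) (hf : IsTest f) :
    ∫ x, g x * CosmoPert.pd a f x = - ∫ x, CosmoPert.pd a g x * f x := by
  refine integral_mul_fderiv_eq_neg_fderiv_mul_of_integrable ?_ ?_ ?_
    (fun x _ => differentiableAt_of_contDiff hg x) (fun x _ => differentiableAt_of_contDiff hf.1 x)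
  · exact (hf.mul_left (contDiff_pd a hg)).integrable
  · exact ((hf.pd a).mul_left hg).integrable
  · exact (hf.mul_left hg).integrable

end IsTest

lemma eq_zero_of_forall_integral_mul_test {f : Space → ℝ} (hf : Continuous f)
    (h : ∀ g, IsTest g → ∫ x, f x * g x = 0) (x : Space) : f x = 0 := by
  have h1 : ∀ᵐ x, f x = 0 := by
    refine ae_eq_zero_of_integral_contDiff_smul_eq_zero hf.locallyIntegrable fun g hg hgc => ?_
    rw [← h g ⟨hg, hgc⟩]
    exact integral_congr_ae (Eventually.of_forall fun x => by simp [mul_comm])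
  exact congrFun (Measure.eq_of_ae_eq h1 hf continuous_const) x

/-- Two densities agree up to an integrable density with vanishing integral. -/
def DivEq (u w : Space → ℝ) : Prop :=
  Integrable (fun x => u x - w x) ∧ ∫ x, (u x - w x) = 0

namespace DivEq

variable {u v w u' w' : Space → ℝ}

lemma refl (u : Space → ℝ) : DivEq u u := by simp [DivEq]

lemma of_eq (h : ∀ x, u x = w x) : DivEq u w := by
  rw [funext h]
  exact refl w

lemma add (h : DivEq u w) (h' : DivEq u' w') :
    DivEq (fun x => u x + u' x) (fun x => w x + w' x) := by
  have e : (fun x => u x + u' x - (w x + w' x)) = fun x => (u x - w x) + (u' x - w' x) := by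
    ext; ring
  refine ⟨by rw [e]; exact h.1.add h'.1, ?_⟩
  rw [e, integral_add h.1 h'.1, h.2, h'.2, add_zero]

lemma const_mul (c : ℝ) (h : DivEq u w) : DivEq (fun x => c * u x) (fun x => c * w x) := by
  have e : (fun x => c * u x - c * w x) = fun x => c * (u x - w x) := by ext; ring
  refine ⟨by rw [e]; exact h.1.const_mul c, ?_⟩
  rw [e, integral_const_mul, h.2, mul_zero]

lemma sub (h : DivEq u w) (h' : DivEq u' w') :
    DivEq (fun x => u x - u' x) (fun x => w x - w' x) := by
  simpa [sub_eq_add_neg] using h.add (h'.const_mul (-1))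

lemma trans (h : DivEq u v) (h' : DivEq v w) : DivEq u w := by
  have e : (fun x => u x - w x) = fun x => (u x - v x) + (v x - w x) := by ext; ring
  refine ⟨by rw [e]; exact h.1.add h'.1, ?_⟩
  rw [e, integral_add h.1 h'.1, h.2, h'.2, add_zero]

lemma sum {ι : Type*} (s : Finset ι) {F G : ι → Space → ℝ} (h : ∀ i, DivEq (F i) (G i)) :
    DivEq (fun x => ∑ i ∈ s, F i x) (fun x => ∑ i ∈ s, G i x) := by
  classical
  induction s using Finset.induction_on with
  | empty => simpa using refl _
  | insert i s hi ih => simpa only [Finset.sum_insert hi] using (h i).add ih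

/-- Because `DivEq` only speaks of the difference, integrability of the final density suffices;
intermediate ones need not be examined. -/
lemma integral_eq (h : DivEq u w) (hw : Integrable w) : ∫ x, u x = ∫ x, w x := by
  have h1 : ∫ x, u x = ∫ x, ((u x - w x) + w x) := by simp
  rw [h1, integral_add h.1 hw, h.2, zero_add]

lemma mul_pd {f g : Space → ℝ} (hg : ContDiff ℝ ∞ g) (a : Fin 3) (hf : IsTest f) :
    DivEq (fun x => g x * pd a f x) (fun x => - pd a g x * f x) := by
  have h1 := ((hf.pd a).mul_left hg).integrable
  have h2 : Integrable (fun x => - pd a g x * f x) := by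
    simpa using (hf.mul_left (contDiff_pd a hg)).integrable.neg
  refine ⟨h1.sub h2, ?_⟩
  rw [integral_sub h1 h2, hf.integral_mul_pd hg a]
  simp [integral_neg]

lemma mul_pd_pd {f g : Space → ℝ} (hg : ContDiff ℝ ∞ g) (a b : Fin 3) (hf : IsTest f) :
    DivEq (fun x => g x * pd a (pd b f) x) (fun x => pd a (pd b g) x * f x) := by
  have h1 := mul_pd hg a (hf.pd b)
  have h2 := (mul_pd (contDiff_pd a hg) b hf).const_mul (-1)
  refine h1.trans ((of_eq fun x => ?_).trans (h2.trans (of_eq fun x => ?_)))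
  · ring
  · rw [pd_comm a b hg]; ring

end DivEq

end CosmoPert

namespace CosmoPert

open Filter Topology

/-! ### Mixed second order jets of functions of two real parameters -/

/-- `f` has the value `f0`, the first derivatives `fr`, `fe` and the mixed second derivative `fre`
at the origin. -/
structure HasJet (f : ℝ → ℝ → ℝ) (f0 fr fe fre : ℝ) : Prop where
  zero : f 0 0 = f0
  left : HasDerivAt (fun r => f r 0) fr 0
  right : ∃ g : ℝ → ℝ, (∀ᶠ r in 𝓝 0, HasDerivAt (f r) (g r) 0) ∧ g 0 = fe ∧ HasDerivAt g fre 0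

namespace HasJet

variable {f g : ℝ → ℝ → ℝ} {f0 fr fe fre g0 gr ge gre : ℝ}

lemma congr_jet {f0' fr' fe' fre' : ℝ} (h : HasJet f f0 fr fe fre) (h0 : f0 = f0') (hr : fr = fr')
    (he : fe = fe') (hre : fre = fre') : HasJet f f0' fr' fe' fre' := by
  subst h0 hr he hre
  exact h

lemma congr_fun (h : HasJet f f0 fr fe fre) (hfg : ∀ r e, g r e = f r e) :
    HasJet g f0 fr fe fre := by
  have : g = f := by ext; exact hfg _ _
  rwa [this]

/-- This nested derivative is the form in which the second variation is defined. It dictates the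
asymmetric field `right`: an e-derivative for all r near 0, differentiable in r at 0. No joint
differentiability is required. -/
lemma deriv_deriv (h : HasJet f f0 fr fe fre) :
    deriv (fun r => deriv (fun e => f r e) 0) 0 = fre := by
  obtain ⟨g, h1, -, h3⟩ := h.right
  have : (fun r => deriv (fun e => f r e) 0) =ᶠ[𝓝 0] g := h1.mono fun r hr => hr.deriv
  rw [this.deriv_eq, h3.deriv]

lemma deriv_right (h : HasJet f f0 fr fe fre) : deriv (fun e => f 0 e) 0 = fe := by
  obtain ⟨g, h1, h2, -⟩ := h.right
  rw [h1.self_of_nhds.deriv, h2]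

lemma affine (c u v : ℝ) : HasJet (fun r e => c + r * u + e * v) c u v 0 := by
  refine ⟨by simp, ?_, fun _ => v, Eventually.of_forall fun r => ?_, rfl, hasDerivAt_const _ _⟩
  · simpa using ((hasDerivAt_id (0 : ℝ)).mul_const u).const_add c
  · simpa using ((hasDerivAt_id (0 : ℝ)).mul_const v).const_add (c + r * u)

lemma const (c : ℝ) : HasJet (fun _ _ => c) c 0 0 0 := by
  simpa using affine c 0 0

lemma add (hf : HasJet f f0 fr fe fre) (hg : HasJet g g0 gr ge gre) :
    HasJet (fun r e => f r e + g r e) (f0 + g0) (fr + gr) (fe + ge) (fre + gre) := by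
  obtain ⟨F, h1, h2, h3⟩ := hf.right
  obtain ⟨G, k1, k2, k3⟩ := hg.right
  refine ⟨by rw [hf.zero, hg.zero], hf.left.add hg.left, fun r => F r + G r, ?_, by simp only [h2, k2],
    h3.add k3⟩
  filter_upwards [h1, k1] with r hr kr using hr.add kr

lemma mul (hf : HasJet f f0 fr fe fre) (hg : HasJet g g0 gr ge gre) :
    HasJet (fun r e => f r e * g r e) (f0 * g0) (fr * g0 + f0 * gr) (fe * g0 + f0 * ge)
      (fre * g0 + fe * gr + fr * ge + f0 * gre) := by
  obtain ⟨F, h1, h2, h3⟩ := hf.right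
  obtain ⟨G, k1, k2, k3⟩ := hg.right
  refine ⟨by rw [hf.zero, hg.zero], ?_, fun r => F r * g r 0 + f r 0 * G r, ?_, ?_, ?_⟩
  · have := hf.left.mul hg.left
    rwa [hf.zero, hg.zero] at this
  · filter_upwards [h1, k1] with r hr kr using hr.mul kr
  · simp only [h2, k2, hf.zero, hg.zero]
  · have := (h3.mul hg.left).add (hf.left.mul k3)
    rw [h2, k2, hf.zero, hg.zero] at this
    exact this.congr_deriv (by ring)

lemma const_mul (c : ℝ) (hf : HasJet f f0 fr fe fre) :
    HasJet (fun r e => c * f r e) (c * f0) (c * fr) (c * fe) (c * fre) :=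
  ((const c).mul hf).congr_jet rfl (by ring) (by ring) (by ring)

lemma sub (hf : HasJet f f0 fr fe fre) (hg : HasJet g g0 gr ge gre) :
    HasJet (fun r e => f r e - g r e) (f0 - g0) (fr - gr) (fe - ge) (fre - gre) :=
  ((hf.add (hg.const_mul (-1))).congr_fun fun r e => by ring).congr_jet
    (by ring) (by ring) (by ring) (by ring)

lemma sum {ι : Type*} (s : Finset ι) {F : ι → ℝ → ℝ → ℝ} {F0 Fr Fe Fre : ι → ℝ}
    (h : ∀ i, HasJet (F i) (F0 i) (Fr i) (Fe i) (Fre i)) :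
    HasJet (fun r e => ∑ i ∈ s, F i r e) (∑ i ∈ s, F0 i) (∑ i ∈ s, Fr i) (∑ i ∈ s, Fe i)
      (∑ i ∈ s, Fre i) := by
  classical
  induction s using Finset.induction_on with
  | empty => simpa using const 0
  | insert i s hi ih => simpa only [Finset.sum_insert hi] using (h i).add ih

/-- Chain rule in e at each small r, then product and chain rule in r. The outer function must be
differentiable near the base value, since the e-derivative is taken at all nearby r, while its
derivative is differentiated only at the base value. -/
lemma comp {φ φ' : ℝ → ℝ} {c : ℝ} (hφ : ∀ᶠ y in 𝓝 f0, HasDerivAt φ (φ' y) y)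
    (hφ' : HasDerivAt φ' c f0) (hf : HasJet f f0 fr fe fre) :
    HasJet (fun r e => φ (f r e)) (φ f0) (φ' f0 * fr) (φ' f0 * fe) (c * fr * fe + φ' f0 * fre) := by
  obtain ⟨F, h1, h2, h3⟩ := hf.right
  have hz := hf.zero
  have hc : Tendsto (fun r => f r 0) (𝓝 0) (𝓝 f0) := by
    have := hf.left.continuousAt.tendsto
    rwa [hz] at this
  refine ⟨by rw [hz], ?_, fun r => φ' (f r 0) * F r, ?_, by simp only [hz, h2], ?_⟩
  · have h4 : HasDerivAt φ (φ' f0) (f 0 0) := by rw [hz]; exact hφ.self_of_nhds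
    exact HasDerivAt.comp (h := fun r => f r 0) (0 : ℝ) h4 hf.left
  · filter_upwards [h1, hc.eventually hφ] with r hr kr
    exact HasDerivAt.comp (0 : ℝ) kr hr
  · have h4 : HasDerivAt φ' c (f 0 0) := by rw [hz]; exact hφ'
    have h5 := (HasDerivAt.comp (h := fun r => f r 0) (0 : ℝ) h4 hf.left).mul h3
    simp only [Function.comp_apply, hz, h2] at h5
    exact h5

lemma inv (hf : HasJet f f0 fr fe fre) (h0 : f0 ≠ 0) :
    HasJet (fun r e => (f r e)⁻¹) f0⁻¹ (-(f0 ^ 2)⁻¹ * fr) (-(f0 ^ 2)⁻¹ * fe)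
      (2 / f0 ^ 3 * fr * fe + -(f0 ^ 2)⁻¹ * fre) := by
  refine hf.comp (φ' := fun y => -(y ^ 2)⁻¹) ?_ ?_
  · filter_upwards [isOpen_ne.mem_nhds h0] with y hy using hasDerivAt_inv hy
  · have := (((hasDerivAt_id f0).pow 2).inv (by simpa using h0)).neg
    refine this.congr_deriv ?_
    simp
    field_simp

/-- Presenting the base value as a square keeps the jet rational in b, so that later comparisons are
field identities. The constant -1/(4b³) is the second derivative of the square root at b². -/
lemma sqrt_of_sq {b : ℝ} (hf : HasJet f (b ^ 2) fr fe fre) (hb : 0 < b) :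
    HasJet (fun r e => √(f r e)) b (1 / (2 * b) * fr) (1 / (2 * b) * fe)
      (-1 / (4 * b ^ 3) * fr * fe + 1 / (2 * b) * fre) := by
  have hb2 : √(b ^ 2) = b := Real.sqrt_sq hb.le
  have hpos : (0 : ℝ) < b ^ 2 := by positivity
  refine (hf.comp (φ := fun y => √y) (φ' := fun y => 1 / (2 * √y)) (c := -1 / (4 * b ^ 3))
    ?_ ?_).congr_jet hb2 (by rw [hb2]) (by rw [hb2]) (by rw [hb2])
  · filter_upwards [isOpen_ne.mem_nhds hpos.ne'] with y hy using Real.hasDerivAt_sqrt hy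
  · have h1 := ((Real.hasDerivAt_sqrt hpos.ne').const_mul 2).inv (by rw [hb2]; positivity)
    simp only [one_div]
    refine h1.congr_deriv ?_
    rw [hb2]
    field_simp
    norm_num

end HasJet

/-- Entrywise jets of a matrix valued function. -/
def HasMatJet (F : ℝ → ℝ → Matrix (Fin 3) (Fin 3) ℝ) (F0 Fr Fe Fre : Matrix (Fin 3) (Fin 3) ℝ) :
    Prop :=
  ∀ a b, HasJet (fun r e => F r e a b) (F0 a b) (Fr a b) (Fe a b) (Fre a b)

namespace HasMatJet

variable {F G : ℝ → ℝ → Matrix (Fin 3) (Fin 3) ℝ} {F0 Fr Fe Fre G0 Gr Ge Gre h k :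
  Matrix (Fin 3) (Fin 3) ℝ}

lemma mul (hF : HasMatJet F F0 Fr Fe Fre) (hG : HasMatJet G G0 Gr Ge Gre) :
    HasMatJet (fun r e => F r e * G r e) (F0 * G0) (Fr * G0 + F0 * Gr) (Fe * G0 + F0 * Ge)
      (Fre * G0 + Fe * Gr + Fr * Ge + F0 * Gre) := by
  intro a b
  refine ((HasJet.sum Finset.univ fun c => (hF a c).mul (hG c b)).congr_fun fun r e => ?_).congr_jet
    ?_ ?_ ?_ ?_ <;> simp [Matrix.mul_apply, Finset.sum_add_distrib]

lemma trace (hF : HasMatJet F F0 Fr Fe Fre) :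
    HasJet (fun r e => (F r e).trace) F0.trace Fr.trace Fe.trace Fre.trace :=
  HasJet.sum Finset.univ fun c => hF c c

lemma det {A : ℝ} (hF : HasMatJet F (A • 1) h k 0) :
    HasJet (fun r e => (F r e).det) (A ^ 3) (A ^ 2 * h.trace) (A ^ 2 * k.trace)
      (A * (h.trace * k.trace - (h * k).trace)) := by
  simp only [Matrix.det_fin_three]
  refine ((((((((hF 0 0).mul (hF 1 1)).mul (hF 2 2)).sub
    (((hF 0 0).mul (hF 1 2)).mul (hF 2 1))).sub (((hF 0 1).mul (hF 1 0)).mul (hF 2 2))).add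
    (((hF 0 1).mul (hF 1 2)).mul (hF 2 0))).add (((hF 0 2).mul (hF 1 0)).mul (hF 2 1))).sub
    (((hF 0 2).mul (hF 1 1)).mul (hF 2 0))).congr_jet ?_ ?_ ?_ ?_ <;>
  simp [Matrix.trace, Matrix.mul_apply, Fin.sum_univ_three] <;> ring

lemma inv {A : ℝ} (hA : A ≠ 0) (hF : HasMatJet F (A • 1) h k 0) :
    HasMatJet (fun r e => (F r e)⁻¹) (A⁻¹ • 1) (-(A ^ 2)⁻¹ • h) (-(A ^ 2)⁻¹ • k)
      ((A ^ 3)⁻¹ • (h * k + k * h)) := by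
  have hd := hF.det.inv (pow_ne_zero 3 hA)
  intro i j
  simp only [Matrix.inv_def, Ring.inverse_eq_inv', Matrix.adjugate_fin_three, Matrix.smul_apply,
    smul_eq_mul]
  -- Cramer's rule: each entry of the inverse is a signed 2×2 minor over the determinant, and all
  -- nine have this shape with the sign absorbed in the order of the two products.
  have key : ∀ a b c d a' b' c' d' : Fin 3, HasJet
      (fun r e => (F r e).det⁻¹ * (F r e a b * F r e c d - F r e a' b' * F r e c' d')) _ _ _ _ :=
    fun a b c d a' b' c' d' =>
      hd.mul (((hF a b).mul (hF c d)).sub ((hF a' b').mul (hF c' d')))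
  fin_cases i <;> fin_cases j
  · refine ((key 1 1 2 2 1 2 2 1).congr_fun fun r e => by simp).congr_jet ?_ ?_ ?_ ?_ <;>
    simp [Matrix.trace, Matrix.mul_apply, Fin.sum_univ_three] <;> field_simp <;> ring
  · refine ((key 0 2 2 1 0 1 2 2).congr_fun fun r e => by simp; left; ring).congr_jet ?_ ?_ ?_ ?_ <;>
    simp [Matrix.trace, Matrix.mul_apply, Fin.sum_univ_three] <;> field_simp <;> ring
  · refine ((key 0 1 1 2 0 2 1 1).congr_fun fun r e => by simp).congr_jet ?_ ?_ ?_ ?_ <;>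
    simp [Matrix.trace, Matrix.mul_apply, Fin.sum_univ_three] <;> field_simp <;> ring
  · refine ((key 1 2 2 0 1 0 2 2).congr_fun fun r e => by simp; left; ring).congr_jet ?_ ?_ ?_ ?_ <;>
    simp [Matrix.trace, Matrix.mul_apply, Fin.sum_univ_three] <;> field_simp <;> ring
  · refine ((key 0 0 2 2 0 2 2 0).congr_fun fun r e => by simp).congr_jet ?_ ?_ ?_ ?_ <;>
    simp [Matrix.trace, Matrix.mul_apply, Fin.sum_univ_three] <;> field_simp <;> ring
  · refine ((key 0 2 1 0 0 0 1 2).congr_fun fun r e => by simp; left; ring).congr_jet ?_ ?_ ?_ ?_ <;>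
    simp [Matrix.trace, Matrix.mul_apply, Fin.sum_univ_three] <;> field_simp <;> ring
  · refine ((key 1 0 2 1 1 1 2 0).congr_fun fun r e => by simp).congr_jet ?_ ?_ ?_ ?_ <;>
    simp [Matrix.trace, Matrix.mul_apply, Fin.sum_univ_three] <;> field_simp <;> ring
  · refine ((key 0 1 2 0 0 0 2 1).congr_fun fun r e => by simp; left; ring).congr_jet ?_ ?_ ?_ ?_ <;>
    simp [Matrix.trace, Matrix.mul_apply, Fin.sum_univ_three] <;> field_simp <;> ring
  · refine ((key 0 0 1 1 0 1 1 0).congr_fun fun r e => by simp).congr_jet ?_ ?_ ?_ ?_ <;>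
    simp [Matrix.trace, Matrix.mul_apply, Fin.sum_univ_three] <;> field_simp <;> ring

end HasMatJet

end CosmoPert

namespace CosmoPert

open Filter Topology

noncomputable section

/-! ### Variations of the constraints at the background -/

namespace PhasePoint

variable (m n : PhasePoint) (r : ℝ)

@[simp] lemma add_q : (m + n).q = m.q + n.q := rfl
@[simp] lemma add_P : (m + n).P = m.P + n.P := rfl
@[simp] lemma add_N : (m + n).N = m.N + n.N := rfl
@[simp] lemma add_PiN : (m + n).PiN = m.PiN + n.PiN := rfl
@[simp] lemma add_shift : (m + n).shift = m.shift + n.shift := rfl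
@[simp] lemma add_PiShift : (m + n).PiShift = m.PiShift + n.PiShift := rfl
@[simp] lemma add_phi : (m + n).phi = m.phi + n.phi := rfl
@[simp] lemma add_piPhi : (m + n).piPhi = m.piPhi + n.piPhi := rfl
@[simp] lemma smul_q : (r • m).q = r • m.q := rfl
@[simp] lemma smul_P : (r • m).P = r • m.P := rfl
@[simp] lemma smul_N : (r • m).N = r • m.N := rfl
@[simp] lemma smul_PiN : (r • m).PiN = r • m.PiN := rfl
@[simp] lemma smul_shift : (r • m).shift = r • m.shift := rfl
@[simp] lemma smul_PiShift : (r • m).PiShift = r • m.PiShift := rfl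
@[simp] lemma smul_phi : (r • m).phi = r • m.phi := rfl
@[simp] lemma smul_piPhi : (r • m).piPhi = r • m.piPhi := rfl

lemma ext_fields {m n : PhasePoint} (hq : m.q = n.q) (hP : m.P = n.P) (hN : m.N = n.N)
    (hPiN : m.PiN = n.PiN) (hs : m.shift = n.shift) (hPs : m.PiShift = n.PiShift)
    (hf : m.phi = n.phi) (hp : m.piPhi = n.piPhi) : m = n := by
  cases m
  cases n
  simp_all

lemma add_zero_smul : m + (0 : ℝ) • n = m := by
  apply ext_fields <;> simp

end PhasePoint

/-- Smooth variations of the phase space variables with symmetric metric and momentum. -/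
structure IsSmoothVariation (u : PhasePoint) : Prop where
  q_smooth : ∀ a b, ContDiff ℝ ∞ fun x => u.q x a b
  q_symm : ∀ a b x, u.q x a b = u.q x b a
  P_smooth : ∀ a b, ContDiff ℝ ∞ fun x => u.P x a b
  P_symm : ∀ a b x, u.P x a b = u.P x b a
  N_smooth : ContDiff ℝ ∞ u.N
  PiN_smooth : ContDiff ℝ ∞ u.PiN
  shift_smooth : ∀ a, ContDiff ℝ ∞ fun x => u.shift x a
  PiShift_smooth : ∀ a, ContDiff ℝ ∞ fun x => u.PiShift x a
  phi_smooth : ContDiff ℝ ∞ u.phi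
  piPhi_smooth : ContDiff ℝ ∞ u.piPhi

lemma IsTestVariation.isSmoothVariation {η : PhasePoint} (h : IsTestVariation η) :
    IsSmoothVariation η where
  q_smooth a b := (h.q_test a b).1
  q_symm a b x := (h.q_symm x).apply b a
  P_smooth a b := (h.P_test a b).1
  P_symm a b x := (h.P_symm x).apply b a
  N_smooth := h.N_test.1
  PiN_smooth := h.PiN_test.1
  shift_smooth a := (h.shift_test a).1
  PiShift_smooth a := (h.PiShift_test a).1
  phi_smooth := h.phi_test.1
  piPhi_smooth := h.piPhi_test.1

/-! ### Differential operators occurring in the variations of a flat metric -/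

section FirstOrderOperators

variable (h k : Space → Matrix (Fin 3) (Fin 3) ℝ)

/-- The part of the Riemann tensor that is linear in the metric. -/
def riemannLin (a b c d : Fin 3) (x : Space) : ℝ :=
  (pd b (pd c (fun y => h y a d)) x + pd a (pd d (fun y => h y b c)) x
    - pd a (pd c (fun y => h y b d)) x - pd b (pd d (fun y => h y a c)) x) / 2

/-- `∂_a ∂_b h_{ab} - Δ h_{aa}`. -/
def curvatureLin (x : Space) : ℝ :=
  ∑ a, ∑ b, (pd a (pd b (fun y => h y a b)) x - pd a (pd a (fun y => h y b b)) x)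

/-- The mixed second variation of the scalar curvature at the metric `δ_{ab}`. -/
def curvatureQuad (x : Space) : ℝ :=
  (∑ a, ∑ b, ∑ e, (christoffel h e b a x * christoffel k e a b x
      + christoffel k e b a x * christoffel h e a b x
      - christoffel h e b b x * christoffel k e a a x
      - christoffel k e b b x * christoffel h e a a x))
  - ∑ a, ∑ b, ∑ c, (h x a c * (riemannLin k a b c b x + riemannLin k b a b c x)
      + k x a c * (riemannLin h a b c b x + riemannLin h b a b c x))

/-- `∂_b p_{ab}`. -/
def divergence (a : Fin 3) (x : Space) : ℝ := ∑ b, pd b (fun y => h y b a) x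

end FirstOrderOperators

/-! ### Jets of the fields and of the scalar curvature along the two-parameter family -/

section Jets

variable {M : Model} {bg : Background} {t a : ℝ} {u η : PhasePoint}

lemma pd_affine {f g : Space → ℝ} (hf : ContDiff ℝ ∞ f) (hg : ContDiff ℝ ∞ g) (c : Fin 3)
    (k r e : ℝ) :
    pd c (fun y => k + r * f y + e * g y) = fun x => r * pd c f x + e * pd c g x := by
  rw [pd_add c (by fun_prop) (by fun_prop), pd_add c (by fun_prop) (by fun_prop),
    pd_const_mul c r hf, pd_const_mul c e hg, pd_const]
  simp

lemma pd_pd_affine {f g : Space → ℝ} (hf : ContDiff ℝ ∞ f) (hg : ContDiff ℝ ∞ g) (c d : Fin 3)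
    (k r e : ℝ) :
    pd d (pd c (fun y => k + r * f y + e * g y)) =
      fun x => r * pd d (pd c f) x + e * pd d (pd c g) x := by
  rw [pd_affine hf hg, pd_add d (by fun_prop) (by fun_prop), pd_const_mul d r (by fun_prop),
    pd_const_mul d e (by fun_prop)]

lemma perturbed_q (r e : ℝ) (x : Space) (i j : Fin 3) :
    (bg.point t + r • u + e • η).q x i j =
      bg.A t * (1 : Matrix (Fin 3) (Fin 3) ℝ) i j + r * u.q x i j + e * η.q x i j := rfl

lemma perturbed_P (r e : ℝ) (x : Space) (i j : Fin 3) :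
    (bg.point t + r • u + e • η).P x i j =
      bg.Pt t * (1 : Matrix (Fin 3) (Fin 3) ℝ) i j + r * u.P x i j + e * η.P x i j := rfl

lemma perturbed_phi (r e : ℝ) :
    (bg.point t + r • u + e • η).phi = fun x => bg.phi t + r * u.phi x + e * η.phi x := rfl

lemma perturbed_piPhi (r e : ℝ) (x : Space) :
    (bg.point t + r • u + e • η).piPhi x = bg.piPhi t + r * u.piPhi x + e * η.piPhi x := rfl

lemma perturbed_N (r e : ℝ) (x : Space) :
    (bg.point t + r • u + e • η).N x = bg.N t + r * u.N x + e * η.N x := rfl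

lemma perturbed_PiN (r e : ℝ) (x : Space) :
    (bg.point t + r • u + e • η).PiN x = 0 + r * u.PiN x + e * η.PiN x := rfl

lemma perturbed_shift (r e : ℝ) (x : Space) (i : Fin 3) :
    (bg.point t + r • u + e • η).shift x i = 0 + r * u.shift x i + e * η.shift x i := rfl

lemma perturbed_PiShift (r e : ℝ) (x : Space) (i : Fin 3) :
    (bg.point t + r • u + e • η).PiShift x i = 0 + r * u.PiShift x i + e * η.PiShift x i := rfl

lemma hasMatJet_q (x : Space) :
    HasMatJet (fun r e => (bg.point t + r • u + e • η).q x) (bg.A t • 1) (u.q x) (η.q x) 0 :=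
  fun i j => (HasJet.affine _ _ _).congr_fun fun r e => perturbed_q r e x i j

lemma hasMatJet_P (x : Space) :
    HasMatJet (fun r e => (bg.point t + r • u + e • η).P x) (bg.Pt t • 1) (u.P x) (η.P x) 0 :=
  fun i j => (HasJet.affine _ _ _).congr_fun fun r e => perturbed_P r e x i j

lemma christoffel_perturbed (hu : IsSmoothVariation u) (hη : IsSmoothVariation η)
    (i j k : Fin 3) (x : Space) (r e : ℝ) :
    christoffel (bg.point t + r • u + e • η).q i j k x =
      0 + r * christoffel u.q i j k x + e * christoffel η.q i j k x := by
  simp only [christoffel, perturbed_q, pd_affine (hu.q_smooth _ _) (hη.q_smooth _ _)]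
  ring

lemma hasJet_christoffel (hu : IsSmoothVariation u) (hη : IsSmoothVariation η)
    (i j k : Fin 3) (x : Space) :
    HasJet (fun r e => christoffel (bg.point t + r • u + e • η).q i j k x) 0
      (christoffel u.q i j k x) (christoffel η.q i j k x) 0 :=
  (HasJet.affine _ _ _).congr_fun fun r e => christoffel_perturbed hu hη i j k x r e

lemma hasJet_riemannLin (hu : IsSmoothVariation u) (hη : IsSmoothVariation η)
    (i j k l : Fin 3) (x : Space) :
    HasJet (fun r e => riemannLin (bg.point t + r • u + e • η).q i j k l x) 0
      (riemannLin u.q i j k l x) (riemannLin η.q i j k l x) 0 := by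
  refine (HasJet.affine _ _ _).congr_fun fun r e => ?_
  simp only [riemannLin, perturbed_q, pd_pd_affine (hu.q_smooth _ _) (hη.q_smooth _ _)]
  ring

lemma sum_delta_delta (F : Fin 3 → Fin 3 → Fin 3 → Fin 3 → ℝ) :
    ∑ a, ∑ b, ∑ c, ∑ d, (if a = c then (1 : ℝ) else 0) * (if b = d then 1 else 0) * F a b c d =
      ∑ a, ∑ b, F a b a b := by
  simp [Finset.sum_ite_eq, ite_mul, mul_ite]

lemma sum_delta_left (G : Fin 3 → Fin 3 → ℝ) (F : Fin 3 → Fin 3 → Fin 3 → Fin 3 → ℝ) :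
    ∑ a, ∑ b, ∑ c, ∑ d, (if a = c then (1 : ℝ) else 0) * G b d * F a b c d =
      ∑ a, ∑ b, ∑ c, G a c * F b a b c := by
  simp only [ite_mul, one_mul, zero_mul]
  rw [Finset.sum_comm]
  refine Finset.sum_congr rfl fun b _ => ?_
  refine Finset.sum_congr rfl fun a _ => ?_
  rw [Finset.sum_comm]
  simp

lemma sum_delta_right (G : Fin 3 → Fin 3 → ℝ) (F : Fin 3 → Fin 3 → Fin 3 → Fin 3 → ℝ) :
    ∑ a, ∑ b, ∑ c, ∑ d, G a c * (if b = d then (1 : ℝ) else 0) * F a b c d =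
      ∑ a, ∑ b, ∑ c, G a c * F a b c b := by
  simp

/-- The background metric is constant, so the Christoffel symbols and the linear part of the Riemann
tensor vanish there. The mixed second variation thus comes only from the Γ·Γ terms and from the
first variation of one inverse metric times the linear Riemann tensor. Each carries three inverse
powers of A. -/
lemma hasJet_scalarCurvature (hA : bg.A t ≠ 0) (hu : IsSmoothVariation u)
    (hη : IsSmoothVariation η) (x : Space) :
    HasJet (fun r e => scalarCurvature (bg.point t + r • u + e • η).q x) 0
      (curvatureLin u.q x / bg.A t ^ 2) (curvatureLin η.q x / bg.A t ^ 2)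
      (curvatureQuad u.q η.q x / bg.A t ^ 3) := by
  have hi := (hasMatJet_q (bg := bg) (t := t) (u := u) (η := η) x).inv hA
  have hR : ∀ i j k l, HasJet (fun r e => riemann (bg.point t + r • u + e • η).q i j k l x) 0
      (riemannLin u.q i j k l x) (riemannLin η.q i j k l x)
      ((bg.A t)⁻¹ * ∑ e, (christoffel u.q e j k x * christoffel η.q e i l x
        + christoffel η.q e j k x * christoffel u.q e i l x
        - christoffel u.q e j l x * christoffel η.q e i k x
        - christoffel η.q e j l x * christoffel u.q e i k x)) := by
    intro i j k l
    refine ((hasJet_riemannLin hu hη i j k l x).add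
      (HasJet.sum Finset.univ fun e => HasJet.sum Finset.univ fun f => (hi e f).mul
        (((hasJet_christoffel hu hη e j k x).mul (hasJet_christoffel hu hη f i l x)).sub
        ((hasJet_christoffel hu hη e j l x).mul (hasJet_christoffel hu hη f i k x))))).congr_jet
      ?_ ?_ ?_ ?_
    · simp
    · simp
    · simp
    · simp only [Matrix.smul_apply, Matrix.one_apply, smul_eq_mul, mul_ite, ite_mul, mul_one,
        mul_zero, zero_mul, add_zero, zero_add, sub_zero, Finset.sum_ite_eq, Finset.mem_univ,
        if_true, Finset.mul_sum]
      refine Finset.sum_congr rfl fun e _ => ?_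
      ring
  -- Contracting the linear Riemann tensor with the flat metric gives the usual double divergence
  -- minus the Laplacian of the trace; only symmetry of h is needed.
  have hc : ∀ h : Space → Matrix (Fin 3) (Fin 3) ℝ, (∀ i j y, h y i j = h y j i) →
      (∑ i, ∑ j, riemannLin h i j i j x) = curvatureLin h x := by
    intro h hs
    have hs' : ∀ i j, (fun y => h y i j) = fun y => h y j i := fun i j => funext (hs i j)
    have e1 := hs' 1 0
    have e2 := hs' 2 0
    have e3 := hs' 2 1
    simp only [riemannLin, curvatureLin, Fin.sum_univ_three, e1, e2, e3]
    ring
  refine (HasJet.sum Finset.univ fun i => HasJet.sum Finset.univ fun j =>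
    HasJet.sum Finset.univ fun k => HasJet.sum Finset.univ fun l =>
      ((hi i k).mul (hi j l)).mul (hR i j k l)).congr_jet ?_ ?_ ?_ ?_
  · simp
  · rw [← hc u.q hu.q_symm, ← sum_delta_delta fun i j k l => riemannLin u.q i j k l x]
    simp only [Finset.sum_div]
    refine Finset.sum_congr rfl fun i _ => Finset.sum_congr rfl fun j _ =>
      Finset.sum_congr rfl fun k _ => Finset.sum_congr rfl fun l _ => ?_
    simp only [Matrix.smul_apply, Matrix.one_apply, smul_eq_mul]
    field_simp
    ring
  · rw [← hc η.q hη.q_symm, ← sum_delta_delta fun i j k l => riemannLin η.q i j k l x]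
    simp only [Finset.sum_div]
    refine Finset.sum_congr rfl fun i _ => Finset.sum_congr rfl fun j _ =>
      Finset.sum_congr rfl fun k _ => Finset.sum_congr rfl fun l _ => ?_
    simp only [Matrix.smul_apply, Matrix.one_apply, smul_eq_mul]
    field_simp
    ring
  -- Writing the contractions in `curvatureQuad` with explicit deltas puts both sides under the same
  -- fourfold sum, where they agree summand by summand.
  · have key : curvatureQuad u.q η.q x =
        (∑ i, ∑ j, ∑ k, ∑ l, (if i = k then (1 : ℝ) else 0) * (if j = l then 1 else 0) *
          ∑ e, (christoffel u.q e j k x * christoffel η.q e i l x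
        + christoffel η.q e j k x * christoffel u.q e i l x
        - christoffel u.q e j l x * christoffel η.q e i k x
        - christoffel η.q e j l x * christoffel u.q e i k x))
        - ((∑ i, ∑ j, ∑ k, ∑ l, u.q x i k * (if j = l then (1 : ℝ) else 0)
              * riemannLin η.q i j k l x)
          + (∑ i, ∑ j, ∑ k, ∑ l, (if i = k then (1 : ℝ) else 0) * u.q x j l
              * riemannLin η.q i j k l x)
          + (∑ i, ∑ j, ∑ k, ∑ l, η.q x i k * (if j = l then (1 : ℝ) else 0)
              * riemannLin u.q i j k l x)
          + (∑ i, ∑ j, ∑ k, ∑ l, (if i = k then (1 : ℝ) else 0) * η.q x j l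
              * riemannLin u.q i j k l x)) := by
      rw [sum_delta_delta, sum_delta_left (fun i j => u.q x i j) (fun i j k l => riemannLin η.q i j k l x),
        sum_delta_left (fun i j => η.q x i j) (fun i j k l => riemannLin u.q i j k l x),
        sum_delta_right (fun i j => u.q x i j) (fun i j k l => riemannLin η.q i j k l x),
        sum_delta_right (fun i j => η.q x i j) (fun i j k l => riemannLin u.q i j k l x),
        curvatureQuad]
      simp only [← Finset.sum_add_distrib]
      congr 1
      refine Finset.sum_congr rfl fun i _ => Finset.sum_congr rfl fun j _ =>
        Finset.sum_congr rfl fun k _ => ?_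
      ring
    rw [key]
    simp only [← Finset.sum_add_distrib, ← Finset.sum_sub_distrib, Finset.sum_div]
    refine Finset.sum_congr rfl fun i _ => Finset.sum_congr rfl fun j _ =>
      Finset.sum_congr rfl fun k _ => Finset.sum_congr rfl fun l _ => ?_
    simp only [Matrix.smul_apply, Matrix.one_apply, smul_eq_mul]
    generalize (∑ e, (christoffel u.q e j k x * christoffel η.q e i l x
        + christoffel η.q e j k x * christoffel u.q e i l x
        - christoffel u.q e j l x * christoffel η.q e i k x
        - christoffel η.q e j l x * christoffel u.q e i k x)) = S
    field_simp
    ring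

end Jets

end

end CosmoPert

namespace CosmoPert

open Filter Topology

noncomputable section

/-! ### First and mixed second variations of the Hamiltonian and diffeomorphism constraints -/

section ConstraintVariations

/-- The mixed second variation of `√q` at `q = δ`. -/
def volumeQuad (h k : Matrix (Fin 3) (Fin 3) ℝ) : ℝ :=
  h.trace * k.trace / 4 - (h * k).trace / 2

/-- The mixed second variation of `1/√q` at `q = δ`. -/
def invVolumeQuad (h k : Matrix (Fin 3) (Fin 3) ℝ) : ℝ :=
  h.trace * k.trace / 4 + (h * k).trace / 2

/-- The first variation of `P_{ab} P^{ab} - (P^a_a)^2/2` at `q = a² δ` and `P^{ab} = P δ^{ab}`. -/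
def kineticLin (a P : ℝ) (h p : Matrix (Fin 3) (Fin 3) ℝ) : ℝ :=
  -(a ^ 2 * P * (P * h.trace + a ^ 2 * p.trace))

/-- The mixed second variation of `P_{ab} P^{ab} - (P^a_a)^2/2`. -/
def kineticQuad (a P : ℝ) (h p k r : Matrix (Fin 3) (Fin 3) ℝ) : ℝ :=
  2 * (P ^ 2 * (h * k).trace + a ^ 2 * P * ((h * r).trace + (k * p).trace) + a ^ 4 * (p * r).trace)
    - (P * h.trace + a ^ 2 * p.trace) * (P * k.trace + a ^ 2 * r.trace)
    - a ^ 2 * P * ((h * r).trace + (k * p).trace)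

/-- The first variation of the Hamiltonian constraint at a homogeneous point with scale factor `a`,
momentum `P` and scalar field `f`, `π`. -/
def hamiltonianLin (M : Model) (a P f π : ℝ) (u : PhasePoint) (x : Space) : ℝ :=
  -(P ^ 2 / (4 * a) * (u.q x).trace) - a * P * (u.P x).trace - curvatureLin u.q x / a
    + M.kappa * (M.lam * π / a ^ 3 * u.piPhi x - M.lam * π ^ 2 / (4 * a ^ 5) * (u.q x).trace
      + a * M.V f / (4 * M.lam) * (u.q x).trace + a ^ 3 * deriv M.V f / (2 * M.lam) * u.phi x)

/-- The first variation of the diffeomorphism constraint. -/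
def diffeoLin (M : Model) (a P π : ℝ) (u : PhasePoint) (i : Fin 3) (x : Space) : ℝ :=
  -2 * a ^ 2 * divergence u.P i x - 2 * P * (∑ b, christoffel u.q i b b x)
    + M.kappa * π * pd i u.phi x

/-- The mixed second variation of the Hamiltonian constraint without the curvature and gradient
terms. -/
def hamiltonianQuadLocal (M : Model) (a P f π : ℝ) (u η : PhasePoint) (x : Space) : ℝ :=
  P ^ 2 / a ^ 3 * (5 / 4 * (u.q x * η.q x).trace - 3 / 8 * ((u.q x).trace * (η.q x).trace))
    + P / a * ((u.q x * η.P x).trace + (η.q x * u.P x).trace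
      - ((u.q x).trace * (η.P x).trace + (u.P x).trace * (η.q x).trace) / 2)
    + a * (2 * (u.P x * η.P x).trace - (u.P x).trace * (η.P x).trace)
    + M.kappa * (M.lam / a ^ 3 * (u.piPhi x * η.piPhi x)
      - M.lam * π / (2 * a ^ 5) * (u.piPhi x * (η.q x).trace + η.piPhi x * (u.q x).trace)
      + M.lam * π ^ 2 / (2 * a ^ 7) * invVolumeQuad (u.q x) (η.q x)
      + a ^ 3 * deriv (deriv M.V) f / (2 * M.lam) * (u.phi x * η.phi x)
      + a * deriv M.V f / (4 * M.lam) * ((u.q x).trace * η.phi x + (η.q x).trace * u.phi x)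
      + M.V f / (2 * M.lam * a) * volumeQuad (u.q x) (η.q x))

/-- The curvature terms of the mixed second variation of `√q R`. -/
def einsteinHilbertQuad (a : ℝ) (u η : PhasePoint) (x : Space) : ℝ :=
  (curvatureQuad u.q η.q x + (u.q x).trace / 2 * curvatureLin η.q x
    + (η.q x).trace / 2 * curvatureLin u.q x) / a ^ 3

/-- The mixed second variation of the Hamiltonian constraint. -/
def hamiltonianQuad (M : Model) (a P f π : ℝ) (u η : PhasePoint) (x : Space) : ℝ :=
  hamiltonianQuadLocal M a P f π u η x - einsteinHilbertQuad a u η x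
    + M.kappa * (a / M.lam) * ∑ i, pd i u.phi x * pd i η.phi x

variable {M : Model} {bg : Background} {t a : ℝ} {u η : PhasePoint}

lemma hasJet_V (M : Model) {f : ℝ → ℝ → ℝ} {f0 fr fe fre : ℝ} (hf : HasJet f f0 fr fe fre) :
    HasJet (fun r e => M.V (f r e)) (M.V f0) (deriv M.V f0 * fr) (deriv M.V f0 * fe)
      (deriv (deriv M.V) f0 * fr * fe + deriv M.V f0 * fre) := by
  have h1 : ContDiff ℝ ∞ (deriv M.V) := (contDiff_infty_iff_deriv.1 M.V_smooth).2
  refine hf.comp (φ' := deriv M.V) (Eventually.of_forall fun y => ?_) ?_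
  · exact ((M.V_smooth.differentiable (by simp)) y).hasDerivAt
  · exact ((h1.differentiable (by simp)) f0).hasDerivAt

lemma hasJet_kinetic {q P : ℝ → ℝ → Matrix (Fin 3) (Fin 3) ℝ} {p0 : ℝ}
    {h p k r : Matrix (Fin 3) (Fin 3) ℝ} (hq : HasMatJet q (a ^ 2 • 1) h k 0)
    (hP : HasMatJet P (p0 • 1) p r 0) :
    HasJet (fun s e => (q s e * P s e * q s e * P s e).trace - (q s e * P s e).trace ^ 2 / 2)
      (-3 / 2 * a ^ 4 * p0 ^ 2) (kineticLin a p0 h p) (kineticLin a p0 k r)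
      (kineticQuad a p0 h p k r) := by
  have hY := hq.mul hP
  have hT := hY.trace
  have hYY := (hY.mul hY).trace
  refine ((hYY.sub ((hT.mul hT).const_mul (1 / 2))).congr_fun fun s e => ?_).congr_jet ?_ ?_ ?_ ?_
  · rw [Matrix.mul_assoc (q s e * P s e)]; ring
  · simp [Matrix.trace]; ring
  · simp [kineticLin, Matrix.trace, Fin.sum_univ_three]; ring
  · simp [kineticLin, Matrix.trace, Fin.sum_univ_three]; ring
  · simp [kineticQuad, Matrix.trace, Matrix.mul_apply, Fin.sum_univ_three]; ring

lemma hasJet_sqrt_det {q : ℝ → ℝ → Matrix (Fin 3) (Fin 3) ℝ} {h k : Matrix (Fin 3) (Fin 3) ℝ}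
    (ha : 0 < a) (hq : HasMatJet q (a ^ 2 • 1) h k 0) :
    HasJet (fun s e => √(q s e).det) (a ^ 3) (a * h.trace / 2) (a * k.trace / 2)
      (volumeQuad h k / a) := by
  have hd := hq.det.congr_jet (f0' := (a ^ 3) ^ 2) (by ring) rfl rfl rfl
  refine (hd.sqrt_of_sq (by positivity)).congr_jet rfl ?_ ?_ ?_ <;>
  (try simp only [volumeQuad]) <;> field_simp
  ring

lemma hasJet_inv_sqrt_det {q : ℝ → ℝ → Matrix (Fin 3) (Fin 3) ℝ} {h k : Matrix (Fin 3) (Fin 3) ℝ}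
    (ha : 0 < a) (hq : HasMatJet q (a ^ 2 • 1) h k 0) :
    HasJet (fun s e => (√(q s e).det)⁻¹) (a ^ 3)⁻¹ (-h.trace / (2 * a ^ 5)) (-k.trace / (2 * a ^ 5))
      (invVolumeQuad h k / a ^ 7) := by
  refine ((hasJet_sqrt_det ha hq).inv (by positivity)).congr_jet rfl ?_ ?_ ?_ <;>
  (try simp only [volumeQuad, invVolumeQuad]) <;> field_simp
  ring

/-- Assembled from the jets of the kinetic term, √q and its inverse, R, and the matter fields. With
A = a² all coefficients are rational in a. The background value c stays unspecified: in the second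
variation it would only multiply the mixed variation of the lapse, which is zero. -/
lemma hasJet_hamiltonianConstraint (ha : 0 < a) (hA : bg.A t = a ^ 2) (hu : IsSmoothVariation u)
    (hη : IsSmoothVariation η) (x : Space) :
    ∃ c, HasJet (fun r e => hamiltonianConstraint M (bg.point t + r • u + e • η) x) c
      (hamiltonianLin M a (bg.Pt t) (bg.phi t) (bg.piPhi t) u x)
      (hamiltonianLin M a (bg.Pt t) (bg.phi t) (bg.piPhi t) η x)
      (hamiltonianQuad M a (bg.Pt t) (bg.phi t) (bg.piPhi t) u η x) := by
  have hA0 : bg.A t ≠ 0 := by rw [hA]; positivity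
  have hq := hasMatJet_q (bg := bg) (t := t) (u := u) (η := η) x
  have hR := hasJet_scalarCurvature hA0 hu hη x
  rw [hA] at hq hR
  have hP := hasMatJet_P (bg := bg) (t := t) (u := u) (η := η) x
  have hK := hasJet_kinetic hq hP
  have hs := hasJet_sqrt_det ha hq
  have hsi := hasJet_inv_sqrt_det ha hq
  have hi := hq.inv (by positivity)
  have hpi : HasJet (fun r e => (bg.point t + r • u + e • η).piPhi x) _ _ _ _ :=
    (HasJet.affine _ _ _).congr_fun fun r e => perturbed_piPhi r e x
  have hV : HasJet (fun r e => M.V ((bg.point t + r • u + e • η).phi x)) _ _ _ _ :=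
    hasJet_V M (HasJet.affine (bg.phi t) (u.phi x) (η.phi x))
  have hd : ∀ i, HasJet (fun r e => pd i (bg.point t + r • u + e • η).phi x) 0
      (pd i u.phi x) (pd i η.phi x) 0 := fun i =>
    (HasJet.affine _ _ _).congr_fun fun r e => by
      rw [perturbed_phi, pd_affine hu.phi_smooth hη.phi_smooth]; ring
  have hgrad : HasJet (fun r e => ∑ i, ∑ j, ((bg.point t + r • u + e • η).q x)⁻¹ i j *
      pd i (bg.point t + r • u + e • η).phi x * pd j (bg.point t + r • u + e • η).phi x) 0 0 0
      (2 / a ^ 2 * ∑ i, pd i u.phi x * pd i η.phi x) := by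
    refine (HasJet.sum Finset.univ fun i => HasJet.sum Finset.univ fun j =>
      ((hi i j).mul (hd i)).mul (hd j)).congr_jet (by simp) (by simp) (by simp) ?_
    simp [Matrix.one_apply, Fin.sum_univ_three]
    field_simp
    ring
  have hl := M.lam_ne_zero
  have h1 := ((hK.mul hsi).sub (hs.mul hR)).add (((((hpi.mul hpi).mul hsi).const_mul
    (M.lam / 2)).add ((hs.mul (hgrad.add hV)).const_mul (1 / (2 * M.lam)))).const_mul M.kappa)
  refine ⟨_, (h1.congr_fun fun r e => ?_).congr_jet rfl ?_ ?_ ?_⟩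
  · rw [hamiltonianConstraint]
    simp only [div_eq_mul_inv, mul_inv]
    ring
  · rw [hamiltonianLin, kineticLin]
    field_simp
    ring
  · rw [hamiltonianLin, kineticLin]
    field_simp
    ring
  · rw [hamiltonianQuad, hamiltonianQuadLocal, einsteinHilbertQuad, kineticQuad, kineticLin,
      kineticLin, invVolumeQuad, volumeQuad]
    field_simp
    ring

/-- Here the mixed variation may stay unspecified, because the background shift that multiplies it
is zero. -/
lemma hasJet_diffeoConstraint (hA : bg.A t = a ^ 2) (hu : IsSmoothVariation u)
    (hη : IsSmoothVariation η) (i : Fin 3) (x : Space) :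
    ∃ c, HasJet (fun r e => diffeoConstraint M (bg.point t + r • u + e • η) i x) 0
      (diffeoLin M a (bg.Pt t) (bg.piPhi t) u i x)
      (diffeoLin M a (bg.Pt t) (bg.piPhi t) η i x) c := by
  have hq := hasMatJet_q (bg := bg) (t := t) (u := u) (η := η) x
  have hP := hasMatJet_P (bg := bg) (t := t) (u := u) (η := η) x
  have hdP : ∀ b c, HasJet (fun r e => pd b (fun y => (bg.point t + r • u + e • η).P y b c) x) 0
      (pd b (fun y => u.P y b c) x) (pd b (fun y => η.P y b c) x) 0 := fun b c =>
    (HasJet.affine _ _ _).congr_fun fun r e => by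
      simp only [perturbed_P, pd_affine (hu.P_smooth b c) (hη.P_smooth b c)]; ring
  have hpi : HasJet (fun r e => (bg.point t + r • u + e • η).piPhi x) _ _ _ _ :=
    (HasJet.affine _ _ _).congr_fun fun r e => perturbed_piPhi r e x
  have hd : HasJet (fun r e => pd i (bg.point t + r • u + e • η).phi x) 0
      (pd i u.phi x) (pd i η.phi x) 0 :=
    (HasJet.affine _ _ _).congr_fun fun r e => by
      rw [perturbed_phi, pd_affine hu.phi_smooth hη.phi_smooth]; ring
  have h1 := ((((HasJet.sum Finset.univ fun b => HasJet.sum Finset.univ fun c =>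
    (hq i c).mul (hdP b c)).const_mul (-2)).sub
    ((HasJet.sum Finset.univ fun b => HasJet.sum Finset.univ fun d =>
      (hasJet_christoffel (bg := bg) (t := t) hu hη i b d x).mul (hP b d)).const_mul 2)).add
    ((hpi.mul hd).const_mul M.kappa))
  refine ⟨_, (h1.congr_fun fun r e => ?_).congr_jet ?_ ?_ ?_ rfl⟩
  · rw [diffeoConstraint]
    ring
  · simp
  · simp [diffeoLin, divergence, hA, Matrix.one_apply, ← Finset.mul_sum, ← Finset.sum_mul]
    ring
  · simp [diffeoLin, divergence, hA, Matrix.one_apply, ← Finset.mul_sum, ← Finset.sum_mul]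
    ring

lemma deriv_hamiltonianConstraint (ha : 0 < a) (hA : bg.A t = a ^ 2) (hu : IsSmoothVariation u)
    (x : Space) : deriv (fun e : ℝ => hamiltonianConstraint M (bg.point t + e • u) x) 0 =
      hamiltonianLin M a (bg.Pt t) (bg.phi t) (bg.piPhi t) u x := by
  obtain ⟨c, h⟩ := hasJet_hamiltonianConstraint (M := M) ha hA hu hu x
  simpa only [PhasePoint.add_zero_smul] using h.deriv_right

lemma deriv_diffeoConstraint (hA : bg.A t = a ^ 2) (hu : IsSmoothVariation u) (i : Fin 3)
    (x : Space) : deriv (fun e : ℝ => diffeoConstraint M (bg.point t + e • u) i x) 0 =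
      diffeoLin M a (bg.Pt t) (bg.piPhi t) u i x := by
  obtain ⟨c, h⟩ := hasJet_diffeoConstraint (M := M) hA hu hu i x
  simpa only [PhasePoint.add_zero_smul] using h.deriv_right

lemma deriv_smearedConstraints (ha : 0 < a) (hA : bg.A t = a ^ 2) (hη : IsSmoothVariation η)
    (xi : Space → ℝ) (xiVec : Space → Fin 3 → ℝ) (chi : Space → ℝ) (chiVec : Space → Fin 3 → ℝ)
    (x : Space) :
    deriv (fun e : ℝ => smearedConstraints M (bg.point t + e • η) xi xiVec chi chiVec x) 0 =
      xi x * hamiltonianLin M a (bg.Pt t) (bg.phi t) (bg.piPhi t) η x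
        + (∑ i, xiVec x i * diffeoLin M a (bg.Pt t) (bg.piPhi t) η i x)
        + chi x * η.PiN x + ∑ i, chiVec x i * η.PiShift x i := by
  obtain ⟨c, hC⟩ := hasJet_hamiltonianConstraint (M := M) ha hA hη hη x
  choose d hD using fun i => hasJet_diffeoConstraint (M := M) hA hη hη i x
  have hN : HasJet (fun r e => (bg.point t + r • η + e • η).PiN x) _ _ _ _ :=
    (HasJet.affine _ _ _).congr_fun fun r e => perturbed_PiN r e x
  have hS : ∀ i, HasJet (fun r e => (bg.point t + r • η + e • η).PiShift x i) _ _ _ _ := fun i =>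
    (HasJet.affine _ _ _).congr_fun fun r e => perturbed_PiShift r e x i
  have h := (((hC.const_mul (xi x)).add
    (HasJet.sum Finset.univ fun i => (hD i).const_mul (xiVec x i))).add
      (hN.const_mul (chi x))).add (HasJet.sum Finset.univ fun i => (hS i).const_mul (chiVec x i))
  simpa only [smearedConstraints, PhasePoint.add_zero_smul] using h.deriv_right

/-- The Leibniz rule for multiplier times constraint. Lapse, shift and their momenta are affine in
both parameters, and shift, Π, Π_a and C_a vanish at the background, so each product contributes
only cross terms, plus N times the second variation of C. -/
lemma secondVariation_eq (ha : 0 < a) (hA : bg.A t = a ^ 2) (hu : IsSmoothVariation u)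
    (hη : IsSmoothVariation η) (dl dlHat : Space → ℝ) (x : Space) :
    secondVariation M bg t u dl dlHat η x =
      bg.N t * hamiltonianQuad M a (bg.Pt t) (bg.phi t) (bg.piPhi t) u η x
        + u.N x * hamiltonianLin M a (bg.Pt t) (bg.phi t) (bg.piPhi t) η x
        + η.N x * hamiltonianLin M a (bg.Pt t) (bg.phi t) (bg.piPhi t) u x
        + (∑ i, (u.shift x i * diffeoLin M a (bg.Pt t) (bg.piPhi t) η i x
          + η.shift x i * diffeoLin M a (bg.Pt t) (bg.piPhi t) u i x))
        + dl x * η.PiN x + ∑ i, pd i dlHat x * η.PiShift x i := by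
  obtain ⟨c, hC⟩ := hasJet_hamiltonianConstraint (M := M) ha hA hu hη x
  choose d hD using fun i => hasJet_diffeoConstraint (M := M) hA hu hη i x
  have hN : HasJet (fun r e => (bg.point t + r • u + e • η).N x) _ _ _ _ :=
    (HasJet.affine _ _ _).congr_fun fun r e => perturbed_N r e x
  have hPN : HasJet (fun r e => (bg.point t + r • u + e • η).PiN x) _ _ _ _ :=
    (HasJet.affine _ _ _).congr_fun fun r e => perturbed_PiN r e x
  have hS : ∀ i, HasJet (fun r e => (bg.point t + r • u + e • η).shift x i) _ _ _ _ := fun i =>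
    (HasJet.affine _ _ _).congr_fun fun r e => perturbed_shift r e x i
  have hPS : ∀ i, HasJet (fun r e => (bg.point t + r • u + e • η).PiShift x i) _ _ _ _ := fun i =>
    (HasJet.affine _ _ _).congr_fun fun r e => perturbed_PiShift r e x i
  have hl : HasJet (fun r _ => deriv bg.N t + r * dl x) _ _ _ _ :=
    (HasJet.affine (deriv bg.N t) (dl x) 0).congr_fun fun r e => by ring
  have hlS : ∀ i, HasJet (fun r _ => r * pd i dlHat x) _ _ _ _ := fun i =>
    (HasJet.affine 0 (pd i dlHat x) 0).congr_fun fun r e => by ring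
  have h := (((hN.mul hC).add (HasJet.sum Finset.univ fun i => (hS i).mul (hD i))).add
      (hl.mul hPN)).add (HasJet.sum Finset.univ fun i => (hlS i).mul (hPS i))
  have h' := h.deriv_deriv
  rw [secondVariation]
  simp only [canonicalDensity, smearedConstraints]
  refine h'.trans ?_
  simp only [zero_mul, zero_add, add_zero, mul_zero]
  have : ∀ i, η.shift x i * diffeoLin M a (bg.Pt t) (bg.piPhi t) u i x +
      u.shift x i * diffeoLin M a (bg.Pt t) (bg.piPhi t) η i x =
      u.shift x i * diffeoLin M a (bg.Pt t) (bg.piPhi t) η i x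
          + η.shift x i * diffeoLin M a (bg.Pt t) (bg.piPhi t) u i x := fun i => by ring
  simp only [this]
  ring

end ConstraintVariations

end

end CosmoPert

namespace CosmoPert

open MeasureTheory

noncomputable section

/-! ### Integration by parts in the variations of the constraints -/

/-- The linearized Einstein tensor at the metric `δ_{ab}`. -/
def einsteinLin (h : Space → Matrix (Fin 3) (Fin 3) ℝ) (i j : Fin 3) (x : Space) : ℝ :=
  (∑ c, (pd c (pd i (fun y => h y j c)) x + pd c (pd j (fun y => h y i c)) x
    - pd c (pd c (fun y => h y i j)) x - pd i (pd j (fun y => h y c c)) x)) / 2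
  - if i = j then curvatureLin h x / 2 else 0

variable {h k : Space → Matrix (Fin 3) (Fin 3) ℝ} {f : Space → ℝ}

@[fun_prop]
lemma contDiff_christoffel (hh : ∀ i j, ContDiff ℝ ∞ fun y => h y i j) (c a b : Fin 3) :
    ContDiff ℝ ∞ (christoffel h c a b) := by
  have : christoffel h c a b = fun x => (pd a (fun y => h y c b) x + pd b (fun y => h y c a) x
    - pd c (fun y => h y a b) x) / 2 := rfl
  rw [this]
  have h1 := contDiff_pd a (hh c b)
  have h2 := contDiff_pd b (hh c a)
  have h3 := contDiff_pd c (hh a b)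
  fun_prop

lemma pd_christoffel (hh : ∀ i j, ContDiff ℝ ∞ fun y => h y i j) (c a b d : Fin 3) (x : Space) :
    pd d (christoffel h c a b) x = (pd d (pd a (fun y => h y c b)) x
      + pd d (pd b (fun y => h y c a)) x - pd d (pd c (fun y => h y a b)) x) / 2 := by
  have : christoffel h c a b = fun x => (1 / 2) * (pd a (fun y => h y c b) x
      + pd b (fun y => h y c a) x - pd c (fun y => h y a b) x) := by
    ext x; rw [christoffel]; ring
  have h1 := contDiff_pd a (hh c b)
  have h2 := contDiff_pd b (hh c a)
  have h3 := contDiff_pd c (hh a b)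
  rw [this, pd_const_mul d _ (by fun_prop), pd_sub d (by fun_prop) (by fun_prop),
    pd_add d (by fun_prop) (by fun_prop)]
  ring

namespace DivEq

lemma mul_christoffel (hf : ContDiff ℝ ∞ f) (hk : ∀ i j, IsTest fun y => k y i j)
    (c a b : Fin 3) :
    DivEq (fun x => f x * christoffel k c a b x)
      (fun x => -(pd a f x * k x c b + pd b f x * k x c a - pd c f x * k x a b) / 2) :=
  (of_eq fun x => by rw [christoffel]; ring).trans
    (((((mul_pd hf a (hk c b)).add (mul_pd hf b (hk c a))).sub (mul_pd hf c (hk a b))).const_mul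
      (1 / 2)).trans (of_eq fun x => by ring))

lemma mul_riemannLin (hf : ContDiff ℝ ∞ f) (hk : ∀ i j, IsTest fun y => k y i j)
    (a b c d : Fin 3) :
    DivEq (fun x => f x * riemannLin k a b c d x)
      (fun x => (pd b (pd c f) x * k x a d + pd a (pd d f) x * k x b c
        - pd a (pd c f) x * k x b d - pd b (pd d f) x * k x a c) / 2) :=
  (of_eq fun x => by rw [riemannLin]; ring).trans
    ((((((mul_pd_pd hf b c (hk a d)).add (mul_pd_pd hf a d (hk b c))).sub
      (mul_pd_pd hf a c (hk b d))).sub (mul_pd_pd hf b d (hk a c))).const_mul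
      (1 / 2)).trans (of_eq fun x => by ring))

lemma mul_curvatureLin (hf : ContDiff ℝ ∞ f) (hk : ∀ i j, IsTest fun y => k y i j) :
    DivEq (fun x => f x * curvatureLin k x)
      (fun x => ∑ a, ∑ b, (pd a (pd b f) x * k x a b - pd a (pd a f) x * k x b b)) := by
  refine (of_eq fun x => ?_).trans (sum Finset.univ fun a => sum Finset.univ fun b =>
    (mul_pd_pd hf a b (hk a b)).sub (mul_pd_pd hf a a (hk b b)))
  simp only [curvatureLin, Finset.mul_sum]
  refine Finset.sum_congr rfl fun a _ => Finset.sum_congr rfl fun b _ => ?_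
  ring

/-- One integration by parts for each Γ·Γ product and two for each h·Riem(k) term; the terms
k·Riem(h) already carry no derivative of k and are kept. -/
lemma curvatureQuad_left (hh : ∀ i j, ContDiff ℝ ∞ fun y => h y i j)
    (hk : ∀ i j, IsTest fun y => k y i j) :
    DivEq (curvatureQuad h k) (fun x =>
      (∑ a, ∑ b, ∑ e,
        (-(pd a (christoffel h e b a) x * k x e b + pd b (christoffel h e b a) x * k x e a
            - pd e (christoffel h e b a) x * k x a b) / 2
        + -(pd b (christoffel h e a b) x * k x e a + pd a (christoffel h e a b) x * k x e b
            - pd e (christoffel h e a b) x * k x b a) / 2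
        - -(pd a (christoffel h e b b) x * k x e a + pd a (christoffel h e b b) x * k x e a
            - pd e (christoffel h e b b) x * k x a a) / 2
        - -(pd b (christoffel h e a a) x * k x e b + pd b (christoffel h e a a) x * k x e b
            - pd e (christoffel h e a a) x * k x b b) / 2))
      - ∑ a, ∑ b, ∑ c,
        ((pd b (pd c (fun y => h y a c)) x * k x a b + pd a (pd b (fun y => h y a c)) x * k x b c
            - pd a (pd c (fun y => h y a c)) x * k x b b
            - pd b (pd b (fun y => h y a c)) x * k x a c) / 2
        + (pd a (pd b (fun y => h y a c)) x * k x b c + pd b (pd c (fun y => h y a c)) x * k x a b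
            - pd b (pd b (fun y => h y a c)) x * k x a c
            - pd a (pd c (fun y => h y a c)) x * k x b b) / 2
        + k x a c * (riemannLin h a b c b x + riemannLin h b a b c x))) := by
  have hΓ := contDiff_christoffel hh
  refine ((DivEq.sum Finset.univ fun a => DivEq.sum Finset.univ fun b => DivEq.sum Finset.univ
    fun e => ?_).sub (DivEq.sum Finset.univ fun a => DivEq.sum Finset.univ fun b =>
      DivEq.sum Finset.univ fun c => ?_))
  · refine ((((mul_christoffel (hΓ e b a) hk e a b).add
      ((of_eq fun x => mul_comm _ _).trans (mul_christoffel (hΓ e a b) hk e b a))).sub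
      (mul_christoffel (hΓ e b b) hk e a a)).sub
      ((of_eq fun x => mul_comm _ _).trans (mul_christoffel (hΓ e a a) hk e b b)))
  · refine DivEq.add ((of_eq fun x => mul_add _ _ _).trans
      ((mul_riemannLin (hh a c) hk a b c b).add (mul_riemannLin (hh a c) hk b a b c))) (refl _)

/-- The second variation of `∫ √q R` is the linearized Einstein tensor. -/
lemma einsteinHilbert {u η : PhasePoint} (hu : IsSmoothVariation u)
    (hη : IsTestVariation η) (a : ℝ) :
    DivEq (einsteinHilbertQuad a u η)
      (fun x => -(1 / a ^ 3) * ∑ i, ∑ j, einsteinLin u.q i j x * η.q x i j) := by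
  have htr : ContDiff ℝ ∞ fun x => (u.q x).trace / 2 := by
    have : ∀ i, ContDiff ℝ ∞ fun x => u.q x i i := fun i => hu.q_smooth i i
    simp only [Matrix.trace, Matrix.diag_apply]
    fun_prop
  have h1 := (((curvatureQuad_left hu.q_smooth hη.q_test).add
    (mul_curvatureLin htr hη.q_test)).add
    (refl fun x => (η.q x).trace / 2 * curvatureLin u.q x)).const_mul (1 / a ^ 3)
  refine (of_eq fun x => ?_).trans (h1.trans (of_eq fun x => ?_))
  · rw [einsteinHilbertQuad]; ring
  have htr2 : ∀ i j, pd i (pd j (fun x => (u.q x).trace / 2)) x =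
      (pd i (pd j (fun y => u.q y 0 0)) x + pd i (pd j (fun y => u.q y 1 1)) x
        + pd i (pd j (fun y => u.q y 2 2)) x) / 2 := by
    intro i j
    have e : (fun x => (u.q x).trace / 2) =
        fun x => (1 / 2) * (u.q x 0 0 + u.q x 1 1 + u.q x 2 2) := by
      ext x; simp [Matrix.trace, Fin.sum_univ_three]; ring
    have s0 := hu.q_smooth 0 0
    have s1 := hu.q_smooth 1 1
    have s2 := hu.q_smooth 2 2
    have d0 := contDiff_pd j s0
    have d1 := contDiff_pd j s1
    have d2 := contDiff_pd j s2
    rw [e, pd_const_mul j _ (by fun_prop), pd_add j (by fun_prop) s2, pd_add j s0 s1,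
      pd_const_mul i _ (by fun_prop), pd_add i (by fun_prop) d2, pd_add i d0 d1]
    ring
  -- From here the test metric appears undifferentiated. Symmetry of both tensors and commutation of
  -- partial derivatives bring every term to a normal form, so the claim becomes polynomial.
  have hk := hη.isSmoothVariation.q_symm
  have hq : ∀ i j, (fun y => u.q y i j) = fun y => u.q y j i :=
    fun i j => funext (hu.q_symm i j)
  have q1 := hq 1 0
  have q2 := hq 2 0
  have q3 := hq 2 1
  have c1 := fun i j => pd_comm 1 0 (hu.q_smooth i j)
  have c2 := fun i j => pd_comm 2 0 (hu.q_smooth i j)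
  have c3 := fun i j => pd_comm 2 1 (hu.q_smooth i j)
  rw [neg_mul, ← mul_neg]
  congr 1
  simp only [htr2]
  simp only [pd_christoffel hu.q_smooth, einsteinLin, riemannLin, curvatureLin,
    Fin.sum_univ_three, Matrix.trace, Matrix.diag_apply, hk 1 0, hk 2 0, hk 2 1, q1, q2, q3,
    c1, c2, c3]
  simp only [Fin.isValue, if_true, zero_ne_one, one_ne_zero, if_false, Fin.reduceEq]
  ring

end DivEq

end

end CosmoPert

namespace CosmoPert

open MeasureTheory

noncomputable section

/-! ### Scalar Hamiltonian vector fields -/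

/-- The phase space variation generated by scalar functions, without background factors. -/
def scalarPoint (S : ScalarPert) : PhasePoint where
  q x := Matrix.of fun a b => (if a = b then S .psi x else 0) + traceless (S .E) a b x
  P x := Matrix.of fun a b => (if a = b then S .pPsi x else 0) + traceless (S .pE) a b x
  N := S .phi
  PiN := S .pPhi
  shift x a := pd a (S .B) x
  PiShift x a := pd a (S .pB) x
  phi := S .dphi
  piPhi := S .dpi

/-- `f - Δg/3`. -/
def subLapThird (f g : Space → ℝ) (x : Space) : ℝ := f x - lap g x / 3

lemma contDiff_subLapThird {f g : Space → ℝ} (hf : ContDiff ℝ ∞ f) (hg : ContDiff ℝ ∞ g) :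
    ContDiff ℝ ∞ (subLapThird f g) :=
  hf.sub ((contDiff_lap hg).div_const 3)

lemma contDiff_traceless {f : Space → ℝ} (hf : ContDiff ℝ ∞ f) (i j : Fin 3) :
    ContDiff ℝ ∞ (traceless f i j) := by
  have h1 : ContDiff ℝ ∞ fun x => if i = j then lap f x / 3 else 0 := by
    split_ifs
    · exact (contDiff_lap hf).div_const 3
    · exact contDiff_const
  exact (contDiff_pd i (contDiff_pd j hf)).sub h1

lemma contDiff_trace_add_traceless {f g : Space → ℝ} (hf : ContDiff ℝ ∞ f) (hg : ContDiff ℝ ∞ g)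
    (i j : Fin 3) : ContDiff ℝ ∞ fun x => (if i = j then f x else 0) + traceless g i j x := by
  have h1 : ContDiff ℝ ∞ fun x => if i = j then f x else 0 := by
    split_ifs
    · exact hf
    · exact contDiff_const
  exact h1.add (contDiff_traceless hg i j)

lemma traceless_symm {f : Space → ℝ} (hf : ContDiff ℝ ∞ f) (i j : Fin 3) (x : Space) :
    traceless f i j x = traceless f j i x := by
  simp only [traceless, pd_comm i j hf, eq_comm (a := i)]

lemma isSmoothVariation_scalarPoint {S : ScalarPert} (hS : ∀ k, ContDiff ℝ ∞ (S k)) :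
    IsSmoothVariation (scalarPoint S) where
  q_smooth a b := contDiff_trace_add_traceless (hS _) (hS _) a b
  q_symm a b x := by
    simp only [scalarPoint, Matrix.of_apply, traceless_symm (hS .E) a b, eq_comm (a := a)]
  P_smooth a b := contDiff_trace_add_traceless (hS _) (hS _) a b
  P_symm a b x := by
    simp only [scalarPoint, Matrix.of_apply, traceless_symm (hS .pE) a b, eq_comm (a := a)]
  N_smooth := hS _
  PiN_smooth := hS _
  shift_smooth a := contDiff_pd a (hS _)
  PiShift_smooth a := contDiff_pd a (hS _)
  phi_smooth := hS _
  piPhi_smooth := hS _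

lemma traceless_add {f g : Space → ℝ} (hf : ContDiff ℝ ∞ f) (hg : ContDiff ℝ ∞ g) (i j : Fin 3)
    (x : Space) :
    traceless (fun x => f x + g x) i j x = traceless f i j x + traceless g i j x := by
  simp only [traceless]
  rw [pd_add j hf hg, pd_add i (by fun_prop) (by fun_prop), lap_add hf hg]
  split_ifs <;> ring

lemma traceless_const_mul {f : Space → ℝ} (c : ℝ) (hf : ContDiff ℝ ∞ f) (i j : Fin 3)
    (x : Space) : traceless (fun x => c * f x) i j x = c * traceless f i j x := by
  simp only [traceless]
  rw [pd_const_mul j c hf, pd_const_mul i c (by fun_prop), lap_const_mul c hf]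
  split_ifs <;> ring

/-! ### Curvature and divergence of tensors built from two scalars -/

section ScalarTensors

variable {f g : Space → ℝ} {h : Space → Matrix (Fin 3) (Fin 3) ℝ}

lemma pd_subLapThird (hf : ContDiff ℝ ∞ f) (hg : ContDiff ℝ ∞ g) (i : Fin 3) (x : Space) :
    pd i (subLapThird f g) x = pd i f x - pd i (lap g) x / 3 := by
  have : subLapThird f g = fun x => f x - (1 / 3) * lap g x := by
    ext; rw [subLapThird]; ring
  have hl := contDiff_lap hg
  rw [this, pd_sub i hf (by fun_prop), pd_const_mul i _ hl]
  ring

/-- Splits the tensor into a conformal part and a Hessian. The Hessian is an infinitesimal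
diffeomorphism of the flat metric, so curvature can only see f - Δg/3, the combination that also
defines the temporal clock. -/
lemma trace_add_traceless_eq (f g : Space → ℝ) (i j : Fin 3) (x : Space) :
    (if i = j then f x else 0) + traceless g i j x =
      (if i = j then 1 else 0) * subLapThird f g x + pd i (pd j g) x := by
  simp only [traceless, subLapThird]
  split_ifs <;> ring

lemma pd_trace_add_traceless (hf : ContDiff ℝ ∞ f) (hg : ContDiff ℝ ∞ g)
    (hh : ∀ x i j, h x i j = (if i = j then f x else 0) + traceless g i j x) (i j c : Fin 3) :
    pd c (fun y => h y i j) = fun x =>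
      (if i = j then 1 else 0) * pd c (subLapThird f g) x + pd c (pd i (pd j g)) x := by
  simp only [hh, trace_add_traceless_eq]
  have h1 := contDiff_subLapThird hf hg
  rw [pd_add c (by fun_prop) (by fun_prop), pd_const_mul c _ h1]

lemma pd_pd_trace_add_traceless (hf : ContDiff ℝ ∞ f) (hg : ContDiff ℝ ∞ g)
    (hh : ∀ x i j, h x i j = (if i = j then f x else 0) + traceless g i j x) (i j c d : Fin 3)
    (x : Space) :
    pd d (pd c (fun y => h y i j)) x =
      (if i = j then 1 else 0) * pd d (pd c (subLapThird f g)) x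
        + pd d (pd c (pd i (pd j g))) x := by
  rw [pd_trace_add_traceless hf hg hh]
  have h1 := contDiff_subLapThird hf hg
  rw [pd_add d (by fun_prop) (by fun_prop), pd_const_mul d _ (by fun_prop)]

lemma trace_scalar (hg : ContDiff ℝ ∞ g)
    (hh : ∀ x i j, h x i j = (if i = j then f x else 0) + traceless g i j x) (x : Space) :
    (h x).trace = 3 * f x := by
  simp only [Matrix.trace, Matrix.diag_apply, hh, Fin.sum_univ_three, traceless, if_true,
    lap_eq hg]
  ring

/-- The Hessian part drops out since fourth derivatives commute; the conformal part gives Δ - 3Δ. -/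
lemma curvatureLin_scalar (hf : ContDiff ℝ ∞ f) (hg : ContDiff ℝ ∞ g)
    (hh : ∀ x i j, h x i j = (if i = j then f x else 0) + traceless g i j x) (x : Space) :
    curvatureLin h x = -2 * lap (subLapThird f g) x := by
  have h1 := contDiff_subLapThird hf hg
  have h4 : ∀ a b, pd a (pd b (pd a (pd b g))) x = pd a (pd a (pd b (pd b g))) x := fun a b => by
    rw [pd_comm b a (by fun_prop)]
  simp only [curvatureLin, pd_pd_trace_add_traceless hf hg hh, h4, lap_eq h1, Fin.sum_univ_three,
    Fin.isValue, if_true, zero_ne_one, one_ne_zero, if_false, Fin.reduceEq]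
  ring

/-- Again only the conformal part survives. The rearrangements `h4` and `h5` sort the fourth
derivatives of g so that they cancel. -/
lemma einsteinLin_scalar (hf : ContDiff ℝ ∞ f) (hg : ContDiff ℝ ∞ g)
    (hh : ∀ x i j, h x i j = (if i = j then f x else 0) + traceless g i j x) (i j : Fin 3)
    (x : Space) :
    einsteinLin h i j x = ((if i = j then lap (subLapThird f g) x else 0)
      - pd i (pd j (subLapThird f g)) x) / 2 := by
  have h1 := contDiff_subLapThird hf hg
  have h4 : ∀ c, pd c (pd i (pd j (pd c g))) x = pd c (pd c (pd i (pd j g))) x := fun c => by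
    rw [pd_comm j c hg, pd_comm i c (by fun_prop)]
  have h5 : ∀ c, pd c (pd j (pd i (pd c g))) x = pd i (pd j (pd c (pd c g))) x := fun c => by
    rw [pd_comm i c hg, pd_comm j c (by fun_prop), pd_comm j i (by fun_prop),
      pd_comm c i (by fun_prop), pd_comm c i (by fun_prop), pd_comm c j (by fun_prop),
      pd_comm c j (by fun_prop)]
  simp only [einsteinLin, curvatureLin_scalar hf hg hh, pd_pd_trace_add_traceless hf hg hh, h4, h5,
    lap_eq h1]
  have c1 := pd_comm 1 0 h1
  have c2 := pd_comm 2 0 h1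
  have c3 := pd_comm 2 1 h1
  fin_cases i <;> fin_cases j <;> simp [Fin.sum_univ_three, c1, c2, c3] <;> ring

lemma divergence_scalar (hf : ContDiff ℝ ∞ f) (hg : ContDiff ℝ ∞ g)
    (hh : ∀ x i j, h x i j = (if i = j then f x else 0) + traceless g i j x) (i : Fin 3)
    (x : Space) :
    divergence h i x = pd i (fun y => f y + 2 / 3 * lap g y) x := by
  have hl := contDiff_lap hg
  have e : pd i (lap g) x = ∑ b, pd b (pd b (pd i g)) x := by
    rw [pd_lap i hg, lap_eq (by fun_prop)]
  rw [pd_add i hf (by fun_prop), pd_const_mul i _ hl]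
  simp only [divergence, pd_trace_add_traceless hf hg hh, Finset.sum_add_distrib, ← e]
  simp [pd_subLapThird hf hg]
  ring

lemma sum_christoffel_scalar (hf : ContDiff ℝ ∞ f) (hg : ContDiff ℝ ∞ g)
    (hh : ∀ x i j, h x i j = (if i = j then f x else 0) + traceless g i j x) (i : Fin 3)
    (x : Space) :
    ∑ b, christoffel h i b b x = pd i (fun y => 2 / 3 * lap g y - 1 / 2 * f y) x := by
  have hl := contDiff_lap hg
  have e : ∀ i, pd i (lap g) x = ∑ b, pd b (pd b (pd i g)) x := fun i => by
    rw [pd_lap i hg, lap_eq (by fun_prop)]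
  have e' : ∀ b, pd b (pd i (pd b g)) x = pd b (pd b (pd i g)) x := fun b => by
    rw [pd_comm i b hg]
  have e2 : ∀ b, pd i (pd b (pd b g)) x = pd b (pd b (pd i g)) x := fun b => by
    rw [pd_comm i b (by fun_prop), pd_comm i b hg]
  rw [pd_sub i (by fun_prop) (by fun_prop), pd_const_mul i _ hl, pd_const_mul i _ hf]
  simp only [christoffel, pd_trace_add_traceless hf hg hh, e', e2, pd_subLapThird hf hg, e]
  fin_cases i <;> simp [Fin.sum_univ_three] <;> ring

end ScalarTensors

/-- The linearized Hamiltonian constraint in terms of the scalar functions of `scalarPoint`. -/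
def hamiltonianScalar (M : Model) (a P f π : ℝ) (S : ScalarPert) (x : Space) : ℝ :=
  -(3 * P ^ 2 / (4 * a) * S .psi x) - 3 * a * P * S .pPsi x
    + 2 / a * lap (subLapThird (S .psi) (S .E)) x
    + M.kappa * (M.lam * π / a ^ 3 * S .dpi x - 3 * M.lam * π ^ 2 / (4 * a ^ 5) * S .psi x
      + 3 * a * M.V f / (4 * M.lam) * S .psi x + a ^ 3 * deriv M.V f / (2 * M.lam) * S .dphi x)

/-- The potential of the linearized diffeomorphism constraint. -/
def diffeoScalar (M : Model) (a P π : ℝ) (S : ScalarPert) (x : Space) : ℝ :=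
  -2 * a ^ 2 * (S .pPsi x + 2 / 3 * lap (S .pE) x)
    - 2 * P * (2 / 3 * lap (S .E) x - 1 / 2 * S .psi x) + M.kappa * π * S .dphi x

section Constraints

variable {M : Model} {a P f π : ℝ} {S : ScalarPert}

lemma hamiltonianLin_scalarPoint (hS : ∀ k, ContDiff ℝ ∞ (S k)) (x : Space) :
    hamiltonianLin M a P f π (scalarPoint S) x = hamiltonianScalar M a P f π S x := by
  have h1 : ((scalarPoint S).q x).trace = 3 * S .psi x := trace_scalar (hS .E) (fun _ _ _ => rfl) x
  have h2 : ((scalarPoint S).P x).trace = 3 * S .pPsi x :=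
    trace_scalar (hS .pE) (fun _ _ _ => rfl) x
  have h3 := curvatureLin_scalar (h := (scalarPoint S).q) (hS .psi) (hS .E) (fun _ _ _ => rfl) x
  rw [hamiltonianLin, hamiltonianScalar, h1, h2, h3]
  simp only [scalarPoint]
  ring

/-- On scalar perturbations the vector constraint is a pure gradient, so for decaying fields it is
equivalent to the vanishing of one potential. -/
lemma diffeoLin_scalarPoint (hS : ∀ k, ContDiff ℝ ∞ (S k)) (i : Fin 3) (x : Space) :
    diffeoLin M a P π (scalarPoint S) i x = pd i (diffeoScalar M a P π S) x := by
  have h1 := divergence_scalar (h := (scalarPoint S).P) (hS .pPsi) (hS .pE) (fun _ _ _ => rfl) i x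
  have h2 := sum_christoffel_scalar (h := (scalarPoint S).q) (hS .psi) (hS .E)
    (fun _ _ _ => rfl) i x
  have s1 := contDiff_lap (hS .E)
  have s2 := contDiff_lap (hS .pE)
  have s3 := hS .psi
  have s4 := hS .pPsi
  have s5 := hS .dphi
  have e : pd i (diffeoScalar M a P π S) x = -2 * a ^ 2 * pd i (fun y => S .pPsi y
      + 2 / 3 * lap (S .pE) y) x - 2 * P * pd i (fun y => 2 / 3 * lap (S .E) y - 1 / 2 * S .psi y) x
      + M.kappa * π * pd i (S .dphi) x := by
    have : diffeoScalar M a P π S = fun x => -2 * a ^ 2 * (S .pPsi x + 2 / 3 * lap (S .pE) x)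
      - 2 * P * (2 / 3 * lap (S .E) x - 1 / 2 * S .psi x) + M.kappa * π * S .dphi x := rfl
    rw [this, pd_add i (by fun_prop) (by fun_prop), pd_sub i (by fun_prop) (by fun_prop),
      pd_const_mul i _ (by fun_prop), pd_const_mul i _ (by fun_prop), pd_const_mul i _ s5]
  rw [diffeoLin, h1, h2, e]
  rfl

end Constraints

end

end CosmoPert

/-! ### The Hamiltonian vector field of the quadratic Hamiltonian on scalar perturbations -/

namespace CosmoPert

open MeasureTheory

noncomputable section

/-- The bilinear density of the second variation of the smeared constraints at a homogeneous point
with lapse `N` and vanishing shift. -/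
def variationDensity (M : Model) (N a P f π : ℝ) (u : PhasePoint) (dl dlHat : Space → ℝ)
    (η : PhasePoint) (x : Space) : ℝ :=
  N * hamiltonianQuad M a P f π u η x + u.N x * hamiltonianLin M a P f π η x
    + η.N x * hamiltonianLin M a P f π u x
    + (∑ i, (u.shift x i * diffeoLin M a P π η i x + η.shift x i * diffeoLin M a P π u i x))
    + dl x * η.PiN x + ∑ i, pd i dlHat x * η.PiShift x i

/-- The scalar functions of the Hamiltonian vector field of `variationDensity`. -/
def hamVec (M : Model) (N a P f π : ℝ) (S : ScalarPert) (dl dlHat : Space → ℝ) : ScalarPert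
  | .psi => fun x => -(N * (P / (2 * a) * S .psi x + a * S .pPsi x)) - a * P * S .phi x
      + 2 / 3 * a ^ 2 * lap (S .B) x
  | .E => fun x => N * (P / a * S .E x + 2 * a * S .pE x) + 2 * a ^ 2 * S .B x
  | .pPsi => fun x => -(N * (1 / 8 * (P ^ 2 / a ^ 3) * S .psi x - P / (2 * a) * S .pPsi x
        + M.kappa * (5 / 8 * (M.lam * π ^ 2 / a ^ 7) * S .psi x
          + M.V f / (8 * M.lam * a) * S .psi x - M.lam * π / (2 * a ^ 5) * S .dpi x
          + a * deriv M.V f / (4 * M.lam) * S .dphi x)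
        + 1 / 3 * (1 / a ^ 3) * lap (subLapThird (S .psi) (S .E)) x)
      + (-(P ^ 2 / (4 * a)) + M.kappa * (-(M.lam * π ^ 2 / (4 * a ^ 5))
          + a * M.V f / (4 * M.lam))) * S .phi x
      + 2 / 3 * (1 / a) * lap (S .phi) x - P / 3 * lap (S .B) x)
  | .pE => fun x => -(N * (5 / 4 * (P ^ 2 / a ^ 3) * S .E x + P / a * S .pE x
        + M.kappa * (1 / 4 * (M.lam * π ^ 2 / a ^ 7) - M.V f / (4 * M.lam * a)) * S .E x
        - 1 / 2 * (1 / a ^ 3) * subLapThird (S .psi) (S .E) x)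
      - 1 / a * S .phi x + 2 * P * S .B x)
  | .phi => dl
  | .pPhi => fun x => -hamiltonianScalar M a P f π S x
  | .B => dlHat
  | .pB => fun x => -diffeoScalar M a P π S x
  | .dphi => fun x => N * (M.lam / a ^ 3 * S .dpi x - 3 * (M.lam * π / (2 * a ^ 5)) * S .psi x)
      + M.lam * π / a ^ 3 * S .phi x
  | .dpi => fun x => -(N * (a ^ 3 * deriv (deriv M.V) f / (2 * M.lam) * S .dphi x
        + 3 * (a * deriv M.V f / (4 * M.lam)) * S .psi x - a / M.lam * lap (S .dphi) x)
      + a ^ 3 * deriv M.V f / (2 * M.lam) * S .phi x) + π * lap (S .B) x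

variable {M : Model} {N a P f π : ℝ} {S : ScalarPert} {dl dlHat : Space → ℝ} {η : PhasePoint}

/-- The curvature is the only term of the linearized Hamiltonian constraint that differentiates the
variation. Adding `curvatureLin η.q x / a` removes it from the untouched part, and its integrated
form is subtracted separately. -/
lemma DivEq.mul_hamiltonianLin {g : Space → ℝ} (hg : ContDiff ℝ ∞ g) (hη : IsTestVariation η) :
    DivEq (fun x => g x * hamiltonianLin M a P f π η x) (fun x =>
      g x * (hamiltonianLin M a P f π η x + curvatureLin η.q x / a)
        - (1 / a) * ∑ i, ∑ j, (pd i (pd j g) x * η.q x i j - pd i (pd i g) x * η.q x j j)) :=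
  (DivEq.of_eq fun x => by ring).trans
    ((DivEq.refl fun x => g x * (hamiltonianLin M a P f π η x + curvatureLin η.q x / a)).sub
      ((DivEq.mul_curvatureLin hg hη.q_test).const_mul (1 / a)))

lemma DivEq.sum_mul_diffeoLin {g : Space → ℝ} (hg : ContDiff ℝ ∞ g) (hη : IsTestVariation η) :
    DivEq (fun x => ∑ i, pd i g x * diffeoLin M a P π η i x) (fun x => ∑ i,
      (-2 * a ^ 2 * (∑ b, -pd b (pd i g) x * η.P x b i)
        - 2 * P * (∑ b, -(pd b (pd i g) x * η.q x i b + pd b (pd i g) x * η.q x i b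
          - pd i (pd i g) x * η.q x b b) / 2)
        + M.kappa * π * (-pd i (pd i g) x * η.phi x))) := by
  refine DivEq.sum Finset.univ fun i => ?_
  have hgi := contDiff_pd i hg
  refine (DivEq.of_eq fun x => ?_).trans
    ((((DivEq.sum Finset.univ fun b => DivEq.mul_pd hgi b (hη.P_test b i)).const_mul
      (-2 * a ^ 2)).sub ((DivEq.sum Finset.univ fun b =>
        DivEq.mul_christoffel hgi hη.q_test i b b).const_mul (2 * P))).add
      ((DivEq.mul_pd hgi i hη.phi_test).const_mul (M.kappa * π)))
  simp only [diffeoLin, divergence, ← Finset.mul_sum]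
  ring

lemma DivEq.mul_hamiltonianQuad (hS : ∀ k, ContDiff ℝ ∞ (S k)) (hη : IsTestVariation η) :
    DivEq (fun x => N * hamiltonianQuad M a P f π (scalarPoint S) η x) (fun x =>
      N * (hamiltonianQuadLocal M a P f π (scalarPoint S) η x
        + 1 / a ^ 3 * (∑ i, ∑ j, ((if i = j then lap (subLapThird (S .psi) (S .E)) x else 0)
      - pd i (pd j (subLapThird (S .psi) (S .E))) x) / 2 * η.q x i j)
        + M.kappa * (a / M.lam) * ∑ i, -pd i (pd i (S .dphi)) x * η.phi x)) := by
  refine DivEq.const_mul N ((DivEq.refl _).sub (DivEq.einsteinHilbert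
    (isSmoothVariation_scalarPoint hS) hη a) |>.add ((DivEq.sum Finset.univ fun i =>
      DivEq.mul_pd (contDiff_pd i (hS .dphi)) i hη.phi_test).const_mul
        (M.kappa * (a / M.lam))) |>.trans (DivEq.of_eq fun x => ?_))
  simp only [einsteinLin_scalar (h := (scalarPoint S).q) (hS .psi) (hS .E) (fun _ _ _ => rfl)]
  ring

lemma contDiff_diffeoScalar (hS : ∀ k, ContDiff ℝ ∞ (S k)) :
    ContDiff ℝ ∞ (diffeoScalar M a P π S) := by
  have h1 := hS .pPsi
  have h2 := contDiff_lap (hS .pE)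
  have h3 := contDiff_lap (hS .E)
  have h4 := hS .psi
  have h5 := hS .dphi
  have e : diffeoScalar M a P π S = fun x => -2 * a ^ 2 * (S .pPsi x + 2 / 3 * lap (S .pE) x)
    - 2 * P * (2 / 3 * lap (S .E) x - 1 / 2 * S .psi x) + M.kappa * π * S .dphi x := rfl
  rw [e]
  fun_prop

-- The core computation: the quadratic Hamiltonian maps scalar perturbations to scalar ones. After
-- integration by parts the density is linear in the components of η, and matching their
-- coefficients with the symplectic density yields the entries of `hamVec`. The lapse N is free, so
-- N = 0 also covers the constraints themselves.
set_option maxHeartbeats 1000000 in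
set_option maxRecDepth 4000 in
lemma DivEq.variationDensity (hS : ∀ k, ContDiff ℝ ∞ (S k)) (hη : IsTestVariation η) :
    DivEq (variationDensity M N a P f π (scalarPoint S) dl dlHat η)
      (symplecticDensity M (scalarPoint (hamVec M N a P f π S dl dlHat)) η) := by
  have h1 := DivEq.mul_hamiltonianQuad (M := M) (N := N) (a := a) (P := P) (f := f) (π := π) hS hη
  have h2 := DivEq.mul_hamiltonianLin (M := M) (a := a) (P := P) (f := f) (π := π) (hS .phi) hη
  have h3 := DivEq.sum_mul_diffeoLin (M := M) (a := a) (P := P) (π := π) (hS .B) hη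
  have h := ((h1.add h2).add h3).add (DivEq.refl fun x =>
    η.N x * hamiltonianLin M a P f π (scalarPoint S) x
    + (∑ i, η.shift x i * diffeoLin M a P π (scalarPoint S) i x)
    + dl x * η.PiN x + ∑ i, pd i dlHat x * η.PiShift x i)
  refine (DivEq.of_eq fun x => ?_).trans (h.trans (DivEq.of_eq fun x => ?_))
  · simp only [CosmoPert.variationDensity, Finset.sum_add_distrib]
    simp only [scalarPoint]
    ring
  have hZ := contDiff_subLapThird (hS .psi) (hS .E)
  have hk := hη.isSmoothVariation.q_symm
  have hr := hη.isSmoothVariation.P_symm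
  have hCa : ∀ i, pd i (hamVec M N a P f π S dl dlHat .pB) x
      = -diffeoLin M a P π (scalarPoint S) i x := fun i => by
    have e : hamVec M N a P f π S dl dlHat .pB = fun x => (-1) * diffeoScalar M a P π S x := by
      ext y; simp only [hamVec]; ring
    rw [e, pd_const_mul i _ (contDiff_diffeoScalar hS), diffeoLin_scalarPoint hS]
    ring
  -- The trace-free Hessian is linear, so the tensors generated by the entries E and p_E of `hamVec`
  -- expand into those generated by the fields of S; these are matched with the coefficients of η.P
  -- and η.q.
  have hE : ∀ i j, traceless (hamVec M N a P f π S dl dlHat .E) i j x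
      = N * (P / a * traceless (S .E) i j x + 2 * a * traceless (S .pE) i j x)
        + 2 * a ^ 2 * traceless (S .B) i j x := fun i j => by
    have h1 := hS .E
    have h2 := hS .pE
    have h3 := hS .B
    simp only [hamVec]
    rw [traceless_add (by fun_prop) (by fun_prop), traceless_const_mul _ (by fun_prop),
      traceless_add (by fun_prop) (by fun_prop), traceless_const_mul _ (by fun_prop),
      traceless_const_mul _ (by fun_prop), traceless_const_mul _ (by fun_prop)]
  have hpE : ∀ i j, traceless (hamVec M N a P f π S dl dlHat .pE) i j x
      = -(N * (5 / 4 * (P ^ 2 / a ^ 3) * traceless (S .E) i j x + P / a * traceless (S .pE) i j x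
        + M.kappa * (1 / 4 * (M.lam * π ^ 2 / a ^ 7) - M.V f / (4 * M.lam * a))
          * traceless (S .E) i j x
        - 1 / 2 * (1 / a ^ 3) * traceless (subLapThird (S .psi) (S .E)) i j x)
      - 1 / a * traceless (S .phi) i j x + 2 * P * traceless (S .B) i j x) := fun i j => by
    have h1 := hS .E
    have h2 := hS .pE
    have h3 := hS .B
    have h4 := hS .phi
    have e : hamVec M N a P f π S dl dlHat .pE = fun x =>
        -(N * (5 / 4 * (P ^ 2 / a ^ 3) + M.kappa * (1 / 4 * (M.lam * π ^ 2 / a ^ 7)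
          - M.V f / (4 * M.lam * a)))) * S .E x + -(N * (P / a)) * S .pE x
        + N * (1 / 2 * (1 / a ^ 3)) * subLapThird (S .psi) (S .E) x + 1 / a * S .phi x
        + -(2 * P) * S .B x := by
      ext y; simp only [hamVec]; ring
    rw [e, traceless_add (by fun_prop) (by fun_prop), traceless_add (by fun_prop) (by fun_prop),
      traceless_add (by fun_prop) (by fun_prop), traceless_add (by fun_prop) (by fun_prop),
      traceless_const_mul _ h1, traceless_const_mul _ h2, traceless_const_mul _ hZ,
      traceless_const_mul _ h4, traceless_const_mul _ h3]
    ring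
  have hB : ∀ i j, traceless (S .B) i j x =
    pd i (pd j (S .B)) x - if i = j then lap (S .B) x / 3 else 0 := fun _ _ => rfl
  have hphi : ∀ i j, traceless (S .phi) i j x =
    pd i (pd j (S .phi)) x - if i = j then lap (S .phi) x / 3 else 0 := fun _ _ => rfl
  have hTZ : ∀ i j, traceless (subLapThird (S .psi) (S .E)) i j x =
    pd i (pd j (subLapThird (S .psi) (S .E))) x
      - if i = j then lap (subLapThird (S .psi) (S .E)) x / 3 else 0 := fun _ _ => rfl
  have hC : ∀ f, ContDiff ℝ ∞ f → pd 1 (pd 0 f) = pd 0 (pd 1 f) ∧ pd 2 (pd 0 f) = pd 0 (pd 2 f)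
      ∧ pd 2 (pd 1 f) = pd 1 (pd 2 f) := fun f hf => ⟨pd_comm 1 0 hf, pd_comm 2 0 hf, pd_comm 2 1 hf⟩
  have t1 : ((scalarPoint S).q x).trace = 3 * S .psi x :=
    trace_scalar (hS .E) (fun _ _ _ => rfl) x
  have t2 : ((scalarPoint S).P x).trace = 3 * S .pPsi x :=
    trace_scalar (hS .pE) (fun _ _ _ => rfl) x
  have hq : ∀ i j, (scalarPoint S).q x i j
    = (if i = j then S .psi x else 0) + traceless (S .E) i j x := fun _ _ => rfl
  have hP : ∀ i j, (scalarPoint S).P x i j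
    = (if i = j then S .pPsi x else 0) + traceless (S .pE) i j x := fun _ _ => rfl
  have hf : (scalarPoint S).phi x = S .dphi x := rfl
  have hπ : (scalarPoint S).piPhi x = S .dpi x := rfl
  have hs : ∀ X : ScalarPert, symplecticDensity M (scalarPoint X) η x =
      (∑ i, ∑ j, (((if i = j then X .psi x else 0) + traceless (X .E) i j x) * η.P x i j
        - ((if i = j then X .pPsi x else 0) + traceless (X .pE) i j x) * η.q x i j))
      + (X .phi x * η.PiN x - X .pPhi x * η.N x)
      + (∑ i, (pd i (X .B) x * η.PiShift x i - pd i (X .pB) x * η.shift x i))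
      + M.kappa * (X .dphi x * η.piPhi x - X .dpi x * η.phi x) := fun _ => rfl
  -- Everything is reduced to the independent components of η and to index-sorted derivatives of the
  -- scalars, where both densities are the same polynomial.
  rw [hs, hamiltonianLin_scalarPoint hS]
  simp only [hE, hpE, hCa, hB, hphi, hTZ]
  simp only [hamVec, hamiltonianQuadLocal, hamiltonianLin, invVolumeQuad, volumeQuad, t1, t2]
  simp only [hf, hπ,
    Matrix.trace, Matrix.diag_apply, Matrix.mul_apply, hq, hP, Fin.sum_univ_three, hk 1 0, hk 2 0,
    hk 2 1, hr 1 0, hr 2 0, hr 2 1, traceless_symm (hS .E) 1 0, traceless_symm (hS .E) 2 0,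
    traceless_symm (hS .E) 2 1, traceless_symm (hS .pE) 1 0, traceless_symm (hS .pE) 2 0,
    traceless_symm (hS .pE) 2 1, lap_eq hZ, lap_eq (hS .B), lap_eq (hS .phi), lap_eq (hS .dphi),
    hC _ hZ, hC _ (hS .B), hC _ (hS .phi), Fin.isValue, if_true, zero_ne_one, one_ne_zero, if_false,
    Fin.reduceEq]
  ring

end

end CosmoPert

namespace CosmoPert

open MeasureTheory Filter Topology

noncomputable section

/-! ### Nondegeneracy of the symplectic pairing on scalar variations -/

lemma isTest_symplecticDensity (M : Model) {u η : PhasePoint} (hu : IsSmoothVariation u)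
    (hη : IsTestVariation η) : IsTest (symplecticDensity M u η) := by
  refine IsTest.add (IsTest.add (IsTest.add ?_ ?_) ?_) ?_
  · exact IsTest.sum _ fun i => IsTest.sum _ fun j =>
      ((hη.P_test i j).mul_left (hu.q_smooth i j)).sub ((hη.q_test i j).mul_left (hu.P_smooth i j))
  · exact (hη.PiN_test.mul_left hu.N_smooth).sub (hη.N_test.mul_left hu.PiN_smooth)
  · exact IsTest.sum _ fun i => ((hη.PiShift_test i).mul_left (hu.shift_smooth i)).sub
      ((hη.shift_test i).mul_left (hu.PiShift_smooth i))
  · exact ((hη.piPhi_test.mul_left hu.phi_smooth).sub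
      (hη.phi_test.mul_left hu.piPhi_smooth)).mul_left contDiff_const

/-- The vanishing phase space variation. -/
def zeroPoint : PhasePoint := ⟨0, 0, 0, 0, 0, 0, 0, 0⟩

lemma isTestVariation_zeroPoint : IsTestVariation zeroPoint := by
  constructor <;> first
    | exact fun _ _ => IsTest.zero
    | exact fun _ => IsTest.zero
    | exact IsTest.zero
    | exact fun _ => Matrix.isSymm_zero

/-- The symmetric matrix valued function with entries `g` at `(i, j)` and `(j, i)`. -/
def symmEntry (i j : Fin 3) (g : Space → ℝ) (x : Space) : Matrix (Fin 3) (Fin 3) ℝ :=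
  Matrix.of fun a b => (if a = i ∧ b = j then g x else 0) + if a = j ∧ b = i then g x else 0

lemma isTest_symmEntry (i j : Fin 3) {g : Space → ℝ} (hg : IsTest g) (a b : Fin 3) :
    IsTest fun x => symmEntry i j g x a b := by
  have h : ∀ p : Prop, ∀ [Decidable p], IsTest fun x => if p then g x else 0 := by
    intro p _
    split_ifs
    exacts [hg, IsTest.zero]
  exact (h _).add (h _)

lemma isSymm_symmEntry (i j : Fin 3) (g : Space → ℝ) (x : Space) : (symmEntry i j g x).IsSymm := by
  ext a b
  simp only [symmEntry, Matrix.transpose_apply, Matrix.of_apply]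
  rw [add_comm]
  simp only [and_comm]

lemma sum_mul_symmEntry (i j : Fin 3) (g : Space → ℝ) (x : Space) (w : Fin 3 → Fin 3 → ℝ) :
    ∑ a, ∑ b, w a b * symmEntry i j g x a b = (w i j + w j i) * g x := by
  simp only [symmEntry, Matrix.of_apply, mul_add, Finset.sum_add_distrib, mul_ite, mul_zero, ite_and,
    Finset.sum_ite_eq', Finset.mem_univ, if_true, Finset.sum_ite_irrel, Finset.sum_const_zero]
  ring

lemma integral_sum_mul_symmEntry (i j : Fin 3) (g : Space → ℝ)
    {w : Space → Matrix (Fin 3) (Fin 3) ℝ} (hw : ∀ a b x, w x a b = w x b a) :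
    ∫ x, ∑ a, ∑ b, w x a b * symmEntry i j g x a b = 2 * ∫ x, w x i j * g x := by
  rw [← integral_const_mul]
  refine integral_congr_ae (Eventually.of_forall fun x => ?_)
  have := sum_mul_symmEntry i j g x fun a b => w x a b
  simp only [hw j i] at this
  simp only [this]
  ring

section Pairing

variable {M : Model} {u v : PhasePoint}

lemma eq_of_integral_mul_eq {f g : Space → ℝ} (hf : Continuous f) (hg : Continuous g)
    (h : ∀ k, IsTest k → ∫ x, f x * k x = ∫ x, g x * k x) (x : Space) : f x = g x := by
  refine sub_eq_zero.1 (eq_zero_of_forall_integral_mul_test (f := fun x => f x - g x) (hf.sub hg)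
    (fun k hk => ?_) x)
  have h1 : ∀ {f : Space → ℝ}, Continuous f → Integrable fun x => f x * k x := fun hf =>
    (hf.mul hk.1.continuous).integrable_of_hasCompactSupport hk.2.mul_left
  simp only [sub_mul]
  rw [integral_sub (h1 hf) (h1 hg), h k hk, sub_self]

/-- Each field is isolated by a test variation of its canonical partner alone. For the symmetric
tensors the test matrix is symmetrized, which produces a harmless factor 2 on both sides; for the
scalar field the factor κ > 0 is divided out. -/
lemma symplecticDensity_injective (hu : IsSmoothVariation u) (hv : IsSmoothVariation v)
    (h : ∀ η, IsTestVariation η →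
      ∫ x, symplecticDensity M u η x = ∫ x, symplecticDensity M v η x) : u = v := by
  have hκ := M.kappa_pos.ne'
  refine PhasePoint.ext_fields ?_ ?_ ?_ ?_ ?_ ?_ ?_ ?_
  · ext x i j
    refine eq_of_integral_mul_eq (f := fun x => u.q x i j) (g := fun x => v.q x i j)
      (hu.q_smooth i j).continuous (hv.q_smooth i j).continuous (fun k hk => ?_) x
    have := h { zeroPoint with P := symmEntry i j k }
      { isTestVariation_zeroPoint with
        P_test := isTest_symmEntry i j hk, P_symm := isSymm_symmEntry i j k }
    simp only [symplecticDensity, zeroPoint, Pi.zero_apply, Matrix.zero_apply, mul_zero, sub_zero,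
      Finset.sum_const_zero, add_zero] at this
    rw [integral_sum_mul_symmEntry i j k hu.q_symm, integral_sum_mul_symmEntry i j k hv.q_symm]
      at this
    linarith
  · ext x i j
    refine eq_of_integral_mul_eq (f := fun x => u.P x i j) (g := fun x => v.P x i j)
      (hu.P_smooth i j).continuous (hv.P_smooth i j).continuous (fun k hk => ?_) x
    have := h { zeroPoint with q := symmEntry i j k }
      { isTestVariation_zeroPoint with
        q_test := isTest_symmEntry i j hk, q_symm := isSymm_symmEntry i j k }
    simp only [symplecticDensity, zeroPoint, Pi.zero_apply, Matrix.zero_apply, mul_zero, zero_sub,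
      Finset.sum_neg_distrib, sub_zero,
      Finset.sum_const_zero, add_zero, integral_neg] at this
    rw [integral_sum_mul_symmEntry i j k hu.P_symm, integral_sum_mul_symmEntry i j k hv.P_symm]
      at this
    linarith
  · ext x
    refine eq_of_integral_mul_eq hu.N_smooth.continuous hv.N_smooth.continuous (fun k hk => ?_) x
    simpa [symplecticDensity, zeroPoint] using h { zeroPoint with PiN := k }
      { isTestVariation_zeroPoint with PiN_test := hk }
  · ext x
    refine eq_of_integral_mul_eq hu.PiN_smooth.continuous hv.PiN_smooth.continuous
      (fun k hk => ?_) x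
    simpa [symplecticDensity, zeroPoint, integral_neg] using h { zeroPoint with N := k }
      { isTestVariation_zeroPoint with N_test := hk }
  · ext x i
    refine eq_of_integral_mul_eq (f := fun x => u.shift x i) (g := fun x => v.shift x i)
      (hu.shift_smooth i).continuous (hv.shift_smooth i).continuous (fun k hk => ?_) x
    have := h { zeroPoint with PiShift := fun x j => if j = i then k x else 0 }
      { isTestVariation_zeroPoint with
        PiShift_test := fun j => by
          dsimp only
          split_ifs
          exacts [hk, IsTest.zero] }
    simpa [symplecticDensity, zeroPoint] using this
  · ext x i
    refine eq_of_integral_mul_eq (f := fun x => u.PiShift x i) (g := fun x => v.PiShift x i)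
      (hu.PiShift_smooth i).continuous (hv.PiShift_smooth i).continuous (fun k hk => ?_) x
    have := h { zeroPoint with shift := fun x j => if j = i then k x else 0 }
      { isTestVariation_zeroPoint with
        shift_test := fun j => by
          dsimp only
          split_ifs
          exacts [hk, IsTest.zero] }
    simpa [symplecticDensity, zeroPoint, integral_neg] using this
  · ext x
    refine eq_of_integral_mul_eq hu.phi_smooth.continuous hv.phi_smooth.continuous
      (fun k hk => ?_) x
    have := h { zeroPoint with piPhi := k } { isTestVariation_zeroPoint with piPhi_test := hk }
    simpa [symplecticDensity, zeroPoint, integral_const_mul, hκ] using this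
  · ext x
    refine eq_of_integral_mul_eq hu.piPhi_smooth.continuous hv.piPhi_smooth.continuous
      (fun k hk => ?_) x
    have := h { zeroPoint with phi := k } { isTestVariation_zeroPoint with phi_test := hk }
    simpa [symplecticDensity, zeroPoint, integral_neg, integral_const_mul, hκ] using this

/-- Uniqueness of the scalar decomposition: decay removes the kernel of the trace-free Hessian and
of the gradient. -/
lemma scalarPoint_injective {X Y : ScalarPert} (hX : X.IsDecaying) (hY : Y.IsDecaying)
    (h : scalarPoint X = scalarPoint Y) : X = Y := by
  have key : ∀ f g f' g' : Space → ℝ, Decaying f → Decaying g → Decaying f' → Decaying g' →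
      (∀ a b x, (if a = b then f x else 0) + traceless g a b x =
        (if a = b then f' x else 0) + traceless g' a b x) → f = f' ∧ g = g' := by
    intro f g f' g' hf hg hf' hg' he
    have h1 := eq_zero_of_trace_add_traceless (X := fun x => f x + (-1) * f' x)
      (Y := fun x => g x + (-1) * g' x) (hg.add (hg'.const_mul (-1))) fun a b x => by
        have hm := hg'.1
        rw [traceless_add hg.1 (by fun_prop), traceless_const_mul _ hg'.1]
        have := he a b x
        split_ifs at this ⊢ <;> linarith
    exact ⟨funext fun x => by linarith [h1.1 x], funext fun x => by linarith [h1.2 x]⟩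
  have key2 : ∀ f g : Space → ℝ, Decaying f → Decaying g → (∀ a x, pd a f x = pd a g x) →
      f = g := by
    intro f g hf hg he
    ext x
    refine sub_eq_zero.1 ((hf.sub hg).eq_zero_of_pd_eq_zero (fun a x => ?_) x)
    simp only [pd_sub a hf.1 hg.1, he, sub_self]
  have hq := key _ _ _ _ (hX .psi) (hX .E) (hY .psi) (hY .E) fun a b x =>
    congrFun (congrFun (congrFun (congrArg PhasePoint.q h) x) a) b
  have hP := key _ _ _ _ (hX .pPsi) (hX .pE) (hY .pPsi) (hY .pE) fun a b x =>
    congrFun (congrFun (congrFun (congrArg PhasePoint.P h) x) a) b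
  have hs := key2 _ _ (hX .B) (hY .B) fun a x =>
    congrFun (congrFun (congrArg PhasePoint.shift h) x) a
  have hPs := key2 _ _ (hX .pB) (hY .pB) fun a x =>
    congrFun (congrFun (congrArg PhasePoint.PiShift h) x) a
  funext k
  cases k
  exacts [hq.1, hP.1, hq.2, hP.2, congrArg PhasePoint.N h, congrArg PhasePoint.PiN h, hs, hPs,
    congrArg PhasePoint.phi h, congrArg PhasePoint.piPhi h]

/-- The bridge from weak equations, tested against all variations (not just scalar ones), to
pointwise equations for the ten scalar functions. -/
lemma symplecticDensity_scalarPoint_iff {X Y : ScalarPert} (hX : X.IsDecaying)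
    (hY : Y.IsDecaying) :
    (∀ η, IsTestVariation η → ∫ x, symplecticDensity M (scalarPoint X) η x =
      ∫ x, symplecticDensity M (scalarPoint Y) η x) ↔ X = Y :=
  ⟨fun h => scalarPoint_injective hX hY (symplecticDensity_injective
    (isSmoothVariation_scalarPoint fun k => (hX k).1)
    (isSmoothVariation_scalarPoint fun k => (hY k).1) h), fun h _ _ => by rw [h]⟩

end Pairing

lemma Decaying.subLapThird {f g : Space → ℝ} (hf : Decaying f) (hg : Decaying g) :
    Decaying (subLapThird f g) := hf.sub (hg.lap.div_const 3)

section HamVec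

variable {M : Model} {N a P f π : ℝ} {S : ScalarPert} {dl dlHat : Space → ℝ}

lemma decaying_hamiltonianScalar (hS : S.IsDecaying) :
    Decaying (hamiltonianScalar M a P f π S) :=
  ((((hS .psi).const_mul _).neg.sub ((hS .pPsi).const_mul _)).add
    (((hS .psi).subLapThird (hS .E)).lap.const_mul _)).add
    ((((((hS .dpi).const_mul _).sub ((hS .psi).const_mul _)).add ((hS .psi).const_mul _)).add
      ((hS .dphi).const_mul _)).const_mul _)

lemma decaying_diffeoScalar (hS : S.IsDecaying) : Decaying (diffeoScalar M a P π S) :=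
  ((((hS .pPsi).add ((hS .pE).lap.const_mul _)).const_mul _).sub
    ((((hS .E).lap.const_mul _).sub ((hS .psi).const_mul _)).const_mul _)).add
    ((hS .dphi).const_mul _)

lemma isDecaying_hamVec (hS : S.IsDecaying) (hl : Decaying dl) (hl' : Decaying dlHat) :
    (hamVec M N a P f π S dl dlHat).IsDecaying := by
  have hZ := (hS .psi).subLapThird (hS .E)
  intro k
  cases k
  · exact ((((((hS .psi).const_mul _).add ((hS .pPsi).const_mul _)).const_mul _).neg).sub
      ((hS .phi).const_mul _)).add ((hS .B).lap.const_mul _)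
  · have hK := ((((hS .psi).const_mul (5 / 8 * (M.lam * π ^ 2 / a ^ 7))).add
      ((hS .psi).const_mul (M.V f / (8 * M.lam * a)))).sub
      ((hS .dpi).const_mul (M.lam * π / (2 * a ^ 5)))).add
      ((hS .dphi).const_mul (a * deriv M.V f / (4 * M.lam)))
    have h1 := ((((hS .psi).const_mul (1 / 8 * (P ^ 2 / a ^ 3))).sub
      ((hS .pPsi).const_mul (P / (2 * a)))).add (hK.const_mul M.kappa)).add
      (hZ.lap.const_mul (1 / 3 * (1 / a ^ 3)))
    exact ((((h1.const_mul N).add ((hS .phi).const_mul _)).add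
      ((hS .phi).lap.const_mul _)).sub ((hS .B).lap.const_mul _)).neg
  · exact ((((hS .E).const_mul _).add ((hS .pE).const_mul _)).const_mul _).add
      ((hS .B).const_mul _)
  · exact (((((((hS .E).const_mul _).add ((hS .pE).const_mul _)).add ((hS .E).const_mul _)).sub
      (hZ.const_mul _)).const_mul _).sub ((hS .phi).const_mul _)).add ((hS .B).const_mul _) |>.neg
  · exact hl
  · exact (decaying_hamiltonianScalar hS).neg
  · exact hl'
  · exact (decaying_diffeoScalar hS).neg
  · exact (((hS .dpi).const_mul _).sub ((hS .psi).const_mul _)).const_mul _ |>.add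
      ((hS .phi).const_mul _)
  · exact ((((((hS .dphi).const_mul _).add ((hS .psi).const_mul _)).sub
      ((hS .dphi).lap.const_mul _)).const_mul _).add ((hS .phi).const_mul _)).neg.add
      ((hS .B).lap.const_mul _)

end HamVec

end

end CosmoPert

namespace CosmoPert

open MeasureTheory Filter Topology

noncomputable section

/-! ### Linearized Hamilton equations and gauge vectors as equations for scalar functions -/

/-- The background factors in the definition of the scalar perturbations. -/
def scaleFactor (bg : Background) (t : ℝ) : Var → ℝ
  | .psi | .E => 2 * bg.A t
  | .pPsi | .pE => 2 * bg.Pt t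
  | .phi | .pPhi => bg.N t
  | .B | .pB | .dphi | .dpi => 1

/-- The scalar perturbation with the background factors included. -/
def scale (bg : Background) (t : ℝ) (s : ScalarPert) : ScalarPert :=
  fun k x => scaleFactor bg t k * s k x

/-- `v` is the time derivative of the curve `s` at `t`, and time derivatives commute with spatial
derivatives. -/
structure HasVelocity (s : ℝ → ScalarPert) (v : ScalarPert) (t : ℝ) : Prop where
  val : ∀ k x, HasDerivAt (fun τ => s τ k x) (v k x) t
  pd : ∀ k a x, HasDerivAt (fun τ => pd a (s τ k) x) (pd a (v k) x) t
  pd_pd : ∀ k a b x, HasDerivAt (fun τ => CosmoPert.pd a (CosmoPert.pd b (s τ k)) x)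
    (CosmoPert.pd a (CosmoPert.pd b (v k)) x) t
  lap : ∀ k x, HasDerivAt (fun τ => lap (s τ k) x) (lap (v k) x) t

lemma isDecaying_scale {bg : Background} {t : ℝ} {s : ScalarPert} (hs : s.IsDecaying) :
    (scale bg t s).IsDecaying := fun k => (hs k).const_mul _

lemma scale_of_scaleFactor_eq_one {bg : Background} {t : ℝ} {s : ScalarPert} {k : Var}
    (hk : scaleFactor bg t k = 1) : scale bg t s k = s k := by
  ext x
  simp [scale, hk]

lemma scale_apply (bg : Background) (t : ℝ) (s : ScalarPert) (k : Var) :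
    scale bg t s k = fun x => scaleFactor bg t k * s k x := rfl

lemma embed_eq_scalarPoint {bg : Background} {t : ℝ} {s : ScalarPert}
    (hs : ∀ k, ContDiff ℝ ∞ (s k)) : embed bg t s = scalarPoint (scale bg t s) := by
  have h1 : ∀ k, scaleFactor bg t k = 1 → scale bg t s k = s k := fun k hk =>
    scale_of_scaleFactor_eq_one hk
  refine PhasePoint.ext_fields ?_ ?_ rfl rfl ?_ ?_ ?_ ?_
  · ext x a b
    simp only [embed, scalarPoint, scale_apply, scaleFactor, Matrix.of_apply]
    rw [traceless_const_mul _ (hs _)]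
    split_ifs <;> ring
  · ext x a b
    simp only [embed, scalarPoint, scale_apply, scaleFactor, Matrix.of_apply]
    rw [traceless_const_mul _ (hs _)]
    split_ifs <;> ring
  all_goals simp only [embed, scalarPoint, h1 .B rfl, h1 .pB rfl, h1 .dphi rfl, h1 .dpi rfl]

section Characterizations

variable {M : Model} {bg : Background} {t a : ℝ}

/-- The embedding multiplies by time-dependent background factors, so the velocity has an extra term
with their derivatives c. -/
lemma phaseVelocity_embed {s : ℝ → ScalarPert} {v : ScalarPert} {c : Var → ℝ}
    (hc : ∀ k, HasDerivAt (fun τ => scaleFactor bg τ k) (c k) t)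
    (hs : ∀ k, ContDiff ℝ ∞ (s t k)) (hv : ∀ k, ContDiff ℝ ∞ (v k)) (h : HasVelocity s v t)
    (hc1 : c .B = 0 ∧ c .pB = 0) :
    phaseVelocity (fun τ => embed bg τ (s τ)) t =
      scalarPoint (fun k x => c k * s t k x + scaleFactor bg t k * v k x) := by
  have hT : ∀ k i j x, HasDerivAt (fun τ => traceless (s τ k) i j x) (traceless (v k) i j x) t := by
    intro k i j x
    refine (h.pd_pd k i j x).sub ?_
    split_ifs
    · exact (h.lap k x).div_const 3
    · exact hasDerivAt_const _ _
  have hI : ∀ k (i j : Fin 3) x, HasDerivAt (fun τ => if i = j then s τ k x else 0)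
      (if i = j then v k x else 0) t := by
    intro k i j x
    split_ifs
    · exact h.val k x
    · exact hasDerivAt_const _ _
  have hA := fun k i j x => (hc k).mul ((hI .psi i j x).add (hT .E i j x))
  have hL : ∀ (c d : ℝ) k i j x, traceless (fun x => c * s t k x + d * v k x) i j x =
      c * traceless (s t k) i j x + d * traceless (v k) i j x := by
    intro c d k i j x
    have h1 := hs k
    have h2 := hv k
    rw [traceless_add (by fun_prop) (by fun_prop), traceless_const_mul _ h1,
      traceless_const_mul _ h2]
  refine PhasePoint.ext_fields ?_ ?_ ?_ ?_ ?_ ?_ ?_ ?_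
  · ext x i j
    have := ((hc .psi).mul ((hI .psi i j x).add (hT .E i j x))).deriv
    -- The two variables share one background factor; uniqueness of the derivative identifies the
    -- rates and lets the trace and trace-free parts combine.
    have hcE : c .E = c .psi := (hc .E).unique (hc .psi)
    simp only [phaseVelocity, embed, scalarPoint, Matrix.of_apply, hL]
    refine Eq.trans this ?_
    simp only [scaleFactor, hcE, Pi.add_apply]
    split_ifs <;> ring
  · ext x i j
    have := ((hc .pPsi).mul ((hI .pPsi i j x).add (hT .pE i j x))).deriv
    have hcE : c .pE = c .pPsi := (hc .pE).unique (hc .pPsi)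
    simp only [phaseVelocity, embed, scalarPoint, Matrix.of_apply, hL]
    refine Eq.trans this ?_
    simp only [scaleFactor, hcE, Pi.add_apply]
    split_ifs <;> ring
  · ext x
    exact ((hc .phi).mul (h.val .phi x)).deriv
  · ext x
    exact ((hc .pPhi).mul (h.val .pPhi x)).deriv
  · ext x i
    simp only [phaseVelocity, embed, scalarPoint, hc1.1, scaleFactor, zero_mul, zero_add, one_mul]
    exact (h.pd .B i x).deriv
  · ext x i
    simp only [phaseVelocity, embed, scalarPoint, hc1.2, scaleFactor, zero_mul, zero_add, one_mul]
    exact (h.pd .pB i x).deriv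
  · ext x
    have hc0 : c .dphi = 0 := (hc .dphi).unique (hasDerivAt_const t 1)
    simp only [phaseVelocity, embed, scalarPoint, hc0, scaleFactor, zero_mul, zero_add, one_mul]
    exact (h.val .dphi x).deriv
  · ext x
    have hc0 : c .dpi = 0 := (hc .dpi).unique (hasDerivAt_const t 1)
    simp only [phaseVelocity, embed, scalarPoint, hc0, scaleFactor, zero_mul, zero_add, one_mul]
    exact (h.val .dpi x).deriv

lemma linearizedHamiltonAt_iff (ha : 0 < a) (hA : bg.A t = a ^ 2) {s : ℝ → ScalarPert}
    {v : ScalarPert} {c : Var → ℝ} {dl dlHat : Space → ℝ}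
    (hc : ∀ k, HasDerivAt (fun τ => scaleFactor bg τ k) (c k) t)
    (hs : (s t).IsDecaying) (hv : v.IsDecaying) (h : HasVelocity s v t)
    (hl : Decaying dl) (hl' : Decaying dlHat) :
    LinearizedHamiltonAt M bg t s dl dlHat ↔
      hamVec M (bg.N t) a (bg.Pt t) (bg.phi t) (bg.piPhi t) (scale bg t (s t)) dl dlHat =
        fun k x => c k * s t k x + scaleFactor bg t k * v k x := by
  have hS := isDecaying_scale (bg := bg) (t := t) hs
  have hX := isDecaying_hamVec (M := M) (N := bg.N t) (a := a) (P := bg.Pt t) (f := bg.phi t)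
    (π := bg.piPhi t) hS hl hl'
  have hY : ScalarPert.IsDecaying (fun k x => c k * s t k x + scaleFactor bg t k * v k x) :=
    fun k => ((hs k).const_mul _).add ((hv k).const_mul _)
  rw [LinearizedHamiltonAt, ← symplecticDensity_scalarPoint_iff (M := M) hX hY,
    phaseVelocity_embed hc (fun k => (hs k).1) (fun k => (hv k).1) h
      ⟨(hc .B).unique (hasDerivAt_const t 1), (hc .pB).unique (hasDerivAt_const t 1)⟩]
  refine forall_congr' fun η => forall_congr' fun hη => ?_
  have e : ∫ x, secondVariation M bg t (embed bg t (s t)) dl dlHat η x =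
      ∫ x, symplecticDensity M (scalarPoint (hamVec M (bg.N t) a (bg.Pt t) (bg.phi t)
        (bg.piPhi t) (scale bg t (s t)) dl dlHat)) η x := by
    refine DivEq.integral_eq ((DivEq.of_eq fun x => ?_).trans
      (DivEq.variationDensity (fun k => (hS k).1) hη))
      (isTest_symplecticDensity M (isSmoothVariation_scalarPoint fun k => (hX k).1) hη).integrable
    rw [embed_eq_scalarPoint fun k => (hs k).1, secondVariation_eq ha hA
      (isSmoothVariation_scalarPoint fun k => (hS k).1) hη.isSmoothVariation]
    rfl
  rw [e]

/-- The lapse and shift functions of a gauge transformation as a scalar perturbation. -/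
def gaugeSource (xi beta : Space → ℝ) : ScalarPert
  | .phi => xi
  | .B => beta
  | _ => fun _ => 0

lemma isDecaying_gaugeSource {xi beta : Space → ℝ} (h : Decaying xi) (h' : Decaying beta) :
    (gaugeSource xi beta).IsDecaying := by
  intro k
  cases k <;> first | exact h | exact h' | exact Decaying.zero

lemma lap_zero : lap (fun _ => (0 : ℝ)) = fun _ => 0 := by
  have := lap_const_mul (f := fun _ => (0 : ℝ)) 0 contDiff_const
  simpa using this

lemma subLapThird_zero : subLapThird (fun _ => (0 : ℝ)) (fun _ => 0) = fun _ => 0 := by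
  ext x
  simp [subLapThird, lap_zero]

/-- The first variation of the smeared constraints is the bilinear second variation with N = 0,
paired with a perturbation having only lapse ξ and shift potential β, while χ and χ_B play the role
of multipliers. The vector field computation thus serves gauge transformations as well. -/
lemma isGaugeVector_iff (ha : 0 < a) (hA : bg.A t = a ^ 2) {xi beta chi chiB : Space → ℝ}
    {g : ScalarPert} (hxi : Decaying xi) (hbeta : Decaying beta) (hchi : Decaying chi)
    (hchiB : Decaying chiB) :
    IsGaugeVector M bg t xi beta chi chiB g ↔ g.IsDecaying ∧
      hamVec M 0 a (bg.Pt t) (bg.phi t) (bg.piPhi t) (gaugeSource xi beta) chi chiB =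
        scale bg t g := by
  rw [IsGaugeVector]
  refine and_congr_right fun hg => ?_
  have hS := isDecaying_gaugeSource hxi hbeta
  have hX := isDecaying_hamVec (M := M) (N := 0) (a := a) (P := bg.Pt t) (f := bg.phi t)
    (π := bg.piPhi t) hS hchi hchiB
  rw [← symplecticDensity_scalarPoint_iff (M := M) hX (isDecaying_scale hg),
    embed_eq_scalarPoint fun k => (hg k).1]
  refine forall_congr' fun η => forall_congr' fun hη => ?_
  have e : ∫ x, deriv (fun e : ℝ => smearedConstraints M (bg.point t + e • η) xi
        (fun y a => pd a beta y) chi (fun y a => pd a chiB y) x) 0 =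
      ∫ x, symplecticDensity M (scalarPoint (hamVec M 0 a (bg.Pt t) (bg.phi t)
        (bg.piPhi t) (gaugeSource xi beta) chi chiB)) η x := by
    refine DivEq.integral_eq ((DivEq.of_eq fun x => ?_).trans
      (DivEq.variationDensity (fun k => (hS k).1) hη))
      (isTest_symplecticDensity M (isSmoothVariation_scalarPoint fun k => (hX k).1) hη).integrable
    -- The remaining terms of the bilinear density pair the varied lapse and shift with the
    -- constraints of the source; these vanish, as lapse and shift do not enter the constraints.
    have e1 : hamiltonianScalar M a (bg.Pt t) (bg.phi t) (bg.piPhi t) (gaugeSource xi beta) x = 0 := by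
      simp [hamiltonianScalar, gaugeSource, subLapThird_zero, lap_zero]
    have e2 : diffeoScalar M a (bg.Pt t) (bg.piPhi t) (gaugeSource xi beta) = fun _ => 0 := by
      ext y
      simp [diffeoScalar, gaugeSource, lap_zero]
    rw [deriv_smearedConstraints ha hA hη.isSmoothVariation]
    simp only [variationDensity, hamiltonianLin_scalarPoint (fun k => (hS k).1),
      diffeoLin_scalarPoint (fun k => (hS k).1), e1, e2, pd_const, zero_mul, mul_zero, zero_add,
      add_zero]
    rfl
  rw [e]

lemma onConstraintSurface_iff (ha : 0 < a) (hA : bg.A t = a ^ 2) (hN : bg.N t ≠ 0) {s : ScalarPert}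
    (hs : s.IsDecaying) :
    OnConstraintSurface M bg t s ↔ (∀ x, s .pPhi x = 0) ∧ (∀ x, s .pB x = 0) ∧
      (∀ x, hamiltonianScalar M a (bg.Pt t) (bg.phi t) (bg.piPhi t) (scale bg t s) x = 0) ∧
      ∀ x, diffeoScalar M a (bg.Pt t) (bg.piPhi t) (scale bg t s) x = 0 := by
  have hS := isDecaying_scale (bg := bg) (t := t) hs
  have hu := isSmoothVariation_scalarPoint fun k => (hS k).1
  simp only [OnConstraintSurface, embed_eq_scalarPoint fun k => (hs k).1,
    deriv_hamiltonianConstraint ha hA hu, deriv_diffeoConstraint hA hu,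
    hamiltonianLin_scalarPoint (fun k => (hS k).1), diffeoLin_scalarPoint (fun k => (hS k).1)]
  constructor
  · intro h
    refine ⟨fun x => ?_, ?_, fun x => (h x).2.2.1, ?_⟩
    · have := (h x).1
      simpa [scalarPoint, scale, scaleFactor, hN] using this
    · refine (hs .pB).eq_zero_of_pd_eq_zero fun i x => ?_
      have := (h x).2.1 i
      rwa [scalarPoint, scale_of_scaleFactor_eq_one (k := .pB) rfl] at this
    · exact (decaying_diffeoScalar hS).eq_zero_of_pd_eq_zero fun i x => (h x).2.2.2 i
  · rintro ⟨h1, h2, h3, h4⟩ x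
    have h2' : s .pB = fun _ => 0 := funext h2
    have h4' : diffeoScalar M a (bg.Pt t) (bg.piPhi t) (scale bg t s) = fun _ => 0 := funext h4
    refine ⟨?_, fun i => ?_, h3 x, fun i => ?_⟩
    · simp [scalarPoint, scale, scaleFactor, h1]
    · rw [scalarPoint, scale_of_scaleFactor_eq_one (k := .pB) rfl, h2']
      exact pd_const_apply i 0 x
    · rw [h4', pd_const]

end Characterizations

end

end CosmoPert

namespace CosmoPert

open MeasureTheory Filter Topology

noncomputable section

/-! ### The background in terms of the scale factor -/

namespace Background.IsSolution

variable {M : Model} {bg : Background} {I : Set ℝ} {t a : ℝ}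

lemma Pt_eq (h : bg.IsSolution M I) (ht : t ∈ I) (ha : 0 < a) (hA : bg.A t = a ^ 2) :
    bg.Pt t = -2 * a * bg.H t / bg.N t := by
  have hN := (h.N_pos t ht).ne'
  rw [Background.Pt, Background.H, hA, Real.sqrt_sq ha.le]
  field_simp

/-- The Friedmann constraint solved for the potential. With this and `p_eq` the values of V and p
disappear in favour of a, H, N and π, so later identities are rational in independent quantities. -/
lemma V_eq (h : bg.IsSolution M I) (ht : t ∈ I) (ha : 0 < a) (hA : bg.A t = a ^ 2) :
    M.V (bg.phi t) =
      M.lam * (12 * bg.H t ^ 2 / (M.kappa * bg.N t ^ 2) - M.lam * bg.piPhi t ^ 2 / a ^ 6) := by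
  have hN := (h.N_pos t ht).ne'
  have hκ := M.kappa_pos.ne'
  have hl := M.lam_ne_zero
  have hf := h.friedmann t ht
  rw [Background.rho, hA] at hf
  rw [hf]
  field_simp
  ring

lemma p_eq (h : bg.IsSolution M I) (ht : t ∈ I) (ha : 0 < a) (hA : bg.A t = a ^ 2) :
    bg.p M t = M.lam * bg.piPhi t ^ 2 / a ^ 6 - 6 * bg.H t ^ 2 / (M.kappa * bg.N t ^ 2) := by
  have hN := (h.N_pos t ht).ne'
  have hκ := M.kappa_pos.ne'
  have hl := M.lam_ne_zero
  rw [Background.p, h.V_eq ht ha hA, hA]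
  field_simp
  ring

end Background.IsSolution

lemma rpow_three_halves {A a : ℝ} (ha : 0 < a) (hA : A = a ^ 2) : A ^ (3 / 2 : ℝ) = a ^ 3 := by
  rw [hA, ← Real.rpow_natCast a 2, ← Real.rpow_mul ha.le, ← Real.rpow_natCast a 3]
  norm_num

/-! ### The table of observables -/

section Table

variable {M : Model} {bg : Background} {I : Set ℝ} {t a : ℝ} {s : ScalarPert}

lemma decaying_bardeenPsi (hs : s.IsDecaying) : Decaying (bardeenPsi bg t s) :=
  ((hs .psi).add (((hs .E).add (hs .pE)).const_mul _)).sub ((hs .E).lap.div_const 3)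

lemma decaying_upsilon (hs : s.IsDecaying) : Decaying (upsilon M bg t s) :=
  (((hs .pPsi).add ((hs .E).lap.div_const 2)).add ((hs .pE).lap.const_mul _)).sub
    (((hs .E).add (hs .pE)).const_mul _)

lemma isDecaying_flatObservables (hs : s.IsDecaying) :
    (flatObservables M bg t s).IsDecaying := by
  have hΨ := decaying_bardeenPsi (bg := bg) (t := t) hs
  have hΥ := decaying_upsilon (M := M) (bg := bg) (t := t) hs
  have hZ := (hs .psi).sub ((hs .E).lap.div_const 3)
  intro k
  cases k
  · exact Decaying.zero
  · exact (hΥ.add (hΨ.const_mul _)).sub (hΨ.lap.const_mul _)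
  · exact Decaying.zero
  · exact hΨ.div_const _
  · exact (hΥ.const_mul _).sub (hΨ.const_mul _)
  · exact hs .pPhi
  · exact hΨ.const_mul _
  · exact hs .pB
  · exact (hs .dphi).sub (hZ.const_mul _)
  · exact ((hs .dpi).sub ((hs .E).lap.const_mul _)).add (hZ.const_mul _)

variable (hbg : bg.IsSolution M I) (ht : t ∈ I) (ha : 0 < a) (hA : bg.A t = a ^ 2)

include hbg ht ha hA

/-- Here P̃² = 4a²H²/N². The observables of p_E and p_ψ serve as coordinates in place of Ψ and Υ
from now on, since the flow is expressed directly in them. -/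
lemma bardeenPsi_eq (x : Space) : bardeenPsi bg t s x =
    4 * a ^ 2 * bg.H t ^ 2 / bg.N t ^ 2 * flatObservables M bg t s .pE x := by
  have hN := (hbg.N_pos t ht).ne'
  have hH := hbg.H_ne_zero t ht
  simp only [flatObservables, hbg.Pt_eq ht ha hA]
  field_simp
  ring

lemma flatObservables_pE (x : Space) : flatObservables M bg t s .pE x =
    s .pE x + s .E x + bg.N t ^ 2 / (4 * a ^ 2 * bg.H t ^ 2) * subLapThird (s .psi) (s .E) x := by
  have hN := (hbg.N_pos t ht).ne'
  have hH := hbg.H_ne_zero t ht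
  simp only [flatObservables, bardeenPsi, subLapThird, hbg.Pt_eq ht ha hA, hA]
  field_simp
  ring

lemma lap_flatObservables_pE (hs : s.IsDecaying) (x : Space) :
    lap (flatObservables M bg t s .pE) x = lap (s .pE) x + lap (s .E) x
      + bg.N t ^ 2 / (4 * a ^ 2 * bg.H t ^ 2) * lap (subLapThird (s .psi) (s .E)) x := by
  have hZ := (hs .psi).subLapThird (hs .E)
  rw [funext (flatObservables_pE (M := M) (s := s) hbg ht ha hA),
    lap_add ((hs .pE).add (hs .E)).1 (hZ.const_mul _).1, lap_add (hs .pE).1 (hs .E).1,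
    lap_const_mul _ hZ.1]

lemma lap_bardeenPsi (hs : s.IsDecaying) (x : Space) : lap (bardeenPsi bg t s) x =
    4 * a ^ 2 * bg.H t ^ 2 / bg.N t ^ 2 * lap (flatObservables M bg t s .pE) x := by
  rw [funext (bardeenPsi_eq (M := M) (s := s) hbg ht ha hA), lap_const_mul _
    (isDecaying_flatObservables hs .pE).1]

lemma flatObservables_pPsi (hs : s.IsDecaying) (x : Space) : flatObservables M bg t s .pPsi x =
    s .pPsi x - lap (s .E) x / 6
      + (1 / 4 + M.kappa * bg.N t ^ 2 * bg.p M t / (8 * bg.H t ^ 2))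
        * subLapThird (s .psi) (s .E) x
      - bg.N t ^ 2 / (6 * a ^ 2 * bg.H t ^ 2) * lap (subLapThird (s .psi) (s .E)) x := by
  have hN := (hbg.N_pos t ht).ne'
  have hH := hbg.H_ne_zero t ht
  have h1 := lap_bardeenPsi (M := M) hbg ht ha hA hs x
  rw [lap_flatObservables_pE hbg ht ha hA hs] at h1
  have h2 := bardeenPsi_eq (M := M) (s := s) hbg ht ha hA x
  rw [flatObservables_pE hbg ht ha hA] at h2
  simp only [flatObservables, h1, h2, upsilon, hbg.Pt_eq ht ha hA, hA]
  field_simp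
  ring

lemma upsilon_eq (hs : s.IsDecaying) (x : Space) : upsilon M bg t s x =
    flatObservables M bg t s .pPsi x
      - (a ^ 2 * bg.H t ^ 2 / bg.N t ^ 2 + M.kappa / 2 * a ^ 2 * bg.p M t)
        * flatObservables M bg t s .pE x
      + 2 / 3 * lap (flatObservables M bg t s .pE) x := by
  have hN := (hbg.N_pos t ht).ne'
  have hH := hbg.H_ne_zero t ht
  have h1 := lap_bardeenPsi (M := M) hbg ht ha hA hs x
  have h2 := bardeenPsi_eq (M := M) (s := s) hbg ht ha hA x
  rw [show flatObservables M bg t s .pPsi x = upsilon M bg t s x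
      + (1 / 4 + M.kappa / (2 * bg.Pt t ^ 2) * bg.A t * bg.p M t) * bardeenPsi bg t s x
      - 2 / (3 * bg.Pt t ^ 2) * lap (bardeenPsi bg t s) x from rfl, h1, h2, hbg.Pt_eq ht ha hA, hA]
  field_simp
  ring

/-- In this form the entry is the condition that ψ stays zero under the flow; `flatObservables_B` is
the corresponding condition for E. -/
lemma flatObservables_phi (hs : s.IsDecaying) (x : Space) : flatObservables M bg t s .phi x =
    -2 * flatObservables M bg t s .pPsi x - 4 / 3 * lap (flatObservables M bg t s .pE) x := by
  have hN := (hbg.N_pos t ht).ne'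
  have hH := hbg.H_ne_zero t ht
  rw [show flatObservables M bg t s .phi x = -2 * upsilon M bg t s x
      - (1 / 2 + M.kappa / bg.Pt t ^ 2 * bg.A t * bg.p M t) * bardeenPsi bg t s x from rfl,
    upsilon_eq hbg ht ha hA hs, bardeenPsi_eq (M := M) hbg ht ha hA, hbg.Pt_eq ht ha hA, hA]
  field_simp
  ring

lemma flatObservables_B (x : Space) : flatObservables M bg t s .B x =
    4 * bg.H t * flatObservables M bg t s .pE x := by
  have hN := (hbg.N_pos t ht).ne'
  have hH := hbg.H_ne_zero t ht
  rw [show flatObservables M bg t s .B x = bg.N t ^ 2 / (bg.A t * bg.H t) * bardeenPsi bg t s x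
    from rfl, bardeenPsi_eq (M := M) hbg ht ha hA, hA]
  field_simp

omit hbg ht in
lemma flatObservables_dphi (x : Space) : flatObservables M bg t s .dphi x =
    s .dphi x - M.lam * bg.N t * bg.piPhi t / (a ^ 3 * bg.H t) * subLapThird (s .psi) (s .E) x := by
  simp only [flatObservables, subLapThird, rpow_three_halves ha hA]
  ring

lemma flatObservables_dpi (x : Space) : flatObservables M bg t s .dpi x =
    s .dpi x - bg.piPhi t * lap (s .E) x
      + a ^ 3 * deriv M.V (bg.phi t) * bg.N t / (2 * M.lam * bg.H t)
        * subLapThird (s .psi) (s .E) x := by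
  have hl := M.lam_ne_zero
  have hH := hbg.H_ne_zero t ht
  simp only [flatObservables, subLapThird, rpow_three_halves ha hA]
  field_simp

end Table

end

end CosmoPert

namespace CosmoPert

open MeasureTheory Filter Topology

noncomputable section

/-! ### Time derivatives of the background -/

namespace Background.IsSolution

variable {M : Model} {bg : Background} {I : Set ℝ} {t a : ℝ}

lemma exists_sqrt (h : bg.IsSolution M I) (ht : t ∈ I) : ∃ a : ℝ, 0 < a ∧ bg.A t = a ^ 2 :=
  ⟨Real.sqrt (bg.A t), Real.sqrt_pos.2 (h.A_pos t ht), (Real.sq_sqrt (h.A_pos t ht).le).symm⟩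

lemma hasDerivAt_A (h : bg.IsSolution M I) (hI : IsOpen I) (ht : t ∈ I) :
    HasDerivAt bg.A (2 * bg.A t * bg.H t) t := by
  have h1 := ((h.A_smooth.contDiffAt (hI.mem_nhds ht)).differentiableAt (by simp)).hasDerivAt
  have hA := (h.A_pos t ht).ne'
  refine h1.congr_deriv ?_
  rw [Background.H]
  field_simp

lemma hasDerivAt_N (h : bg.IsSolution M I) (hI : IsOpen I) (ht : t ∈ I) :
    HasDerivAt bg.N (deriv bg.N t) t :=
  ((h.N_smooth.contDiffAt (hI.mem_nhds ht)).differentiableAt (by simp)).hasDerivAt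

lemma contDiffOn_deriv_of_isOpen {f : ℝ → ℝ} (hI : IsOpen I) (hf : ContDiffOn ℝ ∞ f I) :
    ContDiffOn ℝ ∞ (deriv f) I :=
  hf.deriv_of_isOpen hI (m := ∞) (by simp)

lemma contDiffOn_H (h : bg.IsSolution M I) (hI : IsOpen I) : ContDiffOn ℝ ∞ bg.H I :=
  (contDiffOn_deriv_of_isOpen hI h.A_smooth).div (contDiffOn_const.mul h.A_smooth)
    fun t ht => mul_ne_zero two_ne_zero (h.A_pos t ht).ne'

lemma hasDerivAt_H (h : bg.IsSolution M I) (hI : IsOpen I) (ht : t ∈ I) :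
    HasDerivAt bg.H (deriv bg.N t / bg.N t * bg.H t - 3 / 2 * bg.H t ^ 2
      - M.kappa / 4 * bg.N t ^ 2 * bg.p M t) t := by
  rw [← h.friedmann_dot t ht]
  exact (((h.contDiffOn_H hI).contDiffAt (hI.mem_nhds ht)).differentiableAt (by simp)).hasDerivAt

lemma hasDerivAt_phi (h : bg.IsSolution M I) (hI : IsOpen I) (ht : t ∈ I) (ha : 0 < a)
    (hA : bg.A t = a ^ 2) :
    HasDerivAt bg.phi (M.lam * bg.N t / a ^ 3 * bg.piPhi t) t := by
  rw [← rpow_three_halves ha hA, ← h.phi_eq t ht]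
  exact ((h.phi_smooth.contDiffAt (hI.mem_nhds ht)).differentiableAt (by simp)).hasDerivAt

lemma hasDerivAt_piPhi (h : bg.IsSolution M I) (hI : IsOpen I) (ht : t ∈ I) (ha : 0 < a)
    (hA : bg.A t = a ^ 2) :
    HasDerivAt bg.piPhi (-(bg.N t * a ^ 3) / (2 * M.lam) * deriv M.V (bg.phi t)) t := by
  rw [← rpow_three_halves ha hA, ← h.piPhi_eq t ht]
  exact ((h.piPhi_smooth.contDiffAt (hI.mem_nhds ht)).differentiableAt (by simp)).hasDerivAt

lemma hasDerivAt_sqrt_A (h : bg.IsSolution M I) (hI : IsOpen I) (ht : t ∈ I) (ha : 0 < a)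
    (hA : bg.A t = a ^ 2) : HasDerivAt (fun τ => Real.sqrt (bg.A τ)) (a * bg.H t) t := by
  have := (h.hasDerivAt_A hI ht).sqrt (h.A_pos t ht).ne'
  refine this.congr_deriv ?_
  rw [hA, Real.sqrt_sq ha.le]
  field_simp

/-- Logarithmic differentiation of P̃ = -2aH/N: the rate is H + H'/H - N'/N, and the second
Friedmann equation cancels the derivative of the lapse. -/
lemma hasDerivAt_Pt (h : bg.IsSolution M I) (hI : IsOpen I) (ht : t ∈ I) :
    HasDerivAt bg.Pt (-(bg.H t / 2 + M.kappa * bg.N t ^ 2 * bg.p M t / (4 * bg.H t)) * bg.Pt t)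
      t := by
  obtain ⟨a, ha, hA⟩ := h.exists_sqrt ht
  have hN := (h.N_pos t ht).ne'
  have hH := h.H_ne_zero t ht
  have h1 : bg.Pt =ᶠ[𝓝 t] fun τ => -2 * Real.sqrt (bg.A τ) * bg.H τ / bg.N τ := by
    filter_upwards [hI.mem_nhds ht] with τ hτ
    exact h.Pt_eq hτ (Real.sqrt_pos.2 (h.A_pos τ hτ)) (Real.sq_sqrt (h.A_pos τ hτ).le).symm
  refine HasDerivAt.congr_of_eventuallyEq ?_ h1
  have := (((h.hasDerivAt_sqrt_A hI ht ha hA).const_mul (-2)).mul (h.hasDerivAt_H hI ht)).div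
    (h.hasDerivAt_N hI ht) hN
  refine this.congr_deriv ?_
  rw [h.Pt_eq ht ha hA, hA, Real.sqrt_sq ha.le]
  simp only [Pi.mul_apply, hA, Real.sqrt_sq ha.le]
  field_simp
  ring

lemma Pt_ne_zero (h : bg.IsSolution M I) (ht : t ∈ I) : bg.Pt t ≠ 0 := by
  obtain ⟨a, ha, hA⟩ := h.exists_sqrt ht
  have hN := (h.N_pos t ht).ne'
  have hH := h.H_ne_zero t ht
  rw [h.Pt_eq ht ha hA]
  positivity

lemma scaleFactor_ne_zero (h : bg.IsSolution M I) (ht : t ∈ I) (k : Var) :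
    scaleFactor bg t k ≠ 0 := by
  have h1 := (h.A_pos t ht).ne'
  have h2 := h.Pt_ne_zero ht
  have h3 := (h.N_pos t ht).ne'
  cases k <;> simp [scaleFactor, h1, h2, h3]

end Background.IsSolution

/-- The logarithmic time derivative of the background factors of the perturbations. -/
def scaleRate (M : Model) (bg : Background) (t : ℝ) : Var → ℝ
  | .psi | .E => 2 * bg.H t
  | .pPsi | .pE => -(bg.H t / 2 + M.kappa * bg.N t ^ 2 * bg.p M t / (4 * bg.H t))
  | .phi | .pPhi => deriv bg.N t / bg.N t
  | .B | .pB | .dphi | .dpi => 0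

lemma Background.IsSolution.hasDerivAt_scaleFactor {M : Model} {bg : Background} {I : Set ℝ}
    {t : ℝ} (h : bg.IsSolution M I) (hI : IsOpen I) (ht : t ∈ I) (k : Var) :
    HasDerivAt (fun τ => scaleFactor bg τ k) (scaleRate M bg t k * scaleFactor bg t k) t := by
  have hN := (h.N_pos t ht).ne'
  have h1 := (h.hasDerivAt_A hI ht).const_mul 2
  have h2 := (h.hasDerivAt_Pt hI ht).const_mul 2
  have h3 := h.hasDerivAt_N hI ht
  cases k <;> simp only [scaleFactor, scaleRate]
  case psi | E => exact h1.congr_deriv (by ring)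
  case pPsi | pE => exact h2.congr_deriv (by ring)
  case phi | pPhi => exact h3.congr_deriv (by field_simp)
  all_goals exact (hasDerivAt_const t 1).congr_deriv (by ring)

/-! ### The linearized flow and the gauge transformations in explicit form -/

/-- The perturbation of the pressure term, `λπ/a⁶ δπ - V'/(2λ) δφ`. -/
def matterSource (M : Model) (bg : Background) (t a : ℝ) (s : ScalarPert) (x : Space) : ℝ :=
  M.lam * bg.piPhi t / a ^ 6 * s .dpi x - deriv M.V (bg.phi t) / (2 * M.lam) * s .dphi x

/-- The velocities prescribed by the linearized Hamilton equations, where `A = a²`. -/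
def linearFlow (M : Model) (bg : Background) (t a : ℝ) (s : ScalarPert) (dl dlHat : Space → ℝ) :
    ScalarPert
  | .psi => fun x => bg.H t * (s .phi x - s .psi x + 2 * s .pPsi x) + lap (s .B) x / 3
  | .E => fun x => s .B x - 4 * bg.H t * (s .E x + s .pE x)
  | .pPsi => fun x =>
      (5 / 2 * bg.H t + M.kappa * bg.N t ^ 2 * bg.p M t / (4 * bg.H t)) * s .psi x
      + (M.kappa * bg.N t ^ 2 * bg.p M t / (4 * bg.H t) - bg.H t / 2) * s .pPsi x
      - (bg.H t / 4 + M.kappa * bg.N t ^ 2 * bg.p M t / (8 * bg.H t)) * s .phi x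
      - M.kappa * bg.N t ^ 2 / (8 * bg.H t) * matterSource M bg t a s x
      + bg.N t ^ 2 / (6 * a ^ 2 * bg.H t) * (lap (subLapThird (s .psi) (s .E)) x + lap (s .phi) x)
      + lap (s .B) x / 6
  | .pE => fun x =>
      (5 / 2 * bg.H t + M.kappa * bg.N t ^ 2 * bg.p M t / (4 * bg.H t)) * (s .E x + s .pE x)
      - bg.N t ^ 2 / (4 * a ^ 2 * bg.H t) * (subLapThird (s .psi) (s .E) x + s .phi x) - s .B x
  | .phi => fun x => dl x / bg.N t - deriv bg.N t / bg.N t * s .phi x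
  | .pPhi => fun x => -hamiltonianScalar M a (bg.Pt t) (bg.phi t) (bg.piPhi t) (scale bg t s) x
      / bg.N t - deriv bg.N t / bg.N t * s .pPhi x
  | .B => dlHat
  | .pB => fun x => -diffeoScalar M a (bg.Pt t) (bg.piPhi t) (scale bg t s) x
  | .dphi => fun x => bg.N t * M.lam / a ^ 3
      * (s .dpi x - 3 * bg.piPhi t * s .psi x + bg.piPhi t * s .phi x)
  | .dpi => fun x => -(bg.N t * a ^ 3 / (2 * M.lam)) * (deriv (deriv M.V) (bg.phi t) * s .dphi x
      + deriv M.V (bg.phi t) * (3 * s .psi x + s .phi x))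
      + bg.N t * a / M.lam * lap (s .dphi) x + bg.piPhi t * lap (s .B) x

/-- The gauge transformation with descriptors `ξ`, `β`, `χ`, `χ_B`, where `A = a²`. -/
def gaugeVec (M : Model) (bg : Background) (t a : ℝ) (xi beta chi chiB : Space → ℝ) : ScalarPert
  | .psi => fun x => bg.H t / bg.N t * xi x + lap beta x / 3
  | .E => beta
  | .pPsi => fun x =>
      -(bg.H t / (4 * bg.N t) + M.kappa * bg.N t * bg.p M t / (8 * bg.H t)) * xi x
      + bg.N t / (6 * a ^ 2 * bg.H t) * lap xi x + lap beta x / 6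
  | .pE => fun x => -(bg.N t / (4 * a ^ 2 * bg.H t)) * xi x - beta x
  | .phi => fun x => chi x / bg.N t
  | .pPhi => fun _ => 0
  | .B => chiB
  | .pB => fun _ => 0
  | .dphi => fun x => M.lam * bg.piPhi t / a ^ 3 * xi x
  | .dpi => fun x => -(a ^ 3 * deriv M.V (bg.phi t) / (2 * M.lam)) * xi x
      + bg.piPhi t * lap beta x

lemma subLapThird_const_mul {f g : Space → ℝ} (c : ℝ) (hg : ContDiff ℝ ∞ g) :
    subLapThird (fun x => c * f x) (fun x => c * g x) = fun x => c * subLapThird f g x := by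
  ext x
  rw [subLapThird, subLapThird, lap_const_mul c hg]
  ring

section Explicit

variable {M : Model} {bg : Background} {I : Set ℝ} {t a : ℝ}

/-- Subtracting the growth of the background factors from the vector field turns phase space
velocities into velocities of the scalars; the background constraint is used through `V_eq`. -/
lemma hamVec_scale (hbg : bg.IsSolution M I) (ht : t ∈ I) (ha : 0 < a) (hA : bg.A t = a ^ 2)
    {s : ScalarPert} (hs : s.IsDecaying) (dl dlHat : Space → ℝ) (k : Var) (x : Space) :
    hamVec M (bg.N t) a (bg.Pt t) (bg.phi t) (bg.piPhi t) (scale bg t s) dl dlHat k x =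
      scaleRate M bg t k * scaleFactor bg t k * s k x
        + scaleFactor bg t k * linearFlow M bg t a s dl dlHat k x := by
  have hN := (hbg.N_pos t ht).ne'
  have hH := hbg.H_ne_zero t ht
  have hl := M.lam_ne_zero
  have hκ := M.kappa_pos.ne'
  have hZ := (hs .psi).subLapThird (hs .E)
  cases k <;> simp only [hamVec, linearFlow, scaleRate]
  case pPhi => simp only [scaleFactor]; field_simp; ring
  case pB => simp only [scaleFactor]; ring
  all_goals
    simp only [scale_apply, scaleFactor, lap_const_mul _ (hs _).1, subLapThird_const_mul _ (hs .E).1,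
      lap_const_mul _ hZ.1, hbg.Pt_eq ht ha hA, hbg.V_eq ht ha hA, hbg.p_eq ht ha hA, hA,
      matterSource]
    field_simp
    try ring

/-- The background factors are nonzero and can be cancelled, so the weak equations become an
explicit first-order system, in both directions. -/
lemma linearizedHamiltonAt_iff_velocity (hbg : bg.IsSolution M I) (hI : IsOpen I) (ht : t ∈ I)
    (ha : 0 < a) (hA : bg.A t = a ^ 2) {s : ℝ → ScalarPert} {v : ScalarPert}
    {dl dlHat : Space → ℝ} (hs : (s t).IsDecaying) (hv : v.IsDecaying) (h : HasVelocity s v t)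
    (hl : Decaying dl) (hl' : Decaying dlHat) :
    LinearizedHamiltonAt M bg t s dl dlHat ↔ v = linearFlow M bg t a (s t) dl dlHat := by
  rw [linearizedHamiltonAt_iff ha hA (hbg.hasDerivAt_scaleFactor hI ht) hs hv h hl hl']
  simp only [funext_iff, hamVec_scale hbg ht ha hA hs, add_right_inj,
    mul_right_inj' (hbg.scaleFactor_ne_zero ht _), eq_comm]

lemma isDecaying_linearFlow (hbg : bg.IsSolution M I) (ht : t ∈ I) (ha : 0 < a)
    (hA : bg.A t = a ^ 2) {s : ScalarPert} (hs : s.IsDecaying) {dl dlHat : Space → ℝ}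
    (hl : Decaying dl) (hl' : Decaying dlHat) : (linearFlow M bg t a s dl dlHat).IsDecaying := by
  intro k
  have h1 := isDecaying_hamVec (M := M) (N := bg.N t) (a := a) (P := bg.Pt t) (f := bg.phi t)
    (π := bg.piPhi t) (isDecaying_scale (bg := bg) (t := t) hs) hl hl' k
  have h2 := (h1.sub ((hs k).const_mul (scaleRate M bg t k * scaleFactor bg t k))).div_const
    (scaleFactor bg t k)
  convert h2 using 1
  ext x
  have := hbg.scaleFactor_ne_zero ht k
  rw [hamVec_scale hbg ht ha hA hs]
  field_simp
  ring

lemma hamVec_gaugeSource (hbg : bg.IsSolution M I) (ht : t ∈ I) (ha : 0 < a)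
    (hA : bg.A t = a ^ 2) (xi beta chi chiB : Space → ℝ) (k : Var) (x : Space) :
    hamVec M 0 a (bg.Pt t) (bg.phi t) (bg.piPhi t) (gaugeSource xi beta) chi chiB k x =
      scaleFactor bg t k * gaugeVec M bg t a xi beta chi chiB k x := by
  have hN := (hbg.N_pos t ht).ne'
  have hH := hbg.H_ne_zero t ht
  have hl := M.lam_ne_zero
  have hκ := M.kappa_pos.ne'
  cases k <;> simp only [hamVec, gaugeVec, gaugeSource, scaleFactor, hamiltonianScalar,
    diffeoScalar, lap_zero, subLapThird_zero, hbg.Pt_eq ht ha hA, hbg.V_eq ht ha hA,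
    hbg.p_eq ht ha hA, hA]
  all_goals
    field_simp
    try ring

lemma isGaugeVector_iff_eq (hbg : bg.IsSolution M I) (ht : t ∈ I) (ha : 0 < a)
    (hA : bg.A t = a ^ 2) {xi beta chi chiB : Space → ℝ} {g : ScalarPert} (hxi : Decaying xi)
    (hbeta : Decaying beta) (hchi : Decaying chi) (hchiB : Decaying chiB) :
    IsGaugeVector M bg t xi beta chi chiB g ↔
      g.IsDecaying ∧ g = gaugeVec M bg t a xi beta chi chiB := by
  rw [isGaugeVector_iff ha hA hxi hbeta hchi hchiB]
  simp only [funext_iff, hamVec_gaugeSource hbg ht ha hA, scale_apply,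
    mul_right_inj' (hbg.scaleFactor_ne_zero ht _), eq_comm]

/-- The clocks are canonically conjugate to the secondary constraints. -/
lemma clock_gaugeVector (hbg : bg.IsSolution M I) (ht : t ∈ I) {xi beta chi chiB : Space → ℝ}
    {g : ScalarPert} (hxi : Decaying xi) (hbeta : Decaying beta) (hchi : Decaying chi)
    (hchiB : Decaying chiB) (hg : IsGaugeVector M bg t xi beta chi chiB g) (x : Space) :
    clock0 bg t g x = xi x ∧ ∀ a, clockVec g a x = pd a beta x := by
  obtain ⟨a, ha, hA⟩ := hbg.exists_sqrt ht
  have hN := (hbg.N_pos t ht).ne'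
  have hH := hbg.H_ne_zero t ht
  rw [((isGaugeVector_iff_eq hbg ht ha hA hxi hbeta hchi hchiB).1 hg).2]
  refine ⟨?_, fun _ => rfl⟩
  simp only [clock0, gaugeVec]
  field_simp
  ring

end Explicit

end

end CosmoPert

namespace CosmoPert

open MeasureTheory Filter Topology

noncomputable section

/-! ### The observable map -/

section Affine

variable {o w : ScalarPert} {t : ℝ}

lemma hasDerivAt_affine (b c t : ℝ) : HasDerivAt (fun τ => b + (τ - t) * c) c t := by
  have := (((hasDerivAt_id t).sub_const t).mul_const c).const_add b
  exact this.congr_deriv (by ring)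

lemma hasVelocity_affine (ho : o.IsDecaying) (hw : w.IsDecaying) :
    HasVelocity (fun τ => o + (τ - t) • w) w t := by
  have e : ∀ τ k, (o + (τ - t) • w) k = fun x => o k x + (τ - t) * w k x := fun _ _ => rfl
  have h1 : ∀ τ k a, pd a ((o + (τ - t) • w) k) =
      fun x => pd a (o k) x + (τ - t) * pd a (w k) x := fun τ k a => by
    have hw' := (hw k).1
    rw [e, pd_add a (ho k).1 (by fun_prop), pd_const_mul a _ hw']
  refine ⟨fun k x => hasDerivAt_affine _ _ _, fun k a x => ?_, fun k a b x => ?_, fun k x => ?_⟩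
  · simp only [h1]
    exact hasDerivAt_affine _ _ _
  · have ho' := (ho k).1
    have hw' := (hw k).1
    have h2 : ∀ τ, pd a (fun x => pd b (o k) x + (τ - t) * pd b (w k) x) x =
        pd a (pd b (o k)) x + (τ - t) * pd a (pd b (w k)) x := fun τ => by
      rw [pd_add a (by fun_prop) (by fun_prop), pd_const_mul a _ (by fun_prop)]
    simp only [h1, h2]
    exact hasDerivAt_affine _ _ _
  · have ho' := (ho k).1
    have hw' := (hw k).1
    have h2 : ∀ τ, lap ((o + (τ - t) • w) k) x = lap (o k) x + (τ - t) * lap (w k) x := fun τ => by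
      rw [e, lap_add ho' (by fun_prop), lap_const_mul _ hw']
    simp only [h2]
    exact hasDerivAt_affine _ _ _

end Affine

section Observables

variable {M : Model} {bg : Background} {I : Set ℝ} {t a : ℝ} {s : ScalarPert}

/-- The table of observables is the gauge transform of the perturbation to vanishing clocks. -/
lemma flatObservables_eq_add_gaugeVec (hbg : bg.IsSolution M I) (ht : t ∈ I) (ha : 0 < a)
    (hA : bg.A t = a ^ 2) (hs : s.IsDecaying) {chi chiB : Space → ℝ} {k : Var} (h1 : k ≠ .phi)
    (h2 : k ≠ .B) :
    flatObservables M bg t s k = (s + gaugeVec M bg t a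
      (fun x => -(bg.N t / bg.H t) * subLapThird (s .psi) (s .E) x) (fun x => -1 * s .E x)
      chi chiB) k := by
  have hN := (hbg.N_pos t ht).ne'
  have hH := hbg.H_ne_zero t ht
  have hl := M.lam_ne_zero
  have hZ := (hs .psi).subLapThird (hs .E)
  ext x
  rw [Pi.add_apply, Pi.add_apply]
  cases k
  case psi =>
    simp only [flatObservables, gaugeVec, lap_const_mul _ (hs .E).1, subLapThird]
    field_simp
    ring
  case pPsi =>
    simp only [flatObservables_pPsi hbg ht ha hA hs, gaugeVec, lap_const_mul _ (hs .E).1,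
      lap_const_mul _ hZ.1]
    field_simp
    ring
  case E => simp [flatObservables, gaugeVec]
  case pE =>
    simp only [flatObservables_pE hbg ht ha hA, gaugeVec]
    field_simp
    ring
  case phi => exact absurd rfl h1
  case pPhi => simp [flatObservables, gaugeVec]
  case B => exact absurd rfl h2
  case pB => simp [flatObservables, gaugeVec]
  case dphi =>
    simp only [flatObservables_dphi ha hA, gaugeVec]
    field_simp
    ring
  case dpi =>
    simp only [flatObservables_dpi hbg ht ha hA, gaugeVec, lap_const_mul _ (hs .E).1]
    field_simp
    ring

/-- The derivative of the prefactor N/H multiplies ψ - ΔE/3 at o, which vanishes, so only the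
velocity contributes. -/
lemma hasDerivAt_clock0_affine (hbg : bg.IsSolution M I) (hI : IsOpen I) (ht : t ∈ I)
    {o w : ScalarPert} (ho : o.IsDecaying) (hw : w.IsDecaying) (h1 : o .psi = fun _ => 0)
    (h2 : o .E = fun _ => 0) (x : Space) :
    HasDerivAt (fun τ => clock0 bg τ (o + (τ - t) • w) x)
      (bg.N t / bg.H t * (w .psi x - lap (w .E) x / 3)) t := by
  have hv := hasVelocity_affine (t := t) ho hw
  have := ((hbg.hasDerivAt_N hI ht).div (hbg.hasDerivAt_H hI ht) (hbg.H_ne_zero t ht)).mul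
    ((hv.val .psi x).sub ((hv.lap .E x).div_const 3))
  refine this.congr_deriv ?_
  simp [h1, h2, lap_zero]

/-- The four gauge conditions determine the four descriptors triangularly: the clocks fix β and ξ,
then the rates fix the shift and the lapse, that is χ_B and χ. Division by H is possible because H ≠
0. -/
theorem isDiracObservable_iff (hbg : bg.IsSolution M I) (hI : IsOpen I) (ht : t ∈ I)
    (hs : s.IsDecaying) (o : ScalarPert) :
    IsDiracObservable M bg t s o ↔ o = flatObservables M bg t s := by
  obtain ⟨a, ha, hA⟩ := hbg.exists_sqrt ht
  have hN := (hbg.N_pos t ht).ne'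
  have hH := hbg.H_ne_zero t ht
  have hZ := (hs .psi).subLapThird (hs .E)
  constructor
  · rintro ⟨⟨xi, beta, chi, chiB, g, hxi, hbeta, hchi, hchiB, hg, hog⟩, hclock,
      w, dl, dlHat, hw, hdl, hdlHat, hflow, hrate⟩
    obtain ⟨hgd, hg⟩ := (isGaugeVector_iff_eq hbg ht ha hA hxi hbeta hchi hchiB).1 hg
    have hod : o.IsDecaying := fun k => by rw [hog]; exact (hs k).add (hgd k)
    have oE : o .E = fun _ => 0 :=
      funext ((hod .E).eq_zero_of_pd_eq_zero fun i x => (hclock x).2 i)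
    have opsi : o .psi = fun _ => 0 := by
      ext x
      have := (hclock x).1
      rw [clock0, oE, lap_zero] at this
      simpa [hN, hH] using this
    -- The vanishing clocks are solved for the descriptors; β comes first because Δβ enters the
    -- equation for ξ.
    have hβ : beta = fun x => -1 * s .E x := by
      ext x
      have := congrFun oE x
      rw [hog, hg] at this
      simp only [Pi.add_apply, gaugeVec] at this
      linarith
    have hξ : xi = fun x => -(bg.N t / bg.H t) * subLapThird (s .psi) (s .E) x := by
      ext x
      have := congrFun opsi x
      rw [hog, hg] at this
      simp only [Pi.add_apply, gaugeVec, hβ, lap_const_mul _ (hs .E).1] at this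
      rw [subLapThird]
      field_simp at this ⊢
      linarith
    have hk : ∀ k, k ≠ .phi → k ≠ .B → o k = flatObservables M bg t s k := fun k h1 h2 => by
      rw [flatObservables_eq_add_gaugeVec (chi := chi) (chiB := chiB) hbg ht ha hA hs h1 h2,
        hog, hg, hξ, hβ]
    have hv := hasVelocity_affine (t := t) hod hw
    have hot : o + (t - t) • w = o := by simp
    rw [linearizedHamiltonAt_iff_velocity hbg hI ht ha hA (by rwa [hot]) hw hv hdl hdlHat,
      hot] at hflow
    have wE : w .E = fun _ => 0 := by
      refine funext ((hw .E).eq_zero_of_pd_eq_zero fun i x => ?_)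
      rw [← (hv.pd .E i x).deriv]
      exact (hrate x).2 i
    have wpsi : ∀ x, w .psi x = 0 := fun x => by
      have := (hrate x).1
      rw [(hasDerivAt_clock0_affine hbg hI ht hod hw opsi oE x).deriv, wE, lap_zero] at this
      simpa [hN, hH] using this
    -- With E = 0 the flow of E is B - 4H p_E, so a vanishing rate determines the shift. The rate of
    -- ψ then determines the lapse below.
    have oB : o .B = fun x => 4 * bg.H t * o .pE x := by
      ext x
      have h1 := congrFun (congrFun hflow .E) x
      simp only [wE, linearFlow, oE] at h1
      linarith
    ext k x
    by_cases h1 : k = .phi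
    · subst h1
      have h2 := wpsi x
      rw [hflow] at h2
      simp only [linearFlow, opsi, oB, lap_const_mul _ (hod .pE).1] at h2
      rw [flatObservables_phi hbg ht ha hA hs, ← hk .pPsi (by simp) (by simp),
        ← hk .pE (by simp) (by simp)]
      have h3 : bg.H t * (o .phi x + 2 * o .pPsi x + 4 / 3 * lap (o .pE) x) = 0 := by linarith
      have := (mul_eq_zero.1 h3).resolve_left hH
      linarith
    by_cases h2 : k = .B
    · subst h2
      rw [flatObservables_B hbg ht ha hA, ← hk .pE (by simp) (by simp), oB]
    · rw [hk k h1 h2]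
  · rintro rfl
    have hod := isDecaying_flatObservables (M := M) (bg := bg) (t := t) hs
    set o := flatObservables M bg t s with ho
    have oE : o .E = fun _ => 0 := rfl
    have opsi : o .psi = fun _ => 0 := rfl
    have hgd : ScalarPert.IsDecaying fun k x => o k x - s k x := fun k => (hod k).sub (hs k)
    have hchi : Decaying fun x => bg.N t * (o .phi x - s .phi x) := (hgd .phi).const_mul _
    have hxi : Decaying fun x => -(bg.N t / bg.H t) * subLapThird (s .psi) (s .E) x :=
      hZ.const_mul _
    have hbeta : Decaying fun x => -1 * s .E x := (hs .E).const_mul _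
    -- The descriptors χ and χ_B shift only φ and B, by χ/N and χ_B, so they are read off from the
    -- difference between the table and s.
    refine ⟨⟨_, _, _, _, fun k x => o k x - s k x, hxi, hbeta, hchi, hgd .B,
      (isGaugeVector_iff_eq hbg ht ha hA hxi hbeta hchi (hgd .B)).2 ⟨hgd, ?_⟩, ?_⟩, fun x => ?_, ?_⟩
    · ext k x
      by_cases h1 : k = .phi
      · subst h1
        simp only [gaugeVec]
        field_simp
      by_cases h2 : k = .B
      · subst h2
        rfl
      rw [ho, flatObservables_eq_add_gaugeVec hbg ht ha hA hs h1 h2, Pi.add_apply, Pi.add_apply,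
        add_sub_cancel_left]
    · ext k x
      simp
    · simp [clock0, clockVec, oE, opsi, lap_zero, pd_const]
    -- Zero multiplier perturbations suffice: they influence only the velocities of φ and B, which
    -- the clock rates do not involve.
    · have hw := isDecaying_linearFlow hbg ht ha hA hod Decaying.zero Decaying.zero
      set w := linearFlow M bg t a o (fun _ => 0) fun _ => 0 with hw_def
      have hv := hasVelocity_affine (t := t) hod hw
      have hot : o + (t - t) • w = o := by simp
      have oB : o .B = fun x => 4 * bg.H t * o .pE x := funext (flatObservables_B hbg ht ha hA)
      have wE : w .E = fun _ => 0 := by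
        ext x
        simp only [hw_def, linearFlow, oB, oE]
        ring
      have wpsi : ∀ x, w .psi x = 0 := fun x => by
        have := flatObservables_phi hbg ht ha hA hs x
        simp only [hw_def, linearFlow, oB, opsi, lap_const_mul _ (hod .pE).1]
        rw [← ho] at this
        rw [this]
        ring
      refine ⟨w, fun _ => 0, fun _ => 0, hw, Decaying.zero, Decaying.zero, ?_, fun x => ⟨?_, ?_⟩⟩
      · rw [linearizedHamiltonAt_iff_velocity hbg hI ht ha hA (by rwa [hot]) hw hv
          Decaying.zero Decaying.zero, hot]
      · rw [(hasDerivAt_clock0_affine hbg hI ht hod hw opsi oE x).deriv, wE, lap_zero, wpsi]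
        simp
      · intro i
        refine (hv.pd .E i x).deriv.trans ?_
        rw [wE]
        exact pd_const_apply i 0 x

end Observables

end

end CosmoPert

namespace CosmoPert

open MeasureTheory Filter Topology

noncomputable section

/-! ### Fields depending smoothly on time -/

section JointSmoothness

variable {I : Set ℝ} {t : ℝ} {F : ℝ × Space → ℝ}

lemma mem_nhds_prod_univ (hI : IsOpen I) (ht : t ∈ I) (x : Space) :
    I ×ˢ (Set.univ : Set Space) ∈ 𝓝 (t, x) :=
  (hI.prod isOpen_univ).mem_nhds ⟨ht, trivial⟩

lemma differentiableAt_of_contDiffOn_prod (hI : IsOpen I) (hF : ContDiffOn ℝ ∞ F (I ×ˢ Set.univ))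
    (ht : t ∈ I) (x : Space) : DifferentiableAt ℝ F (t, x) :=
  (hF.contDiffAt (mem_nhds_prod_univ hI ht x)).differentiableAt (by simp)

lemma pd_slice (hI : IsOpen I) (hF : ContDiffOn ℝ ∞ F (I ×ˢ Set.univ)) (ht : t ∈ I) (i : Fin 3)
    (x : Space) :
    pd i (fun y => F (t, y)) x = fderiv ℝ F (t, x) (0, EuclideanSpace.single i 1) := by
  have h := (differentiableAt_of_contDiffOn_prod hI hF ht x).hasFDerivAt.comp x
    ((hasFDerivAt_const t x).prodMk (hasFDerivAt_id x))
  rw [pd]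
  erw [h.fderiv]
  simp

lemma hasDerivAt_slice (hI : IsOpen I) (hF : ContDiffOn ℝ ∞ F (I ×ˢ Set.univ)) (ht : t ∈ I)
    (x : Space) : HasDerivAt (fun τ => F (τ, x)) (fderiv ℝ F (t, x) (1, 0)) t :=
  HasFDerivAt.comp_hasDerivAt (f := fun τ => (τ, x)) t
    (differentiableAt_of_contDiffOn_prod hI hF ht x).hasFDerivAt
    ((hasDerivAt_id t).prodMk (hasDerivAt_const t x))

lemma contDiffOn_fderiv_apply (hI : IsOpen I) (hF : ContDiffOn ℝ ∞ F (I ×ˢ Set.univ))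
    (v : ℝ × Space) : ContDiffOn ℝ ∞ (fun z => fderiv ℝ F z v) (I ×ˢ Set.univ) :=
  (hF.fderiv_of_isOpen (hI.prod isOpen_univ) (m := ∞) (by simp)).clm_apply contDiffOn_const

lemma contDiffOn_pd_slice (hI : IsOpen I) (hF : ContDiffOn ℝ ∞ F (I ×ˢ Set.univ)) (i : Fin 3) :
    ContDiffOn ℝ ∞ (fun z : ℝ × Space => pd i (fun y => F (z.1, y)) z.2) (I ×ˢ Set.univ) :=
  (contDiffOn_fderiv_apply hI hF (0, EuclideanSpace.single i 1)).congr fun z hz =>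
    pd_slice hI hF hz.1 i z.2

/-- Symmetry of the second derivative on spacetime; applied to one time and one space direction it
interchanges the two kinds of derivative. -/
lemma fderiv_fderiv_apply_comm (hI : IsOpen I) (hF : ContDiffOn ℝ ∞ F (I ×ˢ Set.univ))
    (ht : t ∈ I) (x : Space) (v w : ℝ × Space) :
    fderiv ℝ (fun z => fderiv ℝ F z v) (t, x) w = fderiv ℝ (fun z => fderiv ℝ F z w) (t, x) v := by
  have h := hF.contDiffAt (mem_nhds_prod_univ hI ht x)
  have hd : DifferentiableAt ℝ (fderiv ℝ F) (t, x) :=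
    (h.fderiv_right (m := ∞) (by simp)).differentiableAt (by simp)
  rw [fderiv_clm_apply hd (differentiableAt_const _), fderiv_clm_apply hd (differentiableAt_const _)]
  simpa using (h.isSymmSndFDerivAt (by
    rw [minSmoothness_of_isRCLikeNormedField]; exact ENat.LEInfty.out)).eq w v

/-- Time derivatives commute with spatial derivatives. -/
lemma hasDerivAt_pd_slice (hI : IsOpen I) (hF : ContDiffOn ℝ ∞ F (I ×ˢ Set.univ)) (ht : t ∈ I)
    (i : Fin 3) (x : Space) :
    HasDerivAt (fun τ => pd i (fun y => F (τ, y)) x)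
      (pd i (fun y => deriv (fun τ => F (τ, y)) t) x) t := by
  have h1 := hasDerivAt_slice hI (contDiffOn_fderiv_apply hI hF (0, EuclideanSpace.single i 1)) ht x
  have h2 : (fun τ => pd i (fun y => F (τ, y)) x) =ᶠ[𝓝 t]
      fun τ => fderiv ℝ F (τ, x) (0, EuclideanSpace.single i 1) := by
    filter_upwards [hI.mem_nhds ht] with τ hτ
    exact pd_slice hI hF hτ i x
  refine (h1.congr_of_eventuallyEq h2).congr_deriv ?_
  rw [fderiv_fderiv_apply_comm hI hF ht, ← pd_slice hI (contDiffOn_fderiv_apply hI hF (1, 0)) ht]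
  congr 1
  ext y
  exact (hasDerivAt_slice hI hF ht y).deriv.symm

end JointSmoothness

/-- Smooth functions of time and space which decay, together with their time derivative, at each
time in `I`. -/
structure IsAdmissibleField (I : Set ℝ) (f : ℝ → Space → ℝ) : Prop where
  smooth : ContDiffOn ℝ ∞ (fun z : ℝ × Space => f z.1 z.2) (I ×ˢ Set.univ)
  decaying : ∀ t ∈ I, Decaying (f t)
  decaying_deriv : ∀ t ∈ I, Decaying fun x => deriv (fun τ => f τ x) t

lemma isAdmissibleCurve_iff {I : Set ℝ} {s : ℝ → ScalarPert} :
    IsAdmissibleCurve I s ↔ ∀ k, IsAdmissibleField I fun t => s t k :=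
  ⟨fun h k => ⟨h.1 k, fun t ht => (h.2 t ht).1 k, fun t ht => (h.2 t ht).2 k⟩, fun h =>
    ⟨fun k => (h k).smooth, fun t ht => ⟨fun k => (h k).decaying t ht,
      fun k => (h k).decaying_deriv t ht⟩⟩⟩

namespace IsAdmissibleField

variable {I : Set ℝ} {t : ℝ} {f g : ℝ → Space → ℝ} {c : ℝ → ℝ}

lemma hasDerivAt (hI : IsOpen I) (hf : IsAdmissibleField I f) (ht : t ∈ I) (x : Space) :
    HasDerivAt (fun τ => f τ x) (deriv (fun τ => f τ x) t) t :=
  (hasDerivAt_slice hI hf.smooth ht x).differentiableAt.hasDerivAt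

lemma hasDerivAt_pd (hI : IsOpen I) (hf : IsAdmissibleField I f) (ht : t ∈ I) (i : Fin 3)
    (x : Space) :
    HasDerivAt (fun τ => pd i (f τ) x) (pd i (fun y => deriv (fun τ => f τ y) t) x) t :=
  hasDerivAt_pd_slice hI hf.smooth ht i x

lemma hasDerivAt_pd_pd (hI : IsOpen I) (hf : IsAdmissibleField I f) (ht : t ∈ I) (i j : Fin 3)
    (x : Space) : HasDerivAt (fun τ => CosmoPert.pd i (CosmoPert.pd j (f τ)) x)
      (CosmoPert.pd i (CosmoPert.pd j (fun y => deriv (fun τ => f τ y) t)) x) t := by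
  refine (hasDerivAt_pd_slice hI (contDiffOn_pd_slice hI hf.smooth j) ht i x).congr_deriv ?_
  congr 1
  ext y
  exact (hf.hasDerivAt_pd hI ht j y).deriv

lemma hasDerivAt_lap (hI : IsOpen I) (hf : IsAdmissibleField I f) (ht : t ∈ I) (x : Space) :
    HasDerivAt (fun τ => CosmoPert.lap (f τ) x)
      (CosmoPert.lap (fun y => deriv (fun τ => f τ y) t) x) t := by
  rw [lap_eq (hf.decaying_deriv t ht).1]
  refine (HasDerivAt.fun_sum fun i _ => hf.hasDerivAt_pd_pd hI ht i i x).congr_of_eventuallyEq ?_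
  filter_upwards [hI.mem_nhds ht] with τ hτ
  rw [lap_eq (hf.decaying τ hτ).1]

lemma congr (hI : IsOpen I) (hf : IsAdmissibleField I f) (h : ∀ t ∈ I, g t = f t) :
    IsAdmissibleField I g where
  smooth := hf.smooth.congr fun z hz => by rw [h z.1 hz.1]
  decaying t ht := h t ht ▸ hf.decaying t ht
  decaying_deriv t ht := by
    convert hf.decaying_deriv t ht using 2 with x
    refine Filter.EventuallyEq.deriv_eq ?_
    filter_upwards [hI.mem_nhds ht] with τ hτ
    rw [h τ hτ]

lemma zero : IsAdmissibleField I fun _ _ => 0 where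
  smooth := contDiffOn_const
  decaying _ _ := Decaying.zero
  decaying_deriv t _ := by
    simp only [deriv_const]
    exact Decaying.zero

lemma add (hI : IsOpen I) (hf : IsAdmissibleField I f) (hg : IsAdmissibleField I g) :
    IsAdmissibleField I fun t x => f t x + g t x where
  smooth := hf.smooth.add hg.smooth
  decaying t ht := (hf.decaying t ht).add (hg.decaying t ht)
  decaying_deriv t ht := by
    convert (hf.decaying_deriv t ht).add (hg.decaying_deriv t ht) using 2 with x
    exact ((hf.hasDerivAt hI ht x).add (hg.hasDerivAt hI ht x)).deriv

/-- The time derivative c'f + cf' decays because decay is required of both the field and its time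
derivative. -/
lemma coeff_mul (hI : IsOpen I) (hc : ContDiffOn ℝ ∞ c I) (hf : IsAdmissibleField I f) :
    IsAdmissibleField I fun t x => c t * f t x where
  smooth := (hc.comp contDiffOn_fst fun _ hz => hz.1).mul hf.smooth
  decaying t ht := (hf.decaying t ht).const_mul _
  decaying_deriv t ht := by
    convert ((hf.decaying t ht).const_mul (deriv c t)).add
      ((hf.decaying_deriv t ht).const_mul (c t)) using 2 with x
    have h1 := ((hc.contDiffAt (hI.mem_nhds ht)).differentiableAt (by simp)).hasDerivAt
    exact (h1.mul (hf.hasDerivAt hI ht x)).deriv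

lemma sub (hI : IsOpen I) (hf : IsAdmissibleField I f) (hg : IsAdmissibleField I g) :
    IsAdmissibleField I fun t x => f t x - g t x :=
  (hf.add hI (hg.coeff_mul hI (c := fun _ => -1) contDiffOn_const)).congr hI fun t _ => by
    ext x
    ring

lemma lap (hI : IsOpen I) (hf : IsAdmissibleField I f) :
    IsAdmissibleField I fun t => CosmoPert.lap (f t) where
  smooth := by
    refine ContDiffOn.congr (f := fun z : ℝ × Space => ∑ i, pd i (pd i (f z.1)) z.2)
      (ContDiffOn.sum fun i _ => ?_) fun z hz => ?_
    · exact contDiffOn_pd_slice hI (contDiffOn_pd_slice hI hf.smooth i) i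
    · rw [lap_eq (hf.decaying z.1 hz.1).1]
  decaying t ht := (hf.decaying t ht).lap
  decaying_deriv t ht := by
    convert (hf.decaying_deriv t ht).lap using 2 with x
    exact (hf.hasDerivAt_lap hI ht x).deriv

end IsAdmissibleField

lemma IsAdmissibleCurve.hasVelocity {I : Set ℝ} (hI : IsOpen I) {s : ℝ → ScalarPert}
    (hs : IsAdmissibleCurve I s) {t : ℝ} (ht : t ∈ I) : HasVelocity s (dt s t) t := by
  rw [isAdmissibleCurve_iff] at hs
  exact ⟨fun k => (hs k).hasDerivAt hI ht, fun k => (hs k).hasDerivAt_pd hI ht,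
    fun k => (hs k).hasDerivAt_pd_pd hI ht, fun k => (hs k).hasDerivAt_lap hI ht⟩

/-! ### Smooth background coefficients and admissibility of the observables -/

namespace Background.IsSolution

variable {M : Model} {bg : Background} {I : Set ℝ}

lemma contDiffOn_rpow (h : bg.IsSolution M I) : ContDiffOn ℝ ∞ (fun t => bg.A t ^ (3 / 2 : ℝ)) I :=
  h.A_smooth.rpow_const_of_ne fun t ht => (h.A_pos t ht).ne'

lemma contDiffOn_Pt (h : bg.IsSolution M I) (hI : IsOpen I) : ContDiffOn ℝ ∞ bg.Pt I :=
  (contDiffOn_deriv_of_isOpen hI h.A_smooth).neg.div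
    (h.N_smooth.mul (h.A_smooth.sqrt fun t ht => (h.A_pos t ht).ne')) fun t ht =>
      mul_ne_zero (h.N_pos t ht).ne' (Real.sqrt_pos.2 (h.A_pos t ht)).ne'

lemma contDiffOn_p (h : bg.IsSolution M I) : ContDiffOn ℝ ∞ (bg.p M) I :=
  (((contDiffOn_const.div (h.A_smooth.pow 3) fun t ht => pow_ne_zero 3 (h.A_pos t ht).ne').mul
    (h.piPhi_smooth.pow 2)).sub ((M.V_smooth.comp_contDiffOn h.phi_smooth).div_const _)).div_const _

lemma contDiffOn_deriv_V (h : bg.IsSolution M I) :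
    ContDiffOn ℝ ∞ (fun t => deriv M.V (bg.phi t)) I :=
  (contDiff_infty_iff_deriv.1 M.V_smooth).2.comp_contDiffOn h.phi_smooth

end Background.IsSolution

section

variable {M : Model} {bg : Background} {I : Set ℝ} {s : ℝ → ScalarPert}

lemma isAdmissibleField_bardeenPsi (hbg : bg.IsSolution M I) (hI : IsOpen I)
    (hs : ∀ k, IsAdmissibleField I fun t => s t k) :
    IsAdmissibleField I fun t => bardeenPsi bg t (s t) := by
  have hc : ContDiffOn ℝ ∞ (fun t => 4 * bg.H t ^ 2 * bg.A t / bg.N t ^ 2) I :=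
    ((contDiffOn_const.mul ((hbg.contDiffOn_H hI).pow 2)).mul hbg.A_smooth).div
      (hbg.N_smooth.pow 2) fun t ht => pow_ne_zero 2 (hbg.N_pos t ht).ne'
  refine ((((hs .psi).add hI (((hs .E).add hI (hs .pE)).coeff_mul hI hc)).sub hI
    (((hs .E).lap hI).coeff_mul hI (c := fun _ => 1 / 3) contDiffOn_const))).congr hI fun t _ => ?_
  ext x
  rw [bardeenPsi]
  ring

lemma isAdmissibleField_upsilon (hbg : bg.IsSolution M I) (hI : IsOpen I)
    (hs : ∀ k, IsAdmissibleField I fun t => s t k) :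
    IsAdmissibleField I fun t => upsilon M bg t (s t) := by
  have hc : ContDiffOn ℝ ∞ (fun t => bg.H t ^ 2 * bg.A t / bg.N t ^ 2
      + M.kappa * bg.A t / 2 * bg.p M t) I :=
    ((((hbg.contDiffOn_H hI).pow 2).mul hbg.A_smooth).div (hbg.N_smooth.pow 2) fun t ht =>
      pow_ne_zero 2 (hbg.N_pos t ht).ne').add
      (((contDiffOn_const.mul hbg.A_smooth).div_const 2).mul hbg.contDiffOn_p)
  refine (((((hs .pPsi).add hI (((hs .E).lap hI).coeff_mul hI (c := fun _ => 1 / 2)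
    contDiffOn_const)).add hI (((hs .pE).lap hI).coeff_mul hI (c := fun _ => 2 / 3)
    contDiffOn_const)).sub hI (((hs .E).add hI (hs .pE)).coeff_mul hI hc))).congr hI fun t _ => ?_
  ext x
  rw [upsilon]
  ring

/-- The observables of an admissible curve form an admissible curve. -/
lemma isAdmissibleCurve_flatObservables (hbg : bg.IsSolution M I) (hI : IsOpen I)
    (hs : IsAdmissibleCurve I s) : IsAdmissibleCurve I fun t => flatObservables M bg t (s t) := by
  rw [isAdmissibleCurve_iff] at hs ⊢
  have hΨ := isAdmissibleField_bardeenPsi hbg hI hs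
  have hΥ := isAdmissibleField_upsilon hbg hI hs
  have hZ := (hs .psi).sub hI (((hs .E).lap hI).coeff_mul hI (c := fun _ => 1 / 3) contDiffOn_const)
  have hN := hbg.N_smooth
  have hH := hbg.contDiffOn_H hI
  have hA := hbg.A_smooth
  have hp := hbg.contDiffOn_p
  have hr := hbg.contDiffOn_rpow
  have hπ := hbg.piPhi_smooth
  have hV := hbg.contDiffOn_deriv_V
  have hH0 := hbg.H_ne_zero
  have hA0 : ∀ t ∈ I, bg.A t ≠ 0 := fun t ht => (hbg.A_pos t ht).ne'
  have hr0 : ∀ t ∈ I, bg.A t ^ (3 / 2 : ℝ) ≠ 0 := fun t ht =>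
    (Real.rpow_pos_of_pos (hbg.A_pos t ht) _).ne'
  have hP0 : ∀ t ∈ I, bg.Pt t ≠ 0 := fun t ht => hbg.Pt_ne_zero ht
  have hP : ContDiffOn ℝ ∞ (fun t => 1 / bg.Pt t ^ 2) I := contDiffOn_const.div
    ((hbg.contDiffOn_Pt hI).pow 2) fun t ht => pow_ne_zero 2 (hP0 t ht)
  have hQ : ContDiffOn ℝ ∞ (fun t => M.kappa * (1 / bg.Pt t ^ 2) * bg.A t * bg.p M t) I :=
    ((contDiffOn_const.mul hP).mul hA).mul hp
  intro k
  cases k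
  case psi | E => exact IsAdmissibleField.zero
  case pPsi =>
    refine ((hΥ.add hI (hΨ.coeff_mul hI ((contDiffOn_const (c := (1 / 4 : ℝ))).add
      ((contDiffOn_const (c := (1 / 2 : ℝ))).mul hQ)))).sub hI ((hΨ.lap hI).coeff_mul hI
      ((contDiffOn_const (c := (2 / 3 : ℝ))).mul hP))).congr hI fun t _ => ?_
    ext x
    simp only [flatObservables]
    ring
  case pE =>
    refine (hΨ.coeff_mul hI hP).congr hI fun t _ => ?_
    ext x
    simp only [flatObservables]
    ring
  case phi =>
    refine ((hΥ.coeff_mul hI (c := fun _ => -2) contDiffOn_const).sub hI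
      (hΨ.coeff_mul hI ((contDiffOn_const (c := (1 / 2 : ℝ))).add hQ))).congr hI fun t _ => ?_
    ext x
    simp only [flatObservables]
    ring
  case pPhi => exact hs .pPhi
  case B =>
    exact hΨ.coeff_mul hI ((hN.pow 2).div (hA.mul hH) fun t ht => mul_ne_zero (hA0 t ht) (hH0 t ht))
  case pB => exact hs .pB
  case dphi =>
    refine ((hs .dphi).sub hI (hZ.coeff_mul hI (((contDiffOn_const (c := M.lam)).div (hr.mul hH)
      fun t ht => mul_ne_zero (hr0 t ht) (hH0 t ht)).mul hN |>.mul hπ))).congr hI fun t _ => ?_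
    ext x
    simp only [flatObservables, Pi.div_apply]
    ring
  case dpi =>
    refine (((hs .dpi).sub hI (((hs .E).lap hI).coeff_mul hI hπ)).add hI (hZ.coeff_mul hI
      (((contDiffOn_const (c := (1 / 2 : ℝ))).mul (hr.div_const M.lam)).mul hV |>.mul
        (hN.div hH hH0)))).congr hI fun t _ => ?_
    ext x
    simp only [flatObservables, Pi.div_apply]
    ring

end

end

end CosmoPert

namespace CosmoPert

open MeasureTheory Filter Topology

noncomputable section

/-! ### Evolution of the observables -/

section Evolution

variable {M : Model} {bg : Background} {I : Set ℝ} {t a : ℝ}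

/-- The original lapse perturbation is absent from its own observable, so differentiating it in time
never involves the arbitrary multiplier δλ. -/
lemma flatObservables_phi_explicit (hbg : bg.IsSolution M I) (ht : t ∈ I) (ha : 0 < a)
    (hA : bg.A t = a ^ 2) {s : ScalarPert} (hs : s.IsDecaying) (x : Space) :
    flatObservables M bg t s .phi x = -2 * s .pPsi x - lap (s .E) x - 4 / 3 * lap (s .pE) x
      - (1 / 2 + M.kappa * bg.N t ^ 2 * bg.p M t / (4 * bg.H t ^ 2))
        * subLapThird (s .psi) (s .E) x := by
  have hH := hbg.H_ne_zero t ht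
  rw [flatObservables_phi hbg ht ha hA hs, flatObservables_pPsi hbg ht ha hA hs,
    lap_flatObservables_pE hbg ht ha hA hs]
  field_simp
  ring

lemma lap_flatObservables_phi (hbg : bg.IsSolution M I) (ht : t ∈ I) (ha : 0 < a)
    (hA : bg.A t = a ^ 2) {s : ScalarPert} (hs : s.IsDecaying) (x : Space) :
    lap (flatObservables M bg t s .phi) x = -2 * lap (s .pPsi) x - lap (lap (s .E)) x
      - 4 / 3 * lap (lap (s .pE)) x
      - (1 / 2 + M.kappa * bg.N t ^ 2 * bg.p M t / (4 * bg.H t ^ 2))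
        * lap (subLapThird (s .psi) (s .E)) x := by
  have h1 := (hs .pPsi).1
  have h2 := (hs .E).lap.1
  have h3 := (hs .pE).lap.1
  have h4 := ((hs .psi).subLapThird (hs .E)).1
  rw [funext (flatObservables_phi_explicit (M := M) hbg ht ha hA hs),
    lap_sub (by fun_prop) (by fun_prop), lap_sub (by fun_prop) (by fun_prop),
    lap_sub (by fun_prop) (by fun_prop), lap_const_mul _ h1, lap_const_mul _ h3,
    lap_const_mul _ h4]

lemma linearFlow_E_lap {s : ScalarPert} (hs : s.IsDecaying) (dl dlHat : Space → ℝ) (x : Space) :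
    lap (linearFlow M bg t a s dl dlHat .E) x =
      lap (s .B) x - 4 * bg.H t * (lap (s .E) x + lap (s .pE) x) := by
  have h1 := (hs .B).1
  have h2 := (hs .E).1
  have h3 := (hs .pE).1
  simp only [linearFlow]
  rw [lap_sub (by fun_prop) (by fun_prop), lap_const_mul _ (by fun_prop), lap_add h2 h3]

/-- The shift enters ψ' through ΔB/3 and E' through B, so it cancels in the rate of ψ - ΔE/3. -/
lemma subLapThird_linearFlow {s : ScalarPert} (hs : s.IsDecaying) (dl dlHat : Space → ℝ) :
    subLapThird (linearFlow M bg t a s dl dlHat .psi) (linearFlow M bg t a s dl dlHat .E) =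
      fun x => bg.H t * (s .phi x - s .psi x + 2 * s .pPsi x
        + 4 / 3 * (lap (s .E) x + lap (s .pE) x)) := by
  ext x
  rw [subLapThird, linearFlow_E_lap hs]
  simp only [linearFlow]
  ring

lemma lap_subLapThird_linearFlow {s : ScalarPert} (hs : s.IsDecaying) (dl dlHat : Space → ℝ)
    (x : Space) :
    lap (subLapThird (linearFlow M bg t a s dl dlHat .psi) (linearFlow M bg t a s dl dlHat .E)) x =
      bg.H t * (lap (s .phi) x - lap (subLapThird (s .psi) (s .E)) x + 2 * lap (s .pPsi) x
        + lap (lap (s .E)) x + 4 / 3 * lap (lap (s .pE)) x) := by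
  have h1 := (hs .phi).1
  have h2 := (hs .psi).1
  have h3 := (hs .pPsi).1
  have h4 := (hs .E).lap.1
  have h5 := (hs .pE).lap.1
  have e : subLapThird (s .psi) (s .E) = fun x => s .psi x - 1 / 3 * lap (s .E) x := by
    ext y
    rw [subLapThird]
    ring
  rw [subLapThird_linearFlow hs, e, lap_const_mul _ (by fun_prop), lap_add (by fun_prop) (by fun_prop),
    lap_const_mul _ (by fun_prop), lap_add h4 h5, lap_add (by fun_prop) (by fun_prop),
    lap_sub h1 h2, lap_const_mul _ h3, lap_sub h2 (by fun_prop), lap_const_mul _ h4]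
  ring

lemma Background.IsSolution.hasDerivAt_deriv_V (hbg : bg.IsSolution M I) (hI : IsOpen I)
    (ht : t ∈ I) (ha : 0 < a) (hA : bg.A t = a ^ 2) :
    HasDerivAt (fun τ => deriv M.V (bg.phi τ))
      (deriv (deriv M.V) (bg.phi t) * (M.lam * bg.N t / a ^ 3 * bg.piPhi t)) t := by
  have h := ((contDiff_infty_iff_deriv.1 M.V_smooth).2.differentiable (by simp) (bg.phi t)).hasDerivAt
  exact h.comp t (hbg.hasDerivAt_phi hI ht ha hA)

/-- The time derivative of the pressure. -/
lemma Background.IsSolution.hasDerivAt_p (hbg : bg.IsSolution M I) (hI : IsOpen I)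
    (ht : t ∈ I) (ha : 0 < a) (hA : bg.A t = a ^ 2) :
    HasDerivAt (bg.p M) (-3 * bg.H t * M.lam * bg.piPhi t ^ 2 / a ^ 6
      - bg.N t * bg.piPhi t * deriv M.V (bg.phi t) / a ^ 3) t := by
  have hl := M.lam_ne_zero
  have h := ((M.V_smooth.differentiable (by simp) (bg.phi t)).hasDerivAt).comp t
    (hbg.hasDerivAt_phi hI ht ha hA)
  have hA3 : bg.A t ^ 3 ≠ 0 := pow_ne_zero 3 (hbg.A_pos t ht).ne'
  have := (((((hasDerivAt_const t M.lam).fun_div ((hbg.hasDerivAt_A hI ht).fun_pow 3) hA3).fun_mul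
    ((hbg.hasDerivAt_piPhi hI ht ha hA).fun_pow 2)).fun_sub (h.div_const M.lam)).div_const 2)
  refine this.congr_deriv ?_
  rw [hA]
  field_simp
  ring

variable {s : ℝ → ScalarPert} {dl dlHat : Space → ℝ}

lemma hasDerivAt_subLapThird (hI : IsOpen I) (ht : t ∈ I) (hs : IsAdmissibleCurve I s)
    (hflow : dt s t = linearFlow M bg t a (s t) dl dlHat) (x : Space) :
    HasDerivAt (fun τ => subLapThird (s τ .psi) (s τ .E) x)
      (bg.H t * (s t .phi x - s t .psi x + 2 * s t .pPsi x
        + 4 / 3 * (lap (s t .E) x + lap (s t .pE) x))) t := by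
  have hv := hs.hasVelocity hI ht
  have := (hv.val .psi x).sub ((hv.lap .E x).div_const 3)
  refine this.congr_deriv ?_
  have h := congrFun (subLapThird_linearFlow (M := M) (bg := bg) (t := t) (a := a)
    (hs.2 t ht).1 dl dlHat) x
  rwa [subLapThird, ← hflow] at h

lemma hasDerivAt_lap_subLapThird (hI : IsOpen I) (ht : t ∈ I) (hs : IsAdmissibleCurve I s)
    (hflow : dt s t = linearFlow M bg t a (s t) dl dlHat) (x : Space) :
    HasDerivAt (fun τ => lap (subLapThird (s τ .psi) (s τ .E)) x)
      (bg.H t * (lap (s t .phi) x - lap (subLapThird (s t .psi) (s t .E)) x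
        + 2 * lap (s t .pPsi) x + lap (lap (s t .E)) x + 4 / 3 * lap (lap (s t .pE)) x)) t := by
  have hs' := isAdmissibleCurve_iff.1 hs
  have hZ : IsAdmissibleField I fun τ => subLapThird (s τ .psi) (s τ .E) :=
    ((hs' .psi).sub hI (((hs' .E).lap hI).coeff_mul hI (c := fun _ => 1 / 3)
      contDiffOn_const)).congr hI fun τ _ => by
        ext y
        rw [subLapThird]
        ring
  refine (hZ.hasDerivAt_lap hI ht x).congr_deriv ?_
  rw [← lap_subLapThird_linearFlow (M := M) (bg := bg) (t := t) (a := a) (hs.2 t ht).1 dl dlHat,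
    subLapThird_linearFlow (hs.2 t ht).1]
  congr 1
  ext y
  exact (hasDerivAt_subLapThird hI ht hs hflow y).deriv

/-- The gauge-dependent lapse and shift cancel between p_E, E and the rate of ψ - ΔE/3, leaving the
flow evaluated at the observables. Constraints are not needed, here or for p_ψ, δφ and δπ below. -/
lemma hasDerivAt_flatObservables_pE (hbg : bg.IsSolution M I) (hI : IsOpen I) (ht : t ∈ I)
    (ha : 0 < a) (hA : bg.A t = a ^ 2) (hs : IsAdmissibleCurve I s)
    (hflow : dt s t = linearFlow M bg t a (s t) dl dlHat) (x : Space) :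
    HasDerivAt (fun τ => flatObservables M bg τ (s τ) .pE x)
      ((M.kappa * bg.N t ^ 2 * bg.p M t / (4 * bg.H t) - 3 / 2 * bg.H t)
          * flatObservables M bg t (s t) .pE x
        - bg.N t ^ 2 / (4 * a ^ 2 * bg.H t) * flatObservables M bg t (s t) .phi x) t := by
  have hN := (hbg.N_pos t ht).ne'
  have hH := hbg.H_ne_zero t ht
  have hv := hs.hasVelocity hI ht
  have hden : 4 * bg.A t * bg.H t ^ 2 ≠ 0 :=
    mul_ne_zero (mul_ne_zero four_ne_zero (hbg.A_pos t ht).ne') (pow_ne_zero 2 hH)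
  have h1 := ((hv.val .pE x).fun_add (hv.val .E x)).fun_add
    ((((hbg.hasDerivAt_N hI ht).fun_pow 2).fun_div
      (((hbg.hasDerivAt_A hI ht).const_mul 4).fun_mul ((hbg.hasDerivAt_H hI ht).fun_pow 2))
      hden).fun_mul
      (hasDerivAt_subLapThird hI ht hs hflow x))
  refine (h1.congr_of_eventuallyEq ?_).congr_deriv ?_
  · filter_upwards [hI.mem_nhds ht] with τ hτ
    obtain ⟨b, hb, hB⟩ := hbg.exists_sqrt hτ
    rw [flatObservables_pE hbg hτ hb hB, hB]
  · rw [flatObservables_pE hbg ht ha hA, flatObservables_phi_explicit hbg ht ha hA (hs.2 t ht).1,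
      hflow, hA]
    simp only [linearFlow, subLapThird]
    field_simp
    ring

lemma hasDerivAt_flatObservables_pPsi (hbg : bg.IsSolution M I) (hI : IsOpen I) (ht : t ∈ I)
    (ha : 0 < a) (hA : bg.A t = a ^ 2) (hs : IsAdmissibleCurve I s)
    (hflow : dt s t = linearFlow M bg t a (s t) dl dlHat) (x : Space) :
    HasDerivAt (fun τ => flatObservables M bg τ (s τ) .pPsi x)
      ((M.kappa * bg.N t ^ 2 * bg.p M t / (4 * bg.H t) - bg.H t / 2)
          * flatObservables M bg t (s t) .pPsi x
        - (bg.H t / 4 + M.kappa * bg.N t ^ 2 * bg.p M t / (8 * bg.H t))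
          * flatObservables M bg t (s t) .phi x
        - M.kappa * bg.N t ^ 2 / (8 * bg.H t)
          * matterSource M bg t a (flatObservables M bg t (s t)) x
        + bg.N t ^ 2 / (6 * a ^ 2 * bg.H t) * lap (flatObservables M bg t (s t) .phi) x
        + 2 / 3 * bg.H t * lap (flatObservables M bg t (s t) .pE) x) t := by
  have hN := (hbg.N_pos t ht).ne'
  have hH := hbg.H_ne_zero t ht
  have hκ := M.kappa_pos.ne'
  have hl := M.lam_ne_zero
  have hv := hs.hasVelocity hI ht
  have hd := (hs.2 t ht).1
  have hden : 6 * bg.A t * bg.H t ^ 2 ≠ 0 :=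
    mul_ne_zero (mul_ne_zero (by norm_num) (hbg.A_pos t ht).ne') (pow_ne_zero 2 hH)
  have hden' : 8 * bg.H t ^ 2 ≠ 0 := mul_ne_zero (by norm_num) (pow_ne_zero 2 hH)
  have hN2 := (hbg.hasDerivAt_N hI ht).fun_pow 2
  have hH2 := (hbg.hasDerivAt_H hI ht).fun_pow 2
  have h1 := (((hv.val .pPsi x).fun_sub ((hv.lap .E x).div_const 6)).fun_add
    ((((((hN2.const_mul M.kappa).fun_mul (hbg.hasDerivAt_p hI ht ha hA)).fun_div
      (hH2.const_mul 8) hden')).const_add (1 / 4)).fun_mul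
      (hasDerivAt_subLapThird hI ht hs hflow x))).fun_sub
    ((hN2.fun_div (((hbg.hasDerivAt_A hI ht).const_mul 6).fun_mul hH2) hden).fun_mul
      (hasDerivAt_lap_subLapThird hI ht hs hflow x))
  refine (h1.congr_of_eventuallyEq ?_).congr_deriv ?_
  · filter_upwards [hI.mem_nhds ht] with τ hτ
    obtain ⟨b, hb, hB⟩ := hbg.exists_sqrt hτ
    rw [flatObservables_pPsi hbg hτ hb hB (hs.2 τ hτ).1, hB]
  · rw [matterSource, flatObservables_pPsi hbg ht ha hA hd,
      flatObservables_phi_explicit hbg ht ha hA hd, lap_flatObservables_phi hbg ht ha hA hd,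
      lap_flatObservables_pE hbg ht ha hA hd, flatObservables_dphi ha hA,
      flatObservables_dpi hbg ht ha hA, hflow, linearFlow_E_lap hd, hA]
    -- Trading ψ for Z = ψ - ΔE/3 makes the remaining functions independent, as Z and ΔZ occur on
    -- both sides; p is eliminated by the Friedmann constraint.
    have hZ : s t .psi x = subLapThird (s t .psi) (s t .E) x + lap (s t .E) x / 3 := by
      rw [subLapThird]
      ring
    simp only [linearFlow, matterSource, hZ, hbg.p_eq ht ha hA]
    field_simp
    ring

lemma hasDerivAt_flatObservables_dphi (hbg : bg.IsSolution M I) (hI : IsOpen I) (ht : t ∈ I)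
    (ha : 0 < a) (hA : bg.A t = a ^ 2) (hs : IsAdmissibleCurve I s)
    (hflow : dt s t = linearFlow M bg t a (s t) dl dlHat) (x : Space) :
    HasDerivAt (fun τ => flatObservables M bg τ (s τ) .dphi x)
      (bg.N t * M.lam / a ^ 3 * (flatObservables M bg t (s t) .dpi x
        + bg.piPhi t * flatObservables M bg t (s t) .phi x)) t := by
  have hN := (hbg.N_pos t ht).ne'
  have hH := hbg.H_ne_zero t ht
  have hl := M.lam_ne_zero
  have hv := hs.hasVelocity hI ht
  have hsq : Real.sqrt (bg.A t) = a := by rw [hA, Real.sqrt_sq ha.le]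
  have hden : Real.sqrt (bg.A t) ^ 3 * bg.H t ≠ 0 := by
    rw [hsq]
    exact mul_ne_zero (pow_ne_zero 3 ha.ne') hH
  have h1 := (hv.val .dphi x).fun_sub ((((((hbg.hasDerivAt_N hI ht).const_mul M.lam).fun_mul
    (hbg.hasDerivAt_piPhi hI ht ha hA)).fun_div
    (((hbg.hasDerivAt_sqrt_A hI ht ha hA).fun_pow 3).fun_mul (hbg.hasDerivAt_H hI ht)) hden)).fun_mul
    (hasDerivAt_subLapThird hI ht hs hflow x))
  refine (h1.congr_of_eventuallyEq ?_).congr_deriv ?_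
  · filter_upwards [hI.mem_nhds ht] with τ hτ
    rw [flatObservables_dphi (Real.sqrt_pos.2 (hbg.A_pos τ hτ))
      (Real.sq_sqrt (hbg.A_pos τ hτ).le).symm]
  · rw [flatObservables_dpi hbg ht ha hA, flatObservables_phi_explicit hbg ht ha hA (hs.2 t ht).1,
      hflow, hsq]
    simp only [linearFlow, subLapThird]
    field_simp
    ring

lemma lap_flatObservables_dphi (ha : 0 < a) (hA : bg.A t = a ^ 2) {s : ScalarPert} (hs : s.IsDecaying) (x : Space) :
    lap (flatObservables M bg t s .dphi) x = lap (s .dphi) x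
      - M.lam * bg.N t * bg.piPhi t / (a ^ 3 * bg.H t) * lap (subLapThird (s .psi) (s .E)) x := by
  have hZ := (hs .psi).subLapThird (hs .E)
  rw [funext (flatObservables_dphi (M := M) (s := s) ha hA),
    lap_sub (hs .dphi).1 (hZ.const_mul _).1, lap_const_mul _ hZ.1]

lemma hasDerivAt_flatObservables_dpi (hbg : bg.IsSolution M I) (hI : IsOpen I) (ht : t ∈ I)
    (ha : 0 < a) (hA : bg.A t = a ^ 2) (hs : IsAdmissibleCurve I s)
    (hflow : dt s t = linearFlow M bg t a (s t) dl dlHat) (x : Space) :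
    HasDerivAt (fun τ => flatObservables M bg τ (s τ) .dpi x)
      (-(bg.N t * a ^ 3 / (2 * M.lam))
          * (deriv (deriv M.V) (bg.phi t) * flatObservables M bg t (s t) .dphi x
            + deriv M.V (bg.phi t) * flatObservables M bg t (s t) .phi x)
        + bg.N t * a / M.lam * lap (flatObservables M bg t (s t) .dphi) x
        + 4 * bg.H t * bg.piPhi t * lap (flatObservables M bg t (s t) .pE) x) t := by
  have hN := (hbg.N_pos t ht).ne'
  have hH := hbg.H_ne_zero t ht
  have hl := M.lam_ne_zero
  have hd := (hs.2 t ht).1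
  have hv := hs.hasVelocity hI ht
  have hsq : Real.sqrt (bg.A t) = a := by rw [hA, Real.sqrt_sq ha.le]
  have hden : 2 * M.lam * bg.H t ≠ 0 := mul_ne_zero (mul_ne_zero two_ne_zero hl) hH
  have h1 := ((hv.val .dpi x).fun_sub ((hbg.hasDerivAt_piPhi hI ht ha hA).fun_mul
    (hv.lap .E x))).fun_add ((((((hbg.hasDerivAt_sqrt_A hI ht ha hA).fun_pow 3).fun_mul
      (hbg.hasDerivAt_deriv_V hI ht ha hA)).fun_mul (hbg.hasDerivAt_N hI ht)).fun_div
      ((hbg.hasDerivAt_H hI ht).const_mul (2 * M.lam)) hden).fun_mul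
    (hasDerivAt_subLapThird hI ht hs hflow x))
  refine (h1.congr_of_eventuallyEq ?_).congr_deriv ?_
  · filter_upwards [hI.mem_nhds ht] with τ hτ
    rw [flatObservables_dpi hbg hτ (Real.sqrt_pos.2 (hbg.A_pos τ hτ))
      (Real.sq_sqrt (hbg.A_pos τ hτ).le).symm]
  · rw [lap_flatObservables_dphi ha hA hd, lap_flatObservables_pE hbg ht ha hA hd,
      flatObservables_dphi ha hA, flatObservables_phi_explicit hbg ht ha hA hd,
      hflow, linearFlow_E_lap hd, hsq]
    have hZ : s t .psi x = subLapThird (s t .psi) (s t .E) x + lap (s t .E) x / 3 := by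
      rw [subLapThird]
      ring
    simp only [linearFlow, hZ]
    field_simp
    ring

end Evolution

end

end CosmoPert

namespace CosmoPert

open MeasureTheory Filter Topology

noncomputable section

lemma phaseVelocity_congr {c d : ℝ → PhasePoint} {t : ℝ} (h : c =ᶠ[𝓝 t] d) :
    phaseVelocity c t = phaseVelocity d t := by
  have e : ∀ F : PhasePoint → ℝ, deriv (fun τ => F (c τ)) t = deriv (fun τ => F (d τ)) t :=
    fun F => (h.fun_comp F).deriv_eq
  refine PhasePoint.ext_fields ?_ ?_ ?_ ?_ ?_ ?_ ?_ ?_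
  · ext x i j
    exact e fun m => m.q x i j
  · ext x i j
    exact e fun m => m.P x i j
  · ext x
    exact e fun m => m.N x
  · ext x
    exact e fun m => m.PiN x
  · ext x i
    exact e fun m => m.shift x i
  · ext x i
    exact e fun m => m.PiShift x i
  · ext x
    exact e fun m => m.phi x
  · ext x
    exact e fun m => m.piPhi x

lemma FlatHamiltonEquations.congr {M : Model} {bg : Background} {t : ℝ} {s : ScalarPert}
    {o o' : ℝ → ScalarPert} {x : Space} (h : FlatHamiltonEquations M bg t s o x)
    (h1 : o' t = o t) (h2 : dt o' t = dt o t) : FlatHamiltonEquations M bg t s o' x := by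
  obtain ⟨e1, e2, e3, e4, e5, e6, e7, e8, e9, e10⟩ := h
  constructor <;> rw [h2] <;> simpa only [h1]

section Evolution

variable {M : Model} {bg : Background} {I : Set ℝ} {t a : ℝ}

/-! ### The constraints in terms of the observables -/

/-- The linearized constraints are gauge invariant, so they can be rewritten through observables. In
the flat gauge the momentum terms combine into the observable lapse. -/
lemma diffeoScalar_flatObservables (hbg : bg.IsSolution M I) (ht : t ∈ I) (ha : 0 < a)
    (hA : bg.A t = a ^ 2) {s : ScalarPert} (hs : s.IsDecaying) (x : Space) :
    diffeoScalar M a (bg.Pt t) (bg.piPhi t) (scale bg t s) x =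
      -4 * a ^ 3 * bg.H t / bg.N t * flatObservables M bg t s .phi x
        + M.kappa * bg.piPhi t * flatObservables M bg t s .dphi x := by
  have hN := (hbg.N_pos t ht).ne'
  have hH := hbg.H_ne_zero t ht
  have hκ := M.kappa_pos.ne'
  have hZ : s .psi x = subLapThird (s .psi) (s .E) x + lap (s .E) x / 3 := by
    rw [subLapThird]
    ring
  rw [flatObservables_phi_explicit hbg ht ha hA hs, flatObservables_dphi ha hA]
  simp only [diffeoScalar, scale_apply, scaleFactor, lap_const_mul _ (hs _).1, hA,
    hbg.Pt_eq ht ha hA, hbg.p_eq ht ha hA, hZ]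
  field_simp
  ring

/-- The curvature term is gone because ψ - ΔE/3 vanishes at the observables, so the constraint is
algebraic in them. -/
lemma hamiltonianScalar_flatObservables (hbg : bg.IsSolution M I) (ht : t ∈ I) (ha : 0 < a)
    (hA : bg.A t = a ^ 2) {s : ScalarPert} (hs : s.IsDecaying) (x : Space) :
    hamiltonianScalar M a (bg.Pt t) (bg.phi t) (bg.piPhi t) (scale bg t s) x =
      -24 * a ^ 3 * bg.H t ^ 2 / bg.N t ^ 2 * flatObservables M bg t s .pPsi x
        + M.kappa * (M.lam * bg.piPhi t / a ^ 3 * flatObservables M bg t s .dpi x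
          + a ^ 3 * deriv M.V (bg.phi t) / (2 * M.lam) * flatObservables M bg t s .dphi x) := by
  have hN := (hbg.N_pos t ht).ne'
  have hH := hbg.H_ne_zero t ht
  have hκ := M.kappa_pos.ne'
  have hl := M.lam_ne_zero
  have hZ : s .psi x = subLapThird (s .psi) (s .E) x + lap (s .E) x / 3 := by
    rw [subLapThird]
    ring
  have hLZ := ((hs .psi).subLapThird (hs .E)).1
  rw [flatObservables_pPsi hbg ht ha hA hs, flatObservables_dphi ha hA,
    flatObservables_dpi hbg ht ha hA]
  simp only [hamiltonianScalar, scale_apply, scaleFactor, subLapThird_const_mul _ (hs .E).1,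
    lap_const_mul _ hLZ, hA, hbg.Pt_eq ht ha hA, hbg.p_eq ht ha hA, hbg.V_eq ht ha hA, hZ]
  field_simp
  ring

/-- The linearized constraints fix the lapse and the trace of the momentum in terms of the scalar
field perturbation. -/
lemma OnConstraintSurface.flatObservables_eq (hbg : bg.IsSolution M I) (ht : t ∈ I) (ha : 0 < a)
    (hA : bg.A t = a ^ 2) {s : ScalarPert} (hs : s.IsDecaying)
    (h : OnConstraintSurface M bg t s) (x : Space) :
    flatObservables M bg t s .phi x = M.kappa * bg.N t * bg.piPhi t / (4 * a ^ 3 * bg.H t)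
        * flatObservables M bg t s .dphi x ∧
      flatObservables M bg t s .pPsi x = M.kappa * bg.N t ^ 2 / (24 * a ^ 3 * bg.H t ^ 2)
        * (M.lam * bg.piPhi t / a ^ 3 * flatObservables M bg t s .dpi x
          + a ^ 3 * deriv M.V (bg.phi t) / (2 * M.lam) * flatObservables M bg t s .dphi x) := by
  have hN := (hbg.N_pos t ht).ne'
  have hH := hbg.H_ne_zero t ht
  have hl := M.lam_ne_zero
  obtain ⟨-, -, h1, h2⟩ := (onConstraintSurface_iff ha hA hN hs).1 h
  have h1 := h1 x
  have h2 := h2 x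
  rw [hamiltonianScalar_flatObservables hbg ht ha hA hs] at h1
  rw [diffeoScalar_flatObservables hbg ht ha hA hs] at h2
  constructor
  · field_simp at h2 ⊢
    linarith
  · field_simp at h1 ⊢
    linarith

/-! ### Hamilton's equations of the observables -/

variable {s : ℝ → ScalarPert} {dl dlHat : ℝ → Space → ℝ}

/-- The linearized Hamilton equations in explicit form. -/
lemma IsLinearizedSolution.dt_eq (h : IsLinearizedSolution M bg I s dl dlHat)
    (hbg : bg.IsSolution M I) (hI : IsOpen I) (ht : t ∈ I) (ha : 0 < a) (hA : bg.A t = a ^ 2) :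
    dt s t = linearFlow M bg t a (s t) (dl t) (dlHat t) := by
  obtain ⟨h1, h2, h3⟩ := h.2 t ht
  exact (linearizedHamiltonAt_iff_velocity hbg hI ht ha hA (h.1.2 t ht).1 (h.1.2 t ht).2
    (h.1.hasVelocity hI ht) h1 h2).1 h3

variable (hs : IsLinearizedSolution M bg I s dl dlHat) (hbg : bg.IsSolution M I) (hI : IsOpen I)
  (ht : t ∈ I) (ha : 0 < a) (hA : bg.A t = a ^ 2)

include hs hbg hI ht ha hA

/-- Follows by differentiating O_φ = -2 O_{p_ψ} - (4/3)ΔO_{p_E}; the terms with ΔO_φ from the two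
rates cancel. -/
lemma IsLinearizedSolution.hasDerivAt_phi (x : Space) :
    HasDerivAt (fun τ => flatObservables M bg τ (s τ) .phi x)
      (M.kappa * bg.N t ^ 2 * bg.p M t / (2 * bg.H t) * flatObservables M bg t (s t) .phi x
        + M.kappa * bg.N t ^ 2 / (4 * bg.H t)
          * matterSource M bg t a (flatObservables M bg t (s t)) x) t := by
  have hH := hbg.H_ne_zero t ht
  have hd := (hs.1.2 t ht).1
  have hod := isDecaying_flatObservables (M := M) (bg := bg) (t := t) hd
  have hflow := hs.dt_eq hbg hI ht ha hA
  have hadm := isAdmissibleCurve_iff.1 (isAdmissibleCurve_flatObservables (M := M) hbg hI hs.1)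
  have h1 := ((hasDerivAt_flatObservables_pPsi hbg hI ht ha hA hs.1 hflow x).const_mul (-2)).fun_sub
    (((hadm .pE).hasDerivAt_lap hI ht x).const_mul (4 / 3))
  refine (h1.congr_of_eventuallyEq ?_).congr_deriv ?_
  · filter_upwards [hI.mem_nhds ht] with τ hτ
    obtain ⟨b, hb, hB⟩ := hbg.exists_sqrt hτ
    rw [flatObservables_phi hbg hτ hb hB (hs.1.2 τ hτ).1]
  · have e : (fun y => deriv (fun τ => flatObservables M bg τ (s τ) .pE y) t) = _ :=
      funext fun y => (hasDerivAt_flatObservables_pE hbg hI ht ha hA hs.1 hflow y).deriv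
    rw [e, lap_sub ((hod .pE).const_mul _).1 ((hod .phi).const_mul _).1,
      lap_const_mul _ (hod .pE).1, lap_const_mul _ (hod .phi).1,
      flatObservables_phi hbg ht ha hA hd]
    field_simp
    ring

lemma IsLinearizedSolution.hasDerivAt_B (x : Space) :
    HasDerivAt (fun τ => flatObservables M bg τ (s τ) .B x)
      ((4 * deriv bg.N t * bg.H t / bg.N t - 12 * bg.H t ^ 2) * flatObservables M bg t (s t) .pE x
        - bg.N t ^ 2 / a ^ 2 * flatObservables M bg t (s t) .phi x) t := by
  have hH := hbg.H_ne_zero t ht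
  have hN := (hbg.N_pos t ht).ne'
  have h1 := ((hbg.hasDerivAt_H hI ht).const_mul 4).fun_mul
    (hasDerivAt_flatObservables_pE hbg hI ht ha hA hs.1 (hs.dt_eq hbg hI ht ha hA) x)
  refine (h1.congr_of_eventuallyEq ?_).congr_deriv ?_
  · filter_upwards [hI.mem_nhds ht] with τ hτ
    obtain ⟨b, hb, hB⟩ := hbg.exists_sqrt hτ
    rw [flatObservables_B hbg hτ hb hB]
  · field_simp
    ring

omit hs hI in
lemma lap_upsilon {s : ScalarPert} (hs : s.IsDecaying) (x : Space) :
    lap (upsilon M bg t s) x = lap (flatObservables M bg t s .pPsi) x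
      - (a ^ 2 * bg.H t ^ 2 / bg.N t ^ 2 + M.kappa / 2 * a ^ 2 * bg.p M t)
        * lap (flatObservables M bg t s .pE) x
      + 2 / 3 * lap (lap (flatObservables M bg t s .pE)) x := by
  have ho := isDecaying_flatObservables (M := M) (bg := bg) (t := t) hs
  rw [funext (upsilon_eq (M := M) hbg ht ha hA hs), lap_add
    ((ho .pPsi).sub ((ho .pE).const_mul _)).1 ((ho .pE).lap.const_mul _).1,
    lap_sub (ho .pPsi).1 ((ho .pE).const_mul _).1, lap_const_mul _ (ho .pE).1,
    lap_const_mul _ (ho .pE).lap.1]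

omit hs hI hbg ht ha in
lemma deltaT_flatObservables (s : ScalarPert) (x : Space) :
    deltaT M bg t (flatObservables M bg t s) x =
      matterSource M bg t a (flatObservables M bg t s) x := by
  rw [deltaT, matterSource, hA]
  simp only [flatObservables]
  ring

omit hs hI in
-- The right-hand side is N O_φ' + N' O_φ, the multiplier that the equation for φ demands along the
-- observables. Likewise `obsMultiplierHat_eq` is the rate of O_B.
lemma obsMultiplier_eq {s : ScalarPert} (hs : s.IsDecaying) (x : Space) :
    obsMultiplier M bg t s (flatObservables M bg t s) x =
      (deriv bg.N t + M.kappa * bg.N t ^ 3 * bg.p M t / (2 * bg.H t))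
        * flatObservables M bg t s .phi x
      + M.kappa * bg.N t ^ 3 / (4 * bg.H t)
        * matterSource M bg t a (flatObservables M bg t s) x := by
  have hH := hbg.H_ne_zero t ht
  have hN := (hbg.N_pos t ht).ne'
  rw [obsMultiplier, deltaT_flatObservables hA, flatObservables_phi hbg ht ha hA hs,
    upsilon_eq hbg ht ha hA hs, bardeenPsi_eq (M := M) hbg ht ha hA]
  field_simp
  ring

omit hs hI in
lemma obsMultiplierHat_eq {s : ScalarPert} (hs : s.IsDecaying) (x : Space) :
    obsMultiplierHat M bg t s x =
      (4 * deriv bg.N t * bg.H t / bg.N t - 12 * bg.H t ^ 2) * flatObservables M bg t s .pE x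
        - bg.N t ^ 2 / a ^ 2 * flatObservables M bg t s .phi x := by
  have hH := hbg.H_ne_zero t ht
  have hN := (hbg.N_pos t ht).ne'
  rw [obsMultiplierHat, flatObservables_phi hbg ht ha hA hs,
    upsilon_eq hbg ht ha hA hs, bardeenPsi_eq (M := M) hbg ht ha hA, hA]
  field_simp
  ring

variable (hc : ∀ t ∈ I, OnConstraintSurface M bg t (s t))

include hc

omit ha hA in
lemma IsLinearizedSolution.deriv_pPhi_pB (x : Space) :
    deriv (fun τ => s τ .pPhi x) t = 0 ∧ deriv (fun τ => s τ .pB x) t = 0 := by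
  have h : ∀ τ ∈ I, s τ .pPhi x = 0 ∧ s τ .pB x = 0 := fun τ hτ => by
    obtain ⟨b, hb, hB⟩ := hbg.exists_sqrt hτ
    have := (onConstraintSurface_iff hb hB (hbg.N_pos τ hτ).ne' (hs.1.2 τ hτ).1).1 (hc τ hτ)
    exact ⟨this.1 x, this.2.1 x⟩
  constructor
  · refine ((hasDerivAt_const t (0 : ℝ)).congr_of_eventuallyEq ?_).deriv
    filter_upwards [hI.mem_nhds ht] with τ hτ using (h τ hτ).1
  · refine ((hasDerivAt_const t (0 : ℝ)).congr_of_eventuallyEq ?_).deriv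
    filter_upwards [hI.mem_nhds ht] with τ hτ using (h τ hτ).2

/-- Only a change of coordinates from the observables of p_ψ and p_E back to Υ and Ψ. The constraint
surface matters just for the momenta of lapse and shift. -/
lemma IsLinearizedSolution.flatHamiltonEquations (x : Space) :
    FlatHamiltonEquations M bg t (s t) (fun τ => flatObservables M bg τ (s τ)) x := by
  have hH := hbg.H_ne_zero t ht
  have hN := (hbg.N_pos t ht).ne'
  have hl := M.lam_ne_zero
  have hd := (hs.1.2 t ht).1
  have hod := isDecaying_flatObservables (M := M) (bg := bg) (t := t) hd
  have hflow := hs.dt_eq hbg hI ht ha hA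
  have hr := rpow_three_halves ha hA
  have hφ := flatObservables_phi (M := M) hbg ht ha hA hd x
  have hΥ := upsilon_eq (M := M) hbg ht ha hA hd x
  have hΨ := bardeenPsi_eq (M := M) (s := s t) hbg ht ha hA x
  have hΔΨ := lap_bardeenPsi (M := M) hbg ht ha hA hd x
  have hΔΥ := lap_upsilon (M := M) hbg ht ha hA hd x
  refine ⟨?_, ?_, ?_, ?_, ?_, ?_, ?_, ?_, ?_, ?_⟩
  · refine (hs.hasDerivAt_phi hbg hI ht ha hA x).deriv.trans ?_
    rw [deltaT_flatObservables hA, hφ, hΥ, hΨ]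
    field_simp
    ring
  · exact (hs.deriv_pPhi_pB hbg hI ht hc x).1
  · exact deriv_const t 0
  · refine (hasDerivAt_flatObservables_pPsi hbg hI ht ha hA hs.1 hflow x).deriv.trans ?_
    have e : lap (flatObservables M bg t (s t) .phi) x
        = -2 * lap (flatObservables M bg t (s t) .pPsi) x
          - 4 / 3 * lap (lap (flatObservables M bg t (s t) .pE)) x := by
      rw [funext (flatObservables_phi (M := M) hbg ht ha hA hd),
        lap_sub ((hod .pPsi).const_mul _).1 ((hod .pE).lap.const_mul _).1,
        lap_const_mul _ (hod .pPsi).1, lap_const_mul _ (hod .pE).lap.1]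
    rw [deltaT_flatObservables hA, e, hφ, hΔΥ, hΥ, hΔΨ, hΨ, hA]
    field_simp
    ring
  · exact deriv_const t 0
  · refine (hasDerivAt_flatObservables_pE hbg hI ht ha hA hs.1 hflow x).deriv.trans ?_
    rw [hφ, hΥ, hΨ, hA]
    field_simp
    ring
  · refine (hs.hasDerivAt_B hbg hI ht ha hA x).deriv.trans ?_
    rw [obsMultiplierHat_eq hbg ht ha hA hd]
  · exact (hs.deriv_pPhi_pB hbg hI ht hc x).2
  · refine (hasDerivAt_flatObservables_dphi hbg hI ht ha hA hs.1 hflow x).deriv.trans ?_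
    rw [hφ, hΥ, hΨ, hr]
    field_simp
    ring
  · refine (hasDerivAt_flatObservables_dpi hbg hI ht ha hA hs.1 hflow x).deriv.trans ?_
    rw [hφ, hΥ, hΔΨ, hΨ, hr, hA]
    field_simp
    ring

/-- The observables satisfy the linearized Hamilton equations. -/
lemma IsLinearizedSolution.linearizedHamiltonAt :
    LinearizedHamiltonAt M bg t (fun τ => flatObservables M bg τ (s τ))
      (obsMultiplier M bg t (s t) (flatObservables M bg t (s t)))
      (obsMultiplierHat M bg t (s t)) := by
  have hH := hbg.H_ne_zero t ht
  have hN := (hbg.N_pos t ht).ne'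
  have hl := M.lam_ne_zero
  have hd := (hs.1.2 t ht).1
  have hod := isDecaying_flatObservables (M := M) (bg := bg) (t := t) hd
  have hflow := hs.dt_eq hbg hI ht ha hA
  have hadm := isAdmissibleCurve_flatObservables (M := M) hbg hI hs.1
  have e1 := funext (obsMultiplier_eq (M := M) hbg ht ha hA hd)
  have e2 := funext (obsMultiplierHat_eq (M := M) hbg ht ha hA hd)
  have hl1 : Decaying (obsMultiplier M bg t (s t) (flatObservables M bg t (s t))) := by
    rw [e1]
    exact ((hod .phi).const_mul _).add ((((hod .dpi).const_mul _).sub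
      ((hod .dphi).const_mul _)).const_mul _)
  have hl2 : Decaying (obsMultiplierHat M bg t (s t)) := by
    rw [e2]
    exact ((hod .pE).const_mul _).sub ((hod .phi).const_mul _)
  rw [linearizedHamiltonAt_iff_velocity hbg hI ht ha hA hod (hadm.2 t ht).2
    (hadm.hasVelocity hI ht) hl1 hl2]
  have oB := funext (flatObservables_B (M := M) (s := s t) hbg ht ha hA)
  have opsi : flatObservables M bg t (s t) .psi = fun _ => 0 := rfl
  have oE : flatObservables M bg t (s t) .E = fun _ => 0 := rfl
  have hz := hs.deriv_pPhi_pB hbg hI ht hc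
  have hs0 := (onConstraintSurface_iff ha hA hN hd).1 (hc t ht)
  have hcs := fun x => (hc t ht).flatObservables_eq hbg ht ha hA hd x
  ext k x
  cases k
  case psi =>
    refine (deriv_const t 0).trans ?_
    simp only [linearFlow, oB, opsi, lap_const_mul _ (hod .pE).1,
      flatObservables_phi hbg ht ha hA hd]
    ring
  case pPsi =>
    refine (hasDerivAt_flatObservables_pPsi hbg hI ht ha hA hs.1 hflow x).deriv.trans ?_
    simp only [linearFlow, oB, opsi, oE, lap_const_mul _ (hod .pE).1, subLapThird_zero, lap_zero]
    ring
  case E =>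
    refine (deriv_const t 0).trans ?_
    simp only [linearFlow, oB, oE]
    ring
  case pE =>
    refine (hasDerivAt_flatObservables_pE hbg hI ht ha hA hs.1 hflow x).deriv.trans ?_
    simp only [linearFlow, oB, opsi, oE, subLapThird_zero]
    ring
  case phi =>
    refine (hs.hasDerivAt_phi hbg hI ht ha hA x).deriv.trans ?_
    simp only [linearFlow, e1]
    field_simp
    ring
  -- The flow of p_φ at the observables is minus their linearized Hamiltonian constraint over N, up
  -- to a multiple of p_φ. It vanishes by the solved form of the constraints; `pB` is the same with
  -- the diffeomorphism constraint.
  case pPhi =>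
    refine (hz x).1.trans ?_
    have h1 : flatObservables M bg t (s t) .pPhi x = 0 := hs0.1 x
    have h2 : hamiltonianScalar M a (bg.Pt t) (bg.phi t) (bg.piPhi t)
        (scale bg t (flatObservables M bg t (s t))) x = 0 := by
      have := (hcs x).2
      simp only [hamiltonianScalar, scale_apply, scaleFactor, opsi, oE, mul_zero,
        subLapThird_zero, lap_zero, hbg.Pt_eq ht ha hA, this]
      field_simp
      ring
    simp only [linearFlow, h1, h2]
    ring
  case B =>
    refine (hs.hasDerivAt_B hbg hI ht ha hA x).deriv.trans ?_
    simp only [linearFlow, e2]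
  case pB =>
    refine (hz x).2.trans ?_
    have h2 : diffeoScalar M a (bg.Pt t) (bg.piPhi t)
        (scale bg t (flatObservables M bg t (s t))) x = 0 := by
      have := (hcs x).1
      have hφ := flatObservables_phi (M := M) hbg ht ha hA hd x
      rw [this] at hφ
      simp only [diffeoScalar, scale_apply, scaleFactor, opsi, oE, mul_zero, lap_zero,
        lap_const_mul _ (hod .pE).1, hbg.Pt_eq ht ha hA]
      have h3 : flatObservables M bg t (s t) .pPsi x = -(1 / 2) * (M.kappa * bg.N t * bg.piPhi t
          / (4 * a ^ 3 * bg.H t) * flatObservables M bg t (s t) .dphi x)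
          - 2 / 3 * lap (flatObservables M bg t (s t) .pE) x := by linarith
      rw [h3]
      field_simp
      ring
    simp only [linearFlow, h2]
    ring
  case dphi =>
    refine (hasDerivAt_flatObservables_dphi hbg hI ht ha hA hs.1 hflow x).deriv.trans ?_
    simp only [linearFlow, opsi]
    ring
  case dpi =>
    refine (hasDerivAt_flatObservables_dpi hbg hI ht ha hA hs.1 hflow x).deriv.trans ?_
    simp only [linearFlow, opsi, oB, lap_const_mul _ (hod .pE).1]
    ring

/-- The Mukhanov-Sasaki equation. -/
lemma IsLinearizedSolution.mukhanovSasaki (x : Space) :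
    deriv (deriv fun τ => flatObservables M bg τ (s τ) .dphi x) t =
      bg.N t ^ 2 / bg.A t * lap (flatObservables M bg t (s t) .dphi) x
      + (deriv bg.N t / bg.N t - 3 * bg.H t)
        * deriv (fun τ => flatObservables M bg τ (s τ) .dphi x) t
      + (M.kappa ^ 2 / 8 * (deriv bg.phi t ^ 4 / (M.lam ^ 2 * bg.H t ^ 2))
          - 3 * M.kappa / 2 * (deriv bg.phi t ^ 2 / M.lam)
          - M.kappa / 2 * (bg.N t ^ 2 * deriv bg.phi t / (M.lam * bg.H t)) * deriv M.V (bg.phi t)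
          - bg.N t ^ 2 / 2 * deriv (deriv M.V) (bg.phi t)) * flatObservables M bg t (s t) .dphi x := by
  have hH := hbg.H_ne_zero t ht
  have hN := (hbg.N_pos t ht).ne'
  have hl := M.lam_ne_zero
  have hκ := M.kappa_pos.ne'
  have hd := (hs.1.2 t ht).1
  have hflow := hs.dt_eq hbg hI ht ha hA
  have hsq : Real.sqrt (bg.A t) = a := by rw [hA, Real.sqrt_sq ha.le]
  have hden : Real.sqrt (bg.A t) ^ 3 ≠ 0 := by
    rw [hsq]
    exact pow_ne_zero 3 ha.ne'
  -- The first-order equation holds on a neighbourhood, so it may be differentiated again. There √A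
  -- must be kept as a function of time instead of the fixed number a.
  have h1 : deriv (fun τ => flatObservables M bg τ (s τ) .dphi x) =ᶠ[𝓝 t] fun τ =>
      bg.N τ * M.lam / Real.sqrt (bg.A τ) ^ 3 * (flatObservables M bg τ (s τ) .dpi x
        + bg.piPhi τ * flatObservables M bg τ (s τ) .phi x) := by
    filter_upwards [hI.mem_nhds ht] with τ hτ
    have hb := Real.sqrt_pos.2 (hbg.A_pos τ hτ)
    have hB := (Real.sq_sqrt (hbg.A_pos τ hτ).le).symm
    exact (hasDerivAt_flatObservables_dphi hbg hI hτ hb hB hs.1 (hs.dt_eq hbg hI hτ hb hB) x).deriv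
  have h2 := (((hbg.hasDerivAt_N hI ht).mul_const M.lam).fun_div
    ((hbg.hasDerivAt_sqrt_A hI ht ha hA).fun_pow 3) hden).fun_mul
    ((hasDerivAt_flatObservables_dpi hbg hI ht ha hA hs.1 hflow x).fun_add
      ((hbg.hasDerivAt_piPhi hI ht ha hA).fun_mul (hs.hasDerivAt_phi hbg hI ht ha hA x)))
  obtain ⟨c1, c2⟩ := (hc t ht).flatObservables_eq hbg ht ha hA hd x
  -- The relation between O_φ, O_{p_ψ} and ΔO_{p_E} removes the last function not determined by v
  -- and π_v; the remaining π_v terms are accounted for by the v' term.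
  have c3 : lap (flatObservables M bg t (s t) .pE) x =
      -(3 / 4) * flatObservables M bg t (s t) .phi x
        - 3 / 2 * flatObservables M bg t (s t) .pPsi x := by
    rw [flatObservables_phi hbg ht ha hA hd]
    ring
  rw [(h2.congr_of_eventuallyEq h1).deriv,
    (hasDerivAt_flatObservables_dphi hbg hI ht ha hA hs.1 hflow x).deriv, hsq,
    (hbg.hasDerivAt_phi hI ht ha hA).deriv, c3, matterSource, c2, c1, hA, hbg.p_eq ht ha hA]
  field_simp
  ring

/-- The Mukhanov-Sasaki equation in proper time. -/
lemma IsLinearizedSolution.mukhanovSasaki_properTime (hN1 : ∀ t ∈ I, bg.N t = 1) {U : ℝ → ℝ}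
    (hU : ∀ y, M.V y = 2 * U y) (x : Space) :
    deriv (deriv fun τ => flatObservables M bg τ (s τ) .dphi x) t
      + 3 * bg.H t * deriv (fun τ => flatObservables M bg τ (s τ) .dphi x) t
      - lap (flatObservables M bg t (s t) .dphi) x / bg.A t
      + (deriv (deriv U) (bg.phi t)
          - M.kappa / (2 * M.lam) / bg.A t ^ (3 / 2 : ℝ)
            * deriv (fun τ => bg.A τ ^ (3 / 2 : ℝ) * deriv bg.phi τ ^ 2 / bg.H τ) t)
        * flatObservables M bg t (s t) .dphi x = 0 := by
  have hH := hbg.H_ne_zero t ht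
  have hl := M.lam_ne_zero
  have hκ := M.kappa_pos.ne'
  have hsq : Real.sqrt (bg.A t) = a := by rw [hA, Real.sqrt_sq ha.le]
  have hden : Real.sqrt (bg.A t) ^ 3 * bg.H t ≠ 0 := by
    rw [hsq]
    exact mul_ne_zero (pow_ne_zero 3 ha.ne') hH
  have hdN : deriv bg.N t = 0 := by
    refine ((hasDerivAt_const t (1 : ℝ)).congr_of_eventuallyEq ?_).deriv
    filter_upwards [hI.mem_nhds ht] with τ hτ using hN1 τ hτ
  have hV : deriv (deriv M.V) (bg.phi t) = 2 * deriv (deriv U) (bg.phi t) := by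
    have e : M.V = fun y => 2 * U y := funext hU
    have e' : deriv M.V = fun y => 2 * deriv U y := by
      ext y
      rw [e, deriv_const_mul_field]
    rw [e', deriv_const_mul_field]
  -- Substituting φ' = λπ/A^(3/2) first avoids second derivatives of the background scalar: only π,
  -- √A and H need to be differentiated.
  have h1 : (fun τ => bg.A τ ^ (3 / 2 : ℝ) * deriv bg.phi τ ^ 2 / bg.H τ) =ᶠ[𝓝 t] fun τ =>
      M.lam ^ 2 * bg.piPhi τ ^ 2 / (Real.sqrt (bg.A τ) ^ 3 * bg.H τ) := by
    filter_upwards [hI.mem_nhds ht] with τ hτ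
    have hb := Real.sqrt_pos.2 (hbg.A_pos τ hτ)
    have hB := (Real.sq_sqrt (hbg.A_pos τ hτ).le).symm
    have hHτ := hbg.H_ne_zero τ hτ
    rw [(hbg.hasDerivAt_phi hI hτ hb hB).deriv, rpow_three_halves hb hB, hN1 τ hτ]
    field_simp
  have h2 := (((hbg.hasDerivAt_piPhi hI ht ha hA).fun_pow 2).const_mul (M.lam ^ 2)).fun_div
    (((hbg.hasDerivAt_sqrt_A hI ht ha hA).fun_pow 3).fun_mul (hbg.hasDerivAt_H hI ht)) hden
  rw [hs.mukhanovSasaki hbg hI ht ha hA hc x, (h2.congr_of_eventuallyEq h1).deriv,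
    rpow_three_halves ha hA, (hbg.hasDerivAt_phi hI ht ha hA).deriv, hV, hsq, hdN, hA,
    hbg.p_eq ht ha hA, hN1 t ht]
  field_simp
  ring

end Evolution

end

end CosmoPert

/-! ### The main theorem -/

theorem mainTheorem4 (M : Model) (bg : Background) (I : Set ℝ) (hI : IsOpen I)
    (hbg : bg.IsSolution M I) :
    -- the matrix `{T^μ, C_ν}` of the clocks of the spatially flat gauge is the identity
    (∀ t ∈ I, ∀ (xi beta chi chiB : Space → ℝ) (g : ScalarPert),
      Decaying xi → Decaying beta → Decaying chi → Decaying chiB →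
      IsGaugeVector M bg t xi beta chi chiB g →
      ∀ x, clock0 bg t g x = xi x ∧ ∀ a, clockVec g a x = pd a beta x) ∧
    -- the observable map is well defined and given by the table of the spatially flat gauge
    (∀ t ∈ I, ∀ s : ScalarPert, s.IsDecaying →
      ∀ o : ScalarPert, IsDiracObservable M bg t s o ↔ o = flatObservables M bg t s) ∧
    -- evolution of the observables along solutions on the constraint surface
    ∀ (s : ℝ → ScalarPert) (dl dlHat : ℝ → Space → ℝ),
      IsLinearizedSolution M bg I s dl dlHat →
      (∀ t ∈ I, OnConstraintSurface M bg t (s t)) →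
      ∀ o : ℝ → ScalarPert, (∀ t ∈ I, IsDiracObservable M bg t (s t) (o t)) →
        IsAdmissibleCurve I o ∧
        -- `d/dt O_f = O_{{f, H_can}}`
        (∀ t ∈ I, LinearizedHamiltonAt M bg t o
          (obsMultiplier M bg t (s t) (o t)) (obsMultiplierHat M bg t (s t))) ∧
        (∀ t ∈ I, ∀ x, FlatHamiltonEquations M bg t (s t) o x) ∧
        -- the Mukhanov-Sasaki equation for `v = O_{δφ}`
        (∀ t ∈ I, ∀ x,
          deriv (deriv fun τ => o τ .dphi x) t =
            bg.N t ^ 2 / bg.A t * lap (o t .dphi) x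
            + (deriv bg.N t / bg.N t - 3 * bg.H t) * deriv (fun τ => o τ .dphi x) t
            + (M.kappa ^ 2 / 8 * (deriv bg.phi t ^ 4 / (M.lam ^ 2 * bg.H t ^ 2))
                - 3 * M.kappa / 2 * (deriv bg.phi t ^ 2 / M.lam)
                - M.kappa / 2 * (bg.N t ^ 2 * deriv bg.phi t / (M.lam * bg.H t))
                    * deriv M.V (bg.phi t)
                - bg.N t ^ 2 / 2 * deriv (deriv M.V) (bg.phi t)) * o t .dphi x) ∧
        -- its proper-time form, with the usual potential `U = V / 2`
        ((∀ t ∈ I, bg.N t = 1) → ∀ U : ℝ → ℝ, (∀ y, M.V y = 2 * U y) → ∀ t ∈ I, ∀ x,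
          deriv (deriv fun τ => o τ .dphi x) t
            + 3 * bg.H t * deriv (fun τ => o τ .dphi x) t
            - lap (o t .dphi) x / bg.A t
            + (deriv (deriv U) (bg.phi t)
                - M.kappa / (2 * M.lam) / bg.A t ^ (3 / 2 : ℝ)
                  * deriv (fun τ => bg.A τ ^ (3 / 2 : ℝ) * deriv bg.phi τ ^ 2 / bg.H τ) t)
              * o t .dphi x = 0) := by
  refine ⟨fun t ht xi beta chi chiB g h1 h2 h3 h4 hg x =>
    clock_gaugeVector hbg ht h1 h2 h3 h4 hg x, fun t ht s hs o =>
    isDiracObservable_iff hbg hI ht hs o, fun s dl dlHat hs hc o ho => ?_⟩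
  have hos : ∀ t ∈ I, o t = flatObservables M bg t (s t) := fun t ht =>
    (isDiracObservable_iff hbg hI ht (hs.1.2 t ht).1 _).1 (ho t ht)
  have hadm := isAdmissibleCurve_flatObservables (M := M) hbg hI hs.1
  have hoadm : IsAdmissibleCurve I o := isAdmissibleCurve_iff.2 fun k =>
    (isAdmissibleCurve_iff.1 hadm k).congr hI fun t ht => by rw [hos t ht]
  -- The curve o is pinned to the table only for times in I. As I is open, the two curves agree near
  -- each such time, which transfers first and second time derivatives.
  have hev : ∀ t ∈ I, o =ᶠ[nhds t] fun τ => flatObservables M bg τ (s τ) := fun t ht => by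
    filter_upwards [hI.mem_nhds ht] with τ hτ using hos τ hτ
  have hev' : ∀ t ∈ I, ∀ k x, (fun τ => o τ k x) =ᶠ[nhds t]
      fun τ => flatObservables M bg τ (s τ) k x := fun t ht k x =>
    (hev t ht).mono fun τ hτ => congrArg (fun m : ScalarPert => m k x) hτ
  have hdt : ∀ t ∈ I, dt o t = dt (fun τ => flatObservables M bg τ (s τ)) t := fun t ht => by
    ext k x
    exact (hev' t ht k x).deriv_eq
  have hd2 : ∀ t ∈ I, ∀ x, deriv (deriv fun τ => o τ .dphi x) t =
      deriv (deriv fun τ => flatObservables M bg τ (s τ) .dphi x) t := fun t ht x =>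
    (hev' t ht .dphi x).deriv.deriv_eq
  refine ⟨hoadm, fun t ht => ?_, fun t ht x => ?_, fun t ht x => ?_, fun hN U hU t ht x => ?_⟩ <;>
    obtain ⟨a, ha, hA⟩ := hbg.exists_sqrt ht
  · have hO := hs.linearizedHamiltonAt hbg hI ht ha hA hc
    rw [hos t ht]
    rw [LinearizedHamiltonAt] at hO ⊢
    have e : phaseVelocity (fun τ => embed bg τ (o τ)) t =
        phaseVelocity (fun τ => embed bg τ (flatObservables M bg τ (s τ))) t :=
      phaseVelocity_congr ((hev t ht).mono fun τ hτ => congrArg (embed bg τ) hτ)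
    rw [e, hos t ht]
    exact hO
  · have hF := hs.flatHamiltonEquations hbg hI ht ha hA hc x
    exact hF.congr (hos t ht) (hdt t ht)
  · rw [hd2 t ht x, (hev' t ht .dphi x).deriv_eq, hos t ht]
    exact hs.mukhanovSasaki hbg hI ht ha hA hc x
  · rw [hd2 t ht x, (hev' t ht .dphi x).deriv_eq, hos t ht]
    exact hs.mukhanovSasaki_properTime hbg hI ht ha hA hc hN hU x
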